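/- Let $(\overline M,J,\overline g)$ be a locally conformal Kähler (l.c.K.) manifold, i.e. a smooth almost Hermitian manifold in which every point has an open neighbourhood $U$ with a positive smooth function $f_U$ on $U$ such that the metric $\exp(-f_U)\,\overline g|_U$ is Kähler ($J$ is parallel for its Levi-Civita connection). Let $\Omega(X,Y)=\overline g(X,JY)$ be the Kähler 2-form, let $\omega$ be a Lee form, i.e. a smooth closed 1-form on $\overline M$ with $d\Omega=\omega\wedge\Omega$, let $B=\omega^\sharp$ be the Lee vector field ($\overline g(X,B)=\omega(X)$), and let $\theta=\omega\circ J$ and $A=-JB$ be the anti-Lee form and the anti-Lee vector field. Let $M$ be a CR-submanifold of $\overline M$: a (smoothly immersed) submanifold with a differentiable distribution $D\subset TM$ such that $JD_p=D_p$ for all $p\in M$ and such that the orthogonal complement $D^\perp$ of $D$ in $TM$ is totally real, $JD^\perp_p\subset T_p^\perp M$ for all $p\in M$. Let $g$ be the induced metric, let $\overline\nabla$ be the Levi-Civita connection of $\overline g$, let $h(X,Y)$ and $\nabla^\perp_XN$ be the normal components of $\overline\nabla_XY$ and of $\overline\nabla_XN$ ($X,Y$ tangent, $N$ normal to $M$),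 and let $\mu$ be the orthogonal complement of $JD^\perp$ in the normal bundle, so that $TM^\perp=JD^\perp\oplus\mu$. The indices $JD^\perp$ and $\mu$ denote orthogonal projection to these subbundles. Consider the relation $$\theta(Y)\,JX=2\,h_{JD^\perp}(X,Y)\qquad\text{for all } X\in\Gamma(D^\perp),\ Y\in\Gamma(D).\tag{1}$$ Then the following three assertions are equivalent. (i) $M$ is a totally real ruled CR-submanifold: $D^\perp$ is the tangent distribution of a foliation of $M$ (through every point of $M$ there passes a connected integral manifold of $D^\perp$), and the leaves of this foliation (more generally all connected integral manifolds of $D^\perp$, which are the connected open pieces of the leaves) are totally geodesic immersed submanifolds of $(\overline M,\overline g)$, i.e. have vanishing second fundamental form in $\overline M$. (ii) $M$ is $D^\perp$-geodesic, i.e. $h(X,Z)=0$ for all $X,Z\in\Gamma(D^\perp)$, and (1) holds. (iii) The relation (1) holds, $h(X,Z)\in\Gamma(\mu)$ for all $X,Z\in\Gamma(D^\perp)$, and $$(\nabla^\perp_XJZ)_\mu=-\tfrac12\,g(X,Z)\,A_\mu\qquad\text{for all } X,Z\in\Gamma(D^\perp).$$ -/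

import Mathlib

open scoped Manifold ContDiff Bundle

universe u

namespace LCK

noncomputable section

/-! ### Linear algebra of a scalar product -/

section LinearAlgebra

variable {V : Type*} [AddCommGroup V] [Module ℝ V]

/-- The vector `v` with `b v w = α w` for all `w` (it exists and is unique when `b` is a scalar
product on a finite-dimensional space and `α` is linear). -/
def riesz (b : V → V → ℝ) (α : V → ℝ) : V :=
  Classical.epsilon fun v => ∀ w, b v w = α w

/-- The orthogonal complement of `S` with respect to the bilinear form `b`. -/
def orth (b : V →ₗ[ℝ] V →ₗ[ℝ] ℝ) (S : Submodule ℝ V) : Submodule ℝ V where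
  carrier := {v | ∀ w ∈ S, b v w = 0}
  add_mem' := by
    intro x y hx hy w hw
    simp [hx w hw, hy w hw]
  zero_mem' := by
    intro w _
    simp
  smul_mem' := by
    intro c x hx w hw
    simp [hx w hw]

/-- The orthogonal projection of `v` onto `S` (the `S`-component of `v`): the element `u` of `S`
with `v - u` orthogonal to `S`. -/
def proj (b : V →ₗ[ℝ] V →ₗ[ℝ] ℝ) (S : Submodule ℝ V) (v : V) : V :=
  Classical.epsilon fun u => u ∈ S ∧ v - u ∈ orth b S

/-- For a scalar product in finite dimension, `riesz` represents every linear form. -/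
theorem riesz_spec [FiniteDimensional ℝ V] (b : V →ₗ[ℝ] V →ₗ[ℝ] ℝ)
    (hpos : ∀ v, v ≠ 0 → 0 < b v v) (α : V →ₗ[ℝ] ℝ) (w : V) :
    b (riesz (fun x y => b x y) α) w = α w := by
  have hinj : Function.Injective b := by
    rw [injective_iff_map_eq_zero]
    intro v hv
    by_contra h
    have h1 := hpos v h
    rw [hv] at h1
    simp at h1
  have hsurj : Function.Surjective b :=
    (LinearMap.injective_iff_surjective_of_finrank_eq_finrank
      (Subspace.dual_finrank_eq (K := ℝ) (V := V)).symm).1 hinj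
  obtain ⟨v, hv⟩ := hsurj α
  have key : ∃ v, ∀ w, b v w = α w := ⟨v, fun w => by rw [hv]⟩
  exact Classical.epsilon_spec key w

/-- For a scalar product in finite dimension, `proj` is the orthogonal projection. -/
theorem proj_spec [FiniteDimensional ℝ V] (b : V →ₗ[ℝ] V →ₗ[ℝ] ℝ)
    (hpos : ∀ v, v ≠ 0 → 0 < b v v) (S : Submodule ℝ V) (v : V) :
    proj b S v ∈ S ∧ v - proj b S v ∈ orth b S := by
  have hS := riesz_spec (b.domRestrict₁₂ S S)
    (fun u hu => hpos u (fun h => hu (Subtype.ext h))) ((b v).domRestrict S)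
  have key : ∃ u, u ∈ S ∧ v - u ∈ orth b S := by
    refine ⟨(riesz (fun x y => b.domRestrict₁₂ S S x y) ((b v).domRestrict S) : S),
      Subtype.mem _, fun w hw => ?_⟩
    have h := hS ⟨w, hw⟩
    simp only [LinearMap.domRestrict₁₂_apply, LinearMap.domRestrict_apply] at h
    simp only [map_sub, LinearMap.sub_apply]
    rw [sub_eq_zero]
    exact h.symm
  exact Classical.epsilon_spec key

end LinearAlgebra

/-! ### Derivatives in charts and the Levi-Civita connection

Coordinates near a point `x` are those of the preferred chart at `x`; tangent vectors at nearby points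
are read in it through the trivialization of the tangent bundle that it induces. -/

section Connection

variable {F : Type*} [NormedAddCommGroup F] [NormedSpace ℝ F]
  {N : Type*} [TopologicalSpace N] [ChartedSpace F N] [IsManifold 𝓘(ℝ, F) ∞ N]

/-- The vector at `y` which has, in the chart at `x`, the same coordinates as the vector `u` at
`x`: the value at `y` of the vector field with constant coordinates through `u`. -/
def coordField (x : N) (u : TangentSpace 𝓘(ℝ, F) x) (y : N) : TangentSpace 𝓘(ℝ, F) y :=
  (trivializationAt F (TangentSpace 𝓘(ℝ, F)) x).symmL ℝ y
    ((trivializationAt F (TangentSpace 𝓘(ℝ, F)) x).continuousLinearMapAt ℝ x u)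

/-- The partial derivative `∂_w (η(∂_u))` at `x`, in the chart at `x`, of a 1-form. -/
def partial₁ (η : ∀ x : N, TangentSpace 𝓘(ℝ, F) x → ℝ) (x : N)
    (w u : TangentSpace 𝓘(ℝ, F) x) : ℝ :=
  mvfderiv 𝓘(ℝ, F) (fun y => η y (coordField x u y)) x w

/-- The partial derivative `∂_w (b(∂_u, ∂_v))` at `x`, in the chart at `x`, of a covariant
2-tensor. -/
def partial₂ (b : ∀ x : N, TangentSpace 𝓘(ℝ, F) x → TangentSpace 𝓘(ℝ, F) x → ℝ) (x : N)
    (w u v : TangentSpace 𝓘(ℝ, F) x) : ℝ :=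
  mvfderiv 𝓘(ℝ, F) (fun y => b y (coordField x u y) (coordField x v y)) x w

/-- The exterior derivative of a 1-form, in the chart at `x`. -/
def extDeriv₁ (η : ∀ x : N, TangentSpace 𝓘(ℝ, F) x → ℝ) (x : N)
    (u v : TangentSpace 𝓘(ℝ, F) x) : ℝ :=
  partial₁ η x u v - partial₁ η x v u

/-- The exterior derivative of a 2-form, in the chart at `x`. -/
def extDeriv₂ (Ω : ∀ x : N, TangentSpace 𝓘(ℝ, F) x → TangentSpace 𝓘(ℝ, F) x → ℝ) (x : N)
    (u v w : TangentSpace 𝓘(ℝ, F) x) : ℝ :=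
  partial₂ Ω x u v w + partial₂ Ω x v w u + partial₂ Ω x w u v

/-- The wedge product `α ∧ Ω` of a 1-form and a 2-form at `x` (with the normalization of the
exterior derivative above). -/
def wedge₁₂ (α : ∀ x : N, TangentSpace 𝓘(ℝ, F) x → ℝ)
    (Ω : ∀ x : N, TangentSpace 𝓘(ℝ, F) x → TangentSpace 𝓘(ℝ, F) x → ℝ) (x : N)
    (u v w : TangentSpace 𝓘(ℝ, F) x) : ℝ :=
  α x u * Ω x v w + α x v * Ω x w u + α x w * Ω x u v

/-- The Christoffel symbols `Γ(u, v) = Γᵏᵢⱼ uⁱ vʲ ∂ₖ` at `x`, in the chart at `x`, of the metric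
`b`. -/
def christoffel (b : ∀ x : N, TangentSpace 𝓘(ℝ, F) x → TangentSpace 𝓘(ℝ, F) x → ℝ) (x : N)
    (u v : TangentSpace 𝓘(ℝ, F) x) : TangentSpace 𝓘(ℝ, F) x :=
  riesz (b x) fun w => (partial₂ b x u v w + partial₂ b x v u w - partial₂ b x w u v) / 2

variable {E : Type*} [NormedAddCommGroup E] [NormedSpace ℝ E]
  {M : Type*} [TopologicalSpace M] [ChartedSpace E M]

/-- The derivative `w(Vᵏ) ∂ₖ` at `p` of the coordinates, in the chart at `f p`, of a vector field
`V` along the map `f : M → N`. -/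
def coordDeriv (f : M → N) (V : ∀ p : M, TangentSpace 𝓘(ℝ, F) (f p)) (p : M)
    (w : TangentSpace 𝓘(ℝ, E) p) : TangentSpace 𝓘(ℝ, F) (f p) :=
  (trivializationAt F (TangentSpace 𝓘(ℝ, F)) (f p)).symmL ℝ (f p)
    (mvfderiv 𝓘(ℝ, E) (fun q =>
      (trivializationAt F (TangentSpace 𝓘(ℝ, F)) (f p)).continuousLinearMapAt ℝ (f q) (V q)) p w)

/-- The covariant derivative `(∇_w V)(p)` of a vector field `V` along the map `f : M → N`, for the
Levi-Civita connection `∇` of the metric `b` on `N`: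
in the chart at `f p`, `(∇_w V)ᵏ = w(Vᵏ) + Γᵏᵢⱼ (df w)ⁱ Vʲ`. -/
def covAlong (b : ∀ x : N, TangentSpace 𝓘(ℝ, F) x → TangentSpace 𝓘(ℝ, F) x → ℝ) (f : M → N)
    (V : ∀ p : M, TangentSpace 𝓘(ℝ, F) (f p)) (p : M) (w : TangentSpace 𝓘(ℝ, E) p) :
    TangentSpace 𝓘(ℝ, F) (f p) :=
  coordDeriv f V p w + christoffel b (f p) (mfderiv 𝓘(ℝ, E) 𝓘(ℝ, F) f p w) (V p)

/-- The covariant derivative `(∇_w Y)(x)` of a vector field on `N`, for the Levi-Civita connection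
of the metric `b`. -/
def cov (b : ∀ x : N, TangentSpace 𝓘(ℝ, F) x → TangentSpace 𝓘(ℝ, F) x → ℝ)
    (Y : ∀ x : N, TangentSpace 𝓘(ℝ, F) x) (x : N) (w : TangentSpace 𝓘(ℝ, F) x) :
    TangentSpace 𝓘(ℝ, F) x :=
  covAlong (E := F) (M := N) b (fun y : N => y) Y x w

/-- Smooth vector fields. -/
def IsSmoothField (X : ∀ x : N, TangentSpace 𝓘(ℝ, F) x) : Prop :=
  ContMDiff 𝓘(ℝ, F) (𝓘(ℝ, F).prod 𝓘(ℝ, F)) ∞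
    (fun x => (⟨x, X x⟩ : TangentBundle 𝓘(ℝ, F) N))

end Connection

/-! ### Locally conformal Kähler manifolds -/

section Hermitian

variable {F : Type*} [NormedAddCommGroup F] [NormedSpace ℝ F]
  {N : Type*} [TopologicalSpace N] [ChartedSpace F N] [IsManifold 𝓘(ℝ, F) ∞ N]

variable (F N) in
/-- Smooth Riemannian metrics on `N`. -/
abbrev Metric :=
  Bundle.ContMDiffRiemannianMetric 𝓘(ℝ, F) ∞ F (fun x : N => TangentSpace 𝓘(ℝ, F) x)

/-- The metric as a family of functions of two tangent vectors. -/
def Metric.form (g : Metric F N) (x : N) (u v : TangentSpace 𝓘(ℝ, F) x) : ℝ := g.inner x u v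

/-- The scalar product of the metric at `x`, as a bilinear form. -/
def Metric.bilin (g : Metric F N) (x : N) :
    TangentSpace 𝓘(ℝ, F) x →ₗ[ℝ] TangentSpace 𝓘(ℝ, F) x →ₗ[ℝ] ℝ :=
  LinearMap.mk₂ ℝ (fun u v => g.inner x u v) (by simp) (by simp) (by simp) (by simp)

/-- `(N, J, g)` is an almost Hermitian manifold. -/
structure IsAlmostHermitian (g : Metric F N)
    (J : ∀ x : N, TangentSpace 𝓘(ℝ, F) x →L[ℝ] TangentSpace 𝓘(ℝ, F) x) : Prop where
  smooth : ContMDiff 𝓘(ℝ, F) (𝓘(ℝ, F).prod 𝓘(ℝ, F →L[ℝ] F)) ∞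
    (fun x => Bundle.TotalSpace.mk' (F →L[ℝ] F)
      (E := fun x : N => TangentSpace 𝓘(ℝ, F) x →L[ℝ] TangentSpace 𝓘(ℝ, F) x) x (J x))
  sq : ∀ (x : N) (u : TangentSpace 𝓘(ℝ, F) x), J x (J x u) = -u
  isometry : ∀ (x : N) (u v : TangentSpace 𝓘(ℝ, F) x),
    g.inner x (J x u) (J x v) = g.inner x u v

/-- The Hermitian metric `b` is Kähler on the open set `U`: the almost complex structure `J` is
parallel for the Levi-Civita connection of `b`. -/
def IsKahlerOn (b : ∀ x : N, TangentSpace 𝓘(ℝ, F) x → TangentSpace 𝓘(ℝ, F) x → ℝ)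
    (J : ∀ x : N, TangentSpace 𝓘(ℝ, F) x →L[ℝ] TangentSpace 𝓘(ℝ, F) x) (U : Set N) : Prop :=
  ∀ Y : ∀ x : N, TangentSpace 𝓘(ℝ, F) x, IsSmoothField Y →
    ∀ x ∈ U, ∀ w : TangentSpace 𝓘(ℝ, F) x,
      cov b (fun y => J y (Y y)) x w = J x (cov b Y x w)

/-- `(N, J, g)` is a locally conformal Kähler manifold: every point has an open neighbourhood `U`
with a positive smooth function `f` such that `exp(-f) g` is a Kähler metric on `U`. -/
structure IsLCK (g : Metric F N)
    (J : ∀ x : N, TangentSpace 𝓘(ℝ, F) x →L[ℝ] TangentSpace 𝓘(ℝ, F) x) : Prop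
    extends IsAlmostHermitian g J where
  locally_conformal : ∀ p : N, ∃ U : Set N, IsOpen U ∧ p ∈ U ∧ ∃ f : N → ℝ,
    ContMDiffOn 𝓘(ℝ, F) 𝓘(ℝ, ℝ) ∞ f U ∧ (∀ x ∈ U, 0 < f x) ∧
      IsKahlerOn (fun x u v => Real.exp (-f x) * g.form x u v) J U

/-- The Kähler 2-form `Ω(X, Y) = g(X, J Y)`. -/
def kahlerForm (g : Metric F N)
    (J : ∀ x : N, TangentSpace 𝓘(ℝ, F) x →L[ℝ] TangentSpace 𝓘(ℝ, F) x) (x : N)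
    (u v : TangentSpace 𝓘(ℝ, F) x) : ℝ := g.form x u (J x v)

/-- `η` is a Lee form of `(N, J, g)`: a smooth closed 1-form with `dΩ = η ∧ Ω`. -/
structure IsLeeForm (g : Metric F N)
    (J : ∀ x : N, TangentSpace 𝓘(ℝ, F) x →L[ℝ] TangentSpace 𝓘(ℝ, F) x)
    (η : ∀ x : N, TangentSpace 𝓘(ℝ, F) x →L[ℝ] ℝ) : Prop where
  smooth : ContMDiff 𝓘(ℝ, F) (𝓘(ℝ, F).prod 𝓘(ℝ, F →L[ℝ] ℝ)) ∞
    (fun x => Bundle.TotalSpace.mk' (F →L[ℝ] ℝ)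
      (E := fun x : N => TangentSpace 𝓘(ℝ, F) x →L[ℝ] ℝ) x (η x))
  closed : ∀ (x : N) (u v : TangentSpace 𝓘(ℝ, F) x), extDeriv₁ (fun y => η y) x u v = 0
  lee : ∀ (x : N) (u v w : TangentSpace 𝓘(ℝ, F) x),
    extDeriv₂ (kahlerForm g J) x u v w = wedge₁₂ (fun y => η y) (kahlerForm g J) x u v w

/-- The Lee vector field `B = η^♯`. -/
def leeField (g : Metric F N) (η : ∀ x : N, TangentSpace 𝓘(ℝ, F) x →L[ℝ] ℝ) (x : N) :
    TangentSpace 𝓘(ℝ, F) x := riesz (g.form x) (η x)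

/-- The anti-Lee form `θ = η ∘ J`. -/
def antiLeeForm (J : ∀ x : N, TangentSpace 𝓘(ℝ, F) x →L[ℝ] TangentSpace 𝓘(ℝ, F) x)
    (η : ∀ x : N, TangentSpace 𝓘(ℝ, F) x →L[ℝ] ℝ) (x : N) (u : TangentSpace 𝓘(ℝ, F) x) : ℝ :=
  η x (J x u)

/-- The anti-Lee vector field `A = -J B`. -/
def antiLeeField (g : Metric F N)
    (J : ∀ x : N, TangentSpace 𝓘(ℝ, F) x →L[ℝ] TangentSpace 𝓘(ℝ, F) x)
    (η : ∀ x : N, TangentSpace 𝓘(ℝ, F) x →L[ℝ] ℝ) (x : N) : TangentSpace 𝓘(ℝ, F) x :=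
  -(J x (leeField g η x))

end Hermitian

/-! ### Submanifolds -/

section Submanifold

variable {E : Type*} [NormedAddCommGroup E] [NormedSpace ℝ E]
  {M : Type*} [TopologicalSpace M] [ChartedSpace E M] [IsManifold 𝓘(ℝ, E) ∞ M]
  {F : Type*} [NormedAddCommGroup F] [NormedSpace ℝ F]
  {N : Type*} [TopologicalSpace N] [ChartedSpace F N] [IsManifold 𝓘(ℝ, F) ∞ N]

variable (E F) in
/-- The differential `d f` at `p`. -/
def diff (f : M → N) (p : M) : TangentSpace 𝓘(ℝ, E) p →L[ℝ] TangentSpace 𝓘(ℝ, F) (f p) :=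
  mfderiv 𝓘(ℝ, E) 𝓘(ℝ, F) f p

variable (E F) in
/-- Smooth immersions. -/
structure IsSmoothImmersion (f : M → N) : Prop where
  smooth : ContMDiff 𝓘(ℝ, E) 𝓘(ℝ, F) ∞ f
  injective_diff : ∀ p : M, Function.Injective (diff E F f p)

variable (E) in
/-- The normal space `(T_p M)^⊥ ⊆ T_{f p} N` of the immersed submanifold `f : M → N`. -/
def normalSpace (g : Metric F N) (f : M → N) (p : M) : Submodule ℝ (TangentSpace 𝓘(ℝ, F) (f p)) :=
  orth (g.bilin (f p)) (LinearMap.range (diff E F f p).toLinearMap)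

/-- The induced metric on `M`, as a bilinear form at `p`. -/
def inducedMetric (g : Metric F N) (f : M → N) (p : M) :
    TangentSpace 𝓘(ℝ, E) p →ₗ[ℝ] TangentSpace 𝓘(ℝ, E) p →ₗ[ℝ] ℝ :=
  (g.bilin (f p)).compl₁₂ (diff E F f p).toLinearMap
    (diff E F f p).toLinearMap

/-- The second fundamental form `h(X, Y)`: the normal component of `∇̄_X Y`, where `∇̄` is the
Levi-Civita connection of the ambient metric. -/
def secondForm (g : Metric F N) (f : M → N) (X Y : ∀ p : M, TangentSpace 𝓘(ℝ, E) p) (p : M) :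
    TangentSpace 𝓘(ℝ, F) (f p) :=
  proj (g.bilin (f p)) (normalSpace E g f p)
    (covAlong g.form f (fun q => diff E F f q (Y q)) p (X p))

/-- The normal connection `∇^⊥_X V`: the normal component of `∇̄_X V`. -/
def normalCov (g : Metric F N) (f : M → N) (X : ∀ p : M, TangentSpace 𝓘(ℝ, E) p)
    (V : ∀ p : M, TangentSpace 𝓘(ℝ, F) (f p)) (p : M) : TangentSpace 𝓘(ℝ, F) (f p) :=
  proj (g.bilin (f p)) (normalSpace E g f p) (covAlong g.form f V p (X p))

variable (E) in
/-- The immersion `f` is totally geodesic: its second fundamental form vanishes. -/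
def IsTotallyGeodesic (g : Metric F N) (f : M → N) : Prop :=
  ∀ X Y : ∀ p : M, TangentSpace 𝓘(ℝ, E) p, IsSmoothField X → IsSmoothField Y →
    ∀ p, secondForm g f X Y p = 0

/-- A differentiable distribution: locally it is spanned by a smooth frame. -/
def IsSmoothDistribution (D : ∀ p : M, Submodule ℝ (TangentSpace 𝓘(ℝ, E) p)) : Prop :=
  ∀ p : M, ∃ U : Set M, IsOpen U ∧ p ∈ U ∧
    ∃ (k : ℕ) (X : Fin k → ∀ q : M, TangentSpace 𝓘(ℝ, E) q),
      (∀ i, ContMDiffOn 𝓘(ℝ, E) (𝓘(ℝ, E).prod 𝓘(ℝ, E)) ∞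
        (fun q => (⟨q, X i q⟩ : TangentBundle 𝓘(ℝ, E) M)) U) ∧
      ∀ q ∈ U, LinearIndependent ℝ (fun i => X i q) ∧
        Submodule.span ℝ (Set.range fun i => X i q) = D q

/-- `X ∈ Γ(D)`: smooth vector fields with values in the distribution `D`. -/
def IsSection (D : ∀ p : M, Submodule ℝ (TangentSpace 𝓘(ℝ, E) p))
    (X : ∀ p : M, TangentSpace 𝓘(ℝ, E) p) : Prop :=
  IsSmoothField X ∧ ∀ p, X p ∈ D p

/-- The complementary orthogonal distribution `D^⊥ ⊆ TM`. -/
def perp (g : Metric F N) (f : M → N) (D : ∀ p : M, Submodule ℝ (TangentSpace 𝓘(ℝ, E) p)) (p : M) :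
    Submodule ℝ (TangentSpace 𝓘(ℝ, E) p) :=
  orth (inducedMetric g f p) (D p)

/-- The image `J S_p ⊆ T_{f p} N` of a distribution `S` on `M` under the almost complex structure
`J` of `N`. -/
def jImage (J : ∀ x : N, TangentSpace 𝓘(ℝ, F) x →L[ℝ] TangentSpace 𝓘(ℝ, F) x) (f : M → N)
    (S : ∀ p : M, Submodule ℝ (TangentSpace 𝓘(ℝ, E) p)) (p : M) :
    Submodule ℝ (TangentSpace 𝓘(ℝ, F) (f p)) :=
  (S p).map ((J (f p)).toLinearMap ∘ₗ (diff E F f p).toLinearMap)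

/-- The immersed submanifold `f : M → N` with the distribution `D` is a CR-submanifold of
`(N, J, g)`: `D` is holomorphic, `J D = D`, and `D^⊥` is totally real, `J D^⊥ ⊆ TM^⊥`. -/
structure IsCRSubmanifold (g : Metric F N)
    (J : ∀ x : N, TangentSpace 𝓘(ℝ, F) x →L[ℝ] TangentSpace 𝓘(ℝ, F) x) (f : M → N)
    (D : ∀ p : M, Submodule ℝ (TangentSpace 𝓘(ℝ, E) p)) : Prop where
  immersion : IsSmoothImmersion E F f
  smooth : IsSmoothDistribution D
  holomorphic : ∀ p : M, jImage J f D p =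
    (D p).map (diff E F f p).toLinearMap
  totally_real : ∀ p : M, jImage J f (perp g f D) p ≤ normalSpace E g f p

/-- The subbundle `J D^⊥` of the normal bundle. -/
def jPerp (g : Metric F N)
    (J : ∀ x : N, TangentSpace 𝓘(ℝ, F) x →L[ℝ] TangentSpace 𝓘(ℝ, F) x) (f : M → N)
    (D : ∀ p : M, Submodule ℝ (TangentSpace 𝓘(ℝ, E) p)) (p : M) :
    Submodule ℝ (TangentSpace 𝓘(ℝ, F) (f p)) :=
  jImage J f (perp g f D) p

/-- The subbundle `μ`: the orthogonal complement of `J D^⊥` in the normal bundle. -/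
def muBundle (g : Metric F N)
    (J : ∀ x : N, TangentSpace 𝓘(ℝ, F) x →L[ℝ] TangentSpace 𝓘(ℝ, F) x) (f : M → N)
    (D : ∀ p : M, Submodule ℝ (TangentSpace 𝓘(ℝ, E) p)) (p : M) :
    Submodule ℝ (TangentSpace 𝓘(ℝ, F) (f p)) :=
  normalSpace E g f p ⊓ orth (g.bilin (f p)) (jPerp g J f D p)

/-- `M` is `D^⊥`-geodesic: `h(X, Z) = 0` for all `X, Z ∈ Γ(D^⊥)`. -/
def IsPerpGeodesic (g : Metric F N) (f : M → N)
    (D : ∀ p : M, Submodule ℝ (TangentSpace 𝓘(ℝ, E) p)) : Prop :=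
  ∀ X Z : ∀ p : M, TangentSpace 𝓘(ℝ, E) p, IsSection (perp g f D) X → IsSection (perp g f D) Z →
    ∀ p, secondForm g f X Z p = 0

/-- The relation `θ(Y) J X = 2 h_{JD^⊥}(X, Y)` for all `X ∈ Γ(D^⊥)`, `Y ∈ Γ(D)`. -/
def ThetaRelation (g : Metric F N)
    (J : ∀ x : N, TangentSpace 𝓘(ℝ, F) x →L[ℝ] TangentSpace 𝓘(ℝ, F) x)
    (η : ∀ x : N, TangentSpace 𝓘(ℝ, F) x →L[ℝ] ℝ) (f : M → N)
    (D : ∀ p : M, Submodule ℝ (TangentSpace 𝓘(ℝ, E) p)) : Prop :=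
  ∀ X Y : ∀ p : M, TangentSpace 𝓘(ℝ, E) p, IsSection (perp g f D) X → IsSection D Y →
    ∀ p, antiLeeForm J η (f p) (diff E F f p (Y p)) • J (f p) (diff E F f p (X p)) =
      (2 : ℝ) • proj (g.bilin (f p)) (jPerp g J f D p) (secondForm g f X Y p)

/-- `h(X, Z) ∈ Γ(μ)` for all `X, Z ∈ Γ(D^⊥)`. -/
def SecondFormInMu (g : Metric F N)
    (J : ∀ x : N, TangentSpace 𝓘(ℝ, F) x →L[ℝ] TangentSpace 𝓘(ℝ, F) x) (f : M → N)
    (D : ∀ p : M, Submodule ℝ (TangentSpace 𝓘(ℝ, E) p)) : Prop :=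
  ∀ X Z : ∀ p : M, TangentSpace 𝓘(ℝ, E) p, IsSection (perp g f D) X → IsSection (perp g f D) Z →
    ∀ p, secondForm g f X Z p ∈ muBundle g J f D p

/-- `(∇^⊥_X JZ)_μ = -½ g(X, Z) A_μ` for all `X, Z ∈ Γ(D^⊥)`. -/
def NormalRelation (g : Metric F N)
    (J : ∀ x : N, TangentSpace 𝓘(ℝ, F) x →L[ℝ] TangentSpace 𝓘(ℝ, F) x)
    (η : ∀ x : N, TangentSpace 𝓘(ℝ, F) x →L[ℝ] ℝ) (f : M → N)
    (D : ∀ p : M, Submodule ℝ (TangentSpace 𝓘(ℝ, E) p)) : Prop :=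
  ∀ X Z : ∀ p : M, TangentSpace 𝓘(ℝ, E) p, IsSection (perp g f D) X → IsSection (perp g f D) Z →
    ∀ p, proj (g.bilin (f p)) (muBundle g J f D p)
        (normalCov g f X (fun q => J (f q) (diff E F f q (Z q))) p) =
      (-(1 / 2) * inducedMetric g f p (X p) (Z p)) •
        proj (g.bilin (f p)) (muBundle g J f D p) (antiLeeField g J η (f p))

/-- `j : L → M` is an integral manifold of the distribution `S` on `M`: an injectively immersed
submanifold whose tangent spaces are the spaces of `S`. -/
structure IsIntegralManifold {G : Type*} [NormedAddCommGroup G] [NormedSpace ℝ G]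
    {L : Type*} [TopologicalSpace L] [ChartedSpace G L] [IsManifold 𝓘(ℝ, G) ∞ L]
    (S : ∀ p : M, Submodule ℝ (TangentSpace 𝓘(ℝ, E) p)) (j : L → M) : Prop where
  immersion : IsSmoothImmersion G E j
  injective : Function.Injective j
  tangent : ∀ q : L,
    LinearMap.range (diff G E j q).toLinearMap = S (j q)

end Submanifold

/-- The submanifold `f : M → N` is ruled with respect to the foliation tangent to the distribution
`S` on `M`: `S` defines a foliation, i.e. through every point of `M` there passes a connected
integral manifold of `S`, and the leaves are totally geodesic immersed in `(N, g)`. The leaves are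
the maximal connected integral manifolds, and every connected integral manifold is an open piece
of a leaf; the condition is imposed on all of them. -/
def IsRuled {F : Type*} [NormedAddCommGroup F] [NormedSpace ℝ F]
    {N : Type*} [TopologicalSpace N] [ChartedSpace F N] [IsManifold 𝓘(ℝ, F) ∞ N]
    {E : Type*} [NormedAddCommGroup E] [NormedSpace ℝ E]
    {M : Type u} [TopologicalSpace M] [ChartedSpace E M] [IsManifold 𝓘(ℝ, E) ∞ M]
    (g : Metric F N) (f : M → N) (S : ∀ p : M, Submodule ℝ (TangentSpace 𝓘(ℝ, E) p)) : Prop :=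
  (∀ p : M, ∃ (k : ℕ) (L : Type u) (_ : TopologicalSpace L) (_ : T2Space L)
    (_ : SecondCountableTopology L) (_ : ConnectedSpace L)
    (_ : ChartedSpace (EuclideanSpace ℝ (Fin k)) L)
    (_ : IsManifold 𝓘(ℝ, EuclideanSpace ℝ (Fin k)) ∞ L) (j : L → M),
      IsIntegralManifold (G := EuclideanSpace ℝ (Fin k)) S j ∧ p ∈ Set.range j) ∧
  (∀ (k : ℕ) (L : Type u) [TopologicalSpace L] [T2Space L]
    [SecondCountableTopology L] [ConnectedSpace L]
    [ChartedSpace (EuclideanSpace ℝ (Fin k)) L]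
    [IsManifold 𝓘(ℝ, EuclideanSpace ℝ (Fin k)) ∞ L] (j : L → M),
      IsIntegralManifold (G := EuclideanSpace ℝ (Fin k)) S j →
        IsTotallyGeodesic (EuclideanSpace ℝ (Fin k)) g (fun q => f (j q)))

end

end LCK

/-!
The three assertions are equivalent to one condition, `IsAutoparallel g f (perp g f D)`: for the
Levi-Civita connection `∇̄` of the ambient manifold, `∇̄_X Z ∈ Γ(D^⊥)` for all `X, Z ∈ Γ(D^⊥)`.

*The conditions on `h`.* Along `M` the ambient tangent bundle is the orthogonal sum of `D`, `D^⊥`,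
`J D^⊥` and `μ`, so autoparallelism means that `∇̄_X Z` has no component in `D`, `J D^⊥` and `μ`.
That the last two components vanish is `h(X, Z) = 0`. The others are translated by the formula for
`∇̄J` on a locally conformal Kähler manifold: comparing the connections of `g` and `exp(-φ) g`
expresses `∇̄J` through `λ = dφ` (`IsLCK.exists_nablaEndo`), which gives
`g(∇̄_X Z, JY) = g(∇̄_X Y, JZ) - ½ g(X, Z) θ(Y)` for `Y ∈ Γ(D)` (`inner_ambientCov_holomorphic`) and
`g(∇̄_X JZ, N) = -½ g(X, Z) g(A, N) - g(∇̄_X Z, JN)` for `N ∈ μ` (`inner_normalCov_mu`). Hence the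
relation between `θ` and `h` says that the `D`-component vanishes, and the relation between
`∇^⊥ JZ` and `A` that the `μ`-component does. The Lee form need not be `λ` in real dimension two,
where the condition `dΩ = ω ∧ Ω` is empty; it agrees with `λ` on each `u` for which some nonzero
vector is orthogonal to `u` and `Ju` (`IsLeeForm.inner_mul_eq`), and both identities only involve
such vectors.

*The leaves.* The derivative `∇̄_X ρ` of a field `ρ` with values in `D^⊥` depends, modulo `D^⊥`,
only on the value of `ρ` at the point (`covAlong_sub_mem`). Therefore the second fundamental form of
an integral manifold at a point is computed by sections of `D^⊥` over `M`, and vanishes iff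
`∇̄_X Z ∈ D^⊥` there (`secondForm_integral_eq_zero_iff`). This shows that a ruled submanifold has
`D^⊥` autoparallel, and conversely that integral manifolds of an autoparallel `D^⊥` are totally
geodesic.

*Existence of leaves.* Since `∇̄` is torsion-free, an autoparallel distribution is involutive
(`IsAutoparallel.bracket_mem`), and a local form of the theorem of Frobenius gives the integral
manifolds. Near a point, `D^⊥` is the range of projectors `P(x)` along a fixed complement `K`; the
vector fields `P(x) v`, for `v` in the fibre at the base point, then commute: their brackets lie
both in `D^⊥` and in `K`. The integral manifold is the image of the solution of the total
differential equation `dy = P(y)`, obtained from the radial ordinary differential equations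
`α' = P(α) s` (`exists_hasFDerivAt_of_commute`, `exists_integral_map`).
-/

set_option linter.unusedSectionVars false

namespace LCK

noncomputable section

/-! ### Calculus of vector-valued functions on a manifold -/

section Calculus

variable {E : Type*} [NormedAddCommGroup E] [NormedSpace ℝ E]
  {M : Type*} [TopologicalSpace M] [ChartedSpace E M]
  {W W' : Type*} [NormedAddCommGroup W] [NormedSpace ℝ W]
  [NormedAddCommGroup W'] [NormedSpace ℝ W']

theorem mdifferentiableAt_clm_apply {B : M → W →L[ℝ] W'} {v : M → W} {p : M}
    (hB : MDifferentiableAt 𝓘(ℝ, E) 𝓘(ℝ, W →L[ℝ] W') B p)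
    (hv : MDifferentiableAt 𝓘(ℝ, E) 𝓘(ℝ, W) v p) :
    MDifferentiableAt 𝓘(ℝ, E) 𝓘(ℝ, W') (fun q => B q (v q)) p :=
  hB.clm_apply hv

/-- The product rule for the evaluation of a family of operators on a family of vectors. -/
theorem mvfderiv_clm_apply {B : M → W →L[ℝ] W'} {v : M → W} {p : M}
    (hB : MDifferentiableAt 𝓘(ℝ, E) 𝓘(ℝ, W →L[ℝ] W') B p)
    (hv : MDifferentiableAt 𝓘(ℝ, E) 𝓘(ℝ, W) v p) (w : TangentSpace 𝓘(ℝ, E) p) :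
    mvfderiv 𝓘(ℝ, E) (fun q => B q (v q)) p w =
      mvfderiv 𝓘(ℝ, E) B p w (v p) + B p (mvfderiv 𝓘(ℝ, E) v p w) := by
  have h : HasMFDerivAt 𝓘(ℝ, E) 𝓘(ℝ, W') (fun q => B q (v q)) p
      ((B p).comp (show E →L[ℝ] W from mvfderiv 𝓘(ℝ, E) v p) +
        (show E →L[ℝ] W →L[ℝ] W' from mvfderiv 𝓘(ℝ, E) B p).flip (v p)) := by
    refine ⟨(mdifferentiableAt_clm_apply hB hv).continuousAt, ?_⟩
    convert! hB.hasMFDerivAt.2.clm_apply hv.hasMFDerivAt.2 using 1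
    simp [writtenInExtChartAt]
    rfl
  refine (congrArg (fun L : E →L[ℝ] W' => L w) h.mfderiv).trans ?_
  exact add_comm _ _

theorem mvfderiv_clm_apply_const {B : M → W →L[ℝ] W'} {p : M}
    (hB : MDifferentiableAt 𝓘(ℝ, E) 𝓘(ℝ, W →L[ℝ] W') B p) (a : W) (w : TangentSpace 𝓘(ℝ, E) p) :
    mvfderiv 𝓘(ℝ, E) (fun q => B q a) p w = mvfderiv 𝓘(ℝ, E) B p w a := by
  rw [mvfderiv_clm_apply hB mdifferentiableAt_const]
  simp [mvfderiv_const]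

theorem mvfderiv_comp_vec {N F : Type*} [NormedAddCommGroup F] [NormedSpace ℝ F]
    [TopologicalSpace N] [ChartedSpace F N] {h : N → W} {f : M → N} {p : M}
    (hh : MDifferentiableAt 𝓘(ℝ, F) 𝓘(ℝ, W) h (f p))
    (hf : MDifferentiableAt 𝓘(ℝ, E) 𝓘(ℝ, F) f p) (w : TangentSpace 𝓘(ℝ, E) p) :
    mvfderiv 𝓘(ℝ, E) (fun q => h (f q)) p w =
      mvfderiv 𝓘(ℝ, F) h (f p) (mfderiv 𝓘(ℝ, E) 𝓘(ℝ, F) f p w) :=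
  mfderiv_comp_apply p hh hf w

theorem mvfderiv_congr {h h' : M → W} {p : M} (hh : ∀ᶠ q in nhds p, h q = h' q) :
    mvfderiv 𝓘(ℝ, E) h p = mvfderiv 𝓘(ℝ, E) h' p := by
  have h1 : h =ᶠ[nhds p] h' := hh
  ext w
  have := h1.mfderiv_eq (I := 𝓘(ℝ, E)) (I' := 𝓘(ℝ, W))
  simp only [mvfderiv]
  exact congrArg (fun L : E →L[ℝ] W => L w) this

end Calculus

/-! ### Coordinates of the tangent bundle -/

section Coordinates

variable {F : Type*} [NormedAddCommGroup F] [NormedSpace ℝ F]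
  {N : Type*} [TopologicalSpace N] [ChartedSpace F N] [IsManifold 𝓘(ℝ, F) ∞ N]

/-- The coordinates, in the chart at `x`, of tangent vectors at `y`. -/
def toCoord (x y : N) : TangentSpace 𝓘(ℝ, F) y →L[ℝ] F :=
  (trivializationAt F (TangentSpace 𝓘(ℝ, F)) x).continuousLinearMapAt ℝ y

/-- The tangent vector at `y` with given coordinates in the chart at `x`. -/
def ofCoord (x y : N) : F →L[ℝ] TangentSpace 𝓘(ℝ, F) y :=
  (trivializationAt F (TangentSpace 𝓘(ℝ, F)) x).symmL ℝ y

theorem toCoord_eq_mfderiv {x y : N} (hy : y ∈ (chartAt F x).source) :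
    toCoord x y = mvfderiv 𝓘(ℝ, F) (extChartAt 𝓘(ℝ, F) x) y :=
  have : IsManifold 𝓘(ℝ, F) 1 N := IsManifold.of_le (n := ∞) (by simp)
  TangentBundle.continuousLinearMapAt_trivializationAt hy

theorem toCoord_self (x : N) (v : TangentSpace 𝓘(ℝ, F) x) : toCoord x x v = (v : F) := by
  have : IsManifold 𝓘(ℝ, F) 1 N := IsManifold.of_le (n := ∞) (by simp)
  rw [toCoord, TangentBundle.continuousLinearMapAt_trivializationAt_eq_core (by simp)]
  exact (tangentBundleCore 𝓘(ℝ, F) N).coordChange_self (achart F x) x (mem_chart_source F x) v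

theorem toCoord_ofCoord {x y : N} (hy : y ∈ (chartAt F x).source) (u : F) :
    toCoord x y (ofCoord x y u) = u :=
  (trivializationAt F (TangentSpace 𝓘(ℝ, F)) x).continuousLinearMapAt_symmL
    (R := ℝ) (by simpa using hy) u

theorem ofCoord_toCoord {x y : N} (hy : y ∈ (chartAt F x).source) (u : TangentSpace 𝓘(ℝ, F) y) :
    ofCoord x y (toCoord x y u) = u :=
  (trivializationAt F (TangentSpace 𝓘(ℝ, F)) x).symmL_continuousLinearMapAt
    (R := ℝ) (by simpa using hy) u

theorem ofCoord_self (x : N) (v : F) : (ofCoord (F := F) x x v : TangentSpace 𝓘(ℝ, F) x) = v :=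
  (toCoord_self x (ofCoord (F := F) x x v)).symm.trans (toCoord_ofCoord (mem_chart_source F x) v)

theorem coordField_eq (x y : N) (u : TangentSpace 𝓘(ℝ, F) x) :
    coordField x u y = ofCoord (F := F) x y u :=
  congrArg (ofCoord (F := F) x y) (toCoord_self x u)

/-- The components of the metric in the chart at `x`, as a function of the point. -/
def metricRep (g : Metric F N) (x y : N) : F →L[ℝ] F →L[ℝ] ℝ :=
  ContinuousLinearMap.inCoordinates F (fun x : N => TangentSpace 𝓘(ℝ, F) x) (F →L[ℝ] ℝ)
    (fun x : N => TangentSpace 𝓘(ℝ, F) x →L[ℝ] ℝ) x y x y (g.inner y)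

theorem metricRep_apply (g : Metric F N) {x y : N} (hy : y ∈ (chartAt F x).source) (u v : F) :
    metricRep g x y u v = g.inner y (ofCoord x y u) (ofCoord x y v) := by
  rw [metricRep, inCoordinates_apply_eq₂ (by simpa using hy) (by simpa using hy) (by simp)]
  rw [ofCoord, Bundle.Trivialization.symmL_apply _ (by simpa using hy),
    Bundle.Trivialization.symmL_apply _ (by simpa using hy)]
  simp

theorem contMDiffAt_metricRep (g : Metric F N) (x : N) :
    ContMDiffAt 𝓘(ℝ, F) 𝓘(ℝ, F →L[ℝ] F →L[ℝ] ℝ) ∞ (metricRep g x) x :=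
  ((contMDiffAt_hom_bundle _).1 (g.contMDiff x)).2

/-- The components of an endomorphism field in the chart at `x`, as a function of the point. -/
def endoRep (J : ∀ x : N, TangentSpace 𝓘(ℝ, F) x →L[ℝ] TangentSpace 𝓘(ℝ, F) x) (x y : N) :
    F →L[ℝ] F :=
  (toCoord x y).comp ((J y).comp (ofCoord x y))

theorem IsAlmostHermitian.contMDiffAt_endoRep {g : Metric F N}
    {J : ∀ x : N, TangentSpace 𝓘(ℝ, F) x →L[ℝ] TangentSpace 𝓘(ℝ, F) x}
    (h : IsAlmostHermitian g J) (x : N) :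
    ContMDiffAt 𝓘(ℝ, F) 𝓘(ℝ, F →L[ℝ] F) ∞ (endoRep J x) x :=
  ((contMDiffAt_hom_bundle _).1 (h.smooth x)).2

variable {E : Type*} [NormedAddCommGroup E] [NormedSpace ℝ E]
  {M : Type*} [TopologicalSpace M] [ChartedSpace E M]

variable (E) in
/-- A vector field along a map is differentiable at a point: its coordinates in the chart at the
image of this point are. -/
def DiffAlong (f : M → N) (V : ∀ p : M, TangentSpace 𝓘(ℝ, F) (f p)) (p : M) : Prop :=
  MDifferentiableAt 𝓘(ℝ, E) 𝓘(ℝ, F) (fun q => toCoord (f p) (f q) (V q)) p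

theorem coordDeriv_eq (f : M → N) (V : ∀ p : M, TangentSpace 𝓘(ℝ, F) (f p)) (p : M)
    (w : TangentSpace 𝓘(ℝ, E) p) :
    coordDeriv f V p w = mvfderiv 𝓘(ℝ, E) (fun q => toCoord (f p) (f q) (V q)) p w :=
  ofCoord_self (f p) _

theorem contMDiffAt_toCoord {f : M → N} {V : ∀ p : M, TangentSpace 𝓘(ℝ, F) (f p)} {p : M}
    (h : ContMDiffAt 𝓘(ℝ, E) (𝓘(ℝ, F).prod 𝓘(ℝ, F)) ∞
      (fun q => (⟨f q, V q⟩ : TangentBundle 𝓘(ℝ, F) N)) p) :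
    ContMDiffAt 𝓘(ℝ, E) 𝓘(ℝ, F) ∞ (fun q => toCoord (f p) (f q) (V q)) p := by
  have h1 := Bundle.contMDiffAt_totalSpace.1 h
  have h2 : ∀ᶠ q in nhds p, f q ∈ (chartAt F (f p)).source :=
    h1.1.continuousAt.preimage_mem_nhds
      ((chartAt F (f p)).open_source.mem_nhds (mem_chart_source F (f p)))
  refine h1.2.congr_of_eventuallyEq ?_
  filter_upwards [h2] with q hq
  rw [toCoord, Bundle.Trivialization.continuousLinearMapAt_apply,
    Bundle.Trivialization.coe_linearMapAt_of_mem _ (by simpa using hq)]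

theorem diffAlong_of_contMDiffAt {f : M → N} {V : ∀ p : M, TangentSpace 𝓘(ℝ, F) (f p)} {p : M}
    (h : ContMDiffAt 𝓘(ℝ, E) (𝓘(ℝ, F).prod 𝓘(ℝ, F)) ∞
      (fun q => (⟨f q, V q⟩ : TangentBundle 𝓘(ℝ, F) N)) p) : DiffAlong E f V p :=
  (contMDiffAt_toCoord h).mdifferentiableAt (by simp)

end Coordinates

/-! ### The Levi-Civita connection at a point -/

section LeviCivita

variable {F : Type*} [NormedAddCommGroup F] [NormedSpace ℝ F] [FiniteDimensional ℝ F]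
  {N : Type*} [TopologicalSpace N] [ChartedSpace F N] [IsManifold 𝓘(ℝ, F) ∞ N]

instance instFiniteDimensionalTangentSpace (x : N) :
    FiniteDimensional ℝ (TangentSpace 𝓘(ℝ, F) x) :=
  inferInstanceAs (FiniteDimensional ℝ F)

theorem eventually_mem_chart_source (x : N) : ∀ᶠ y in nhds x, y ∈ (chartAt F x).source :=
  (chartAt F x).open_source.mem_nhds (mem_chart_source F x)

/-- The first derivatives `∂_w g(∂_u, ∂_v)` of the metric at `x`, in the chart at `x`. -/
def dMetric (g : Metric F N) (x : N) (w u v : TangentSpace 𝓘(ℝ, F) x) : ℝ :=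
  mvfderiv 𝓘(ℝ, F) (metricRep g x) x w u v

/-- The first derivatives `∂_w (J ∂_u)` of an endomorphism field at `x`, in the chart at `x`. -/
def dEndo (J : ∀ x : N, TangentSpace 𝓘(ℝ, F) x →L[ℝ] TangentSpace 𝓘(ℝ, F) x) (x : N)
    (w u : TangentSpace 𝓘(ℝ, F) x) : TangentSpace 𝓘(ℝ, F) x :=
  mvfderiv 𝓘(ℝ, F) (endoRep J x) x w u

theorem mdifferentiableAt_metricRep (g : Metric F N) (x : N) :
    MDifferentiableAt 𝓘(ℝ, F) 𝓘(ℝ, F →L[ℝ] F →L[ℝ] ℝ) (metricRep g x) x :=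
  (contMDiffAt_metricRep g x).mdifferentiableAt (by simp)

theorem IsAlmostHermitian.mdifferentiableAt_endoRep {g : Metric F N}
    {J : ∀ x : N, TangentSpace 𝓘(ℝ, F) x →L[ℝ] TangentSpace 𝓘(ℝ, F) x}
    (h : IsAlmostHermitian g J) (x : N) :
    MDifferentiableAt 𝓘(ℝ, F) 𝓘(ℝ, F →L[ℝ] F) (endoRep J x) x :=
  (h.contMDiffAt_endoRep x).mdifferentiableAt (by simp)

theorem metricRep_self (g : Metric F N) (x : N) (u v : TangentSpace 𝓘(ℝ, F) x) :
    metricRep (F := F) g x x u v = g.inner x u v :=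
  (metricRep_apply (F := F) g (mem_chart_source F x) u v).trans
    (congrArg₂ (fun a b => g.inner x a b) (ofCoord_self (F := F) x u) (ofCoord_self (F := F) x v))

theorem endoRep_self (J : ∀ x : N, TangentSpace 𝓘(ℝ, F) x →L[ℝ] TangentSpace 𝓘(ℝ, F) x) (x : N)
    (u : TangentSpace 𝓘(ℝ, F) x) :
    (endoRep (F := F) J x x u : TangentSpace 𝓘(ℝ, F) x) = J x u :=
  (toCoord_self x (J x (ofCoord (F := F) x x u))).trans (congrArg (J x) (ofCoord_self (F := F) x u))

theorem mvfderiv_metricRep_apply (g : Metric F N) (x : N) (w : TangentSpace 𝓘(ℝ, F) x) (a b : F) :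
    mvfderiv 𝓘(ℝ, F) (fun y => metricRep g x y a b) x w =
      mvfderiv 𝓘(ℝ, F) (metricRep g x) x w a b := by
  have hd := mdifferentiableAt_metricRep g x
  rw [mvfderiv_clm_apply_const (mdifferentiableAt_clm_apply hd mdifferentiableAt_const),
    mvfderiv_clm_apply_const hd]

theorem dMetric_symm (g : Metric F N) (x : N) (w u v : TangentSpace 𝓘(ℝ, F) x) :
    dMetric g x w u v = dMetric g x w v u := by
  refine (mvfderiv_metricRep_apply g x w u v).symm.trans
    (Eq.trans ?_ (mvfderiv_metricRep_apply g x w v u))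
  refine DFunLike.congr_fun (mvfderiv_congr ?_) w
  filter_upwards [eventually_mem_chart_source (F := F) x] with y hy
  exact (metricRep_apply (F := F) g hy u v).trans
    ((g.symm y _ _).trans (metricRep_apply (F := F) g hy v u).symm)

theorem partial₂_form (g : Metric F N) (x : N) (w u v : TangentSpace 𝓘(ℝ, F) x) :
    partial₂ g.form x w u v = dMetric g x w u v := by
  refine Eq.trans ?_ (mvfderiv_metricRep_apply g x w u v)
  refine DFunLike.congr_fun (mvfderiv_congr ?_) w
  filter_upwards [eventually_mem_chart_source (F := F) x] with y hy
  rw [coordField_eq, coordField_eq]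
  exact (metricRep_apply (F := F) g hy u v).symm

theorem dMetric_add_right (g : Metric F N) (x : N) (w u v v' : TangentSpace 𝓘(ℝ, F) x) :
    dMetric g x w u (v + v') = dMetric g x w u v + dMetric g x w u v' :=
  map_add (show F →L[ℝ] ℝ from mvfderiv 𝓘(ℝ, F) (metricRep g x) x w u) v v'

theorem dMetric_smul_right (g : Metric F N) (x : N) (w u v : TangentSpace 𝓘(ℝ, F) x) (c : ℝ) :
    dMetric g x w u (c • v) = c * dMetric g x w u v :=
  map_smul (show F →L[ℝ] ℝ from mvfderiv 𝓘(ℝ, F) (metricRep g x) x w u) c v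

theorem dMetric_add_left (g : Metric F N) (x : N) (w w' u v : TangentSpace 𝓘(ℝ, F) x) :
    dMetric g x (w + w') u v = dMetric g x w u v + dMetric g x w' u v :=
  congrArg (fun L : F →L[ℝ] F →L[ℝ] ℝ => L u v)
    ((mvfderiv 𝓘(ℝ, F) (metricRep g x) x).map_add w w')

theorem dMetric_smul_left (g : Metric F N) (x : N) (w u v : TangentSpace 𝓘(ℝ, F) x) (c : ℝ) :
    dMetric g x (c • w) u v = c * dMetric g x w u v :=
  congrArg (fun L : F →L[ℝ] F →L[ℝ] ℝ => L u v)
    ((mvfderiv 𝓘(ℝ, F) (metricRep g x) x).map_smul c w)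

theorem Metric.bilin_pos (g : Metric F N) (x : N) (v : TangentSpace 𝓘(ℝ, F) x) (hv : v ≠ 0) :
    0 < g.bilin x v v := g.pos x v hv

/-- The form whose representing vector is the Christoffel symbol. -/
def christoffelForm (g : Metric F N) (x : N) (u v : TangentSpace 𝓘(ℝ, F) x) :
    TangentSpace 𝓘(ℝ, F) x →ₗ[ℝ] ℝ where
  toFun w := (dMetric g x u v w + dMetric g x v u w - dMetric g x w u v) / 2
  map_add' w w' := by
    rw [dMetric_add_right, dMetric_add_right, dMetric_add_left]
    ring
  map_smul' c w := by
    rw [dMetric_smul_right, dMetric_smul_right, dMetric_smul_left]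
    simp only [smul_eq_mul, RingHom.id_apply]
    ring

theorem inner_christoffel (g : Metric F N) (x : N) (u v w : TangentSpace 𝓘(ℝ, F) x) :
    g.inner x (christoffel g.form x u v) w =
      (dMetric g x u v w + dMetric g x v u w - dMetric g x w u v) / 2 := by
  have h := riesz_spec (g.bilin x) (g.bilin_pos x) (christoffelForm g x u v) w
  -- the vector chosen in the definition of the Christoffel symbols is the Riesz representative
  have e : christoffel g.form x u v =
      riesz (fun a b => g.bilin x a b) (christoffelForm g x u v) := by
    unfold christoffel
    simp only [partial₂_form]
    rfl
  rw [e]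
  exact h

theorem Metric.ext_inner (g : Metric F N) {x : N} {a b : TangentSpace 𝓘(ℝ, F) x}
    (h : ∀ w, g.inner x a w = g.inner x b w) : a = b := by
  by_contra hab
  have h1 := g.pos x (a - b) (sub_ne_zero.2 hab)
  rw [(g.inner x).map_sub a b, sub_apply, h, sub_self] at h1
  exact lt_irrefl _ h1

theorem christoffel_symm (g : Metric F N) (x : N) (u v : TangentSpace 𝓘(ℝ, F) x) :
    christoffel g.form x u v = christoffel g.form x v u := by
  refine g.ext_inner fun w => ?_
  rw [inner_christoffel, inner_christoffel, dMetric_symm g x w u v]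
  ring

/-- The Christoffel symbols are those of a metric connection. -/
theorem dMetric_eq (g : Metric F N) (x : N) (w u v : TangentSpace 𝓘(ℝ, F) x) :
    dMetric g x w u v = g.inner x (christoffel g.form x w u) v +
      g.inner x u (christoffel g.form x w v) := by
  rw [g.symm x u, inner_christoffel, inner_christoffel, dMetric_symm g x w v u,
    dMetric_symm g x v w u, dMetric_symm g x u w v]
  ring

/-- The change of the Christoffel symbols under a conformal change of the metric. -/
theorem inner_christoffel_conformal (g : Metric F N) (x : N) {φ : N → ℝ}
    (hφ : MDifferentiableAt 𝓘(ℝ, F) 𝓘(ℝ, ℝ) φ x) (u v w : TangentSpace 𝓘(ℝ, F) x) :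
    g.inner x (christoffel (fun y a b => Real.exp (-φ y) * g.form y a b) x u v) w =
      g.inner x (christoffel g.form x u v) w -
        (mvfderiv 𝓘(ℝ, F) φ x u * g.inner x v w + mvfderiv 𝓘(ℝ, F) φ x v * g.inner x u w -
          mvfderiv 𝓘(ℝ, F) φ x w * g.inner x u v) / 2 := by
  have hexp : ∀ a, mvfderiv 𝓘(ℝ, F) (fun y => Real.exp (-φ y)) x a =
      -(Real.exp (-φ x) * mvfderiv 𝓘(ℝ, F) φ x a) := by
    intro a
    have h1 : HasDerivAt (fun t : ℝ => Real.exp (-t)) (-Real.exp (-φ x)) (φ x) := by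
      simpa using (hasDerivAt_neg (φ x)).exp
    have h2 := mvfderiv_comp_vec (f := φ) h1.differentiableAt.mdifferentiableAt hφ a
    rw [h2]
    refine (DFunLike.congr_fun (mfderiv_eq_fderiv.trans h1.hasFDerivAt.fderiv) _).trans ?_
    exact (mul_neg (mvfderiv 𝓘(ℝ, F) φ x a) (Real.exp (-φ x))).trans
      (congrArg Neg.neg (mul_comm _ _))
  have hexpd : MDifferentiableAt 𝓘(ℝ, F) 𝓘(ℝ, ℝ) (fun y => Real.exp (-φ y)) x := by
    have : DifferentiableAt ℝ (fun t : ℝ => Real.exp (-t)) (φ x) := by fun_prop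
    exact this.mdifferentiableAt.comp x hφ
  have hp : ∀ a b c : TangentSpace 𝓘(ℝ, F) x,
      partial₂ (fun y a b => Real.exp (-φ y) * g.form y a b) x a b c =
      Real.exp (-φ x) * (dMetric g x a b c - mvfderiv 𝓘(ℝ, F) φ x a * g.inner x b c) := by
    intro a b c
    have hd : MDifferentiableAt 𝓘(ℝ, F) 𝓘(ℝ, ℝ) (fun y => metricRep (F := F) g x y b c) x :=
      mdifferentiableAt_clm_apply (mdifferentiableAt_clm_apply (mdifferentiableAt_metricRep g x)
        mdifferentiableAt_const) mdifferentiableAt_const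
    have h1 : partial₂ (fun y a b => Real.exp (-φ y) * g.form y a b) x a b c =
        mvfderiv 𝓘(ℝ, F) (fun y => Real.exp (-φ y) * metricRep (F := F) g x y b c) x a := by
      refine DFunLike.congr_fun (mvfderiv_congr ?_) a
      filter_upwards [eventually_mem_chart_source (F := F) x] with y hy
      rw [coordField_eq, coordField_eq]
      exact congrArg (Real.exp (-φ y) * ·) (metricRep_apply (F := F) g hy b c).symm
    rw [h1, mvfderiv_fun_mul hexpd hd]
    have h2 := mvfderiv_metricRep_apply (F := F) g x a b c
    have h3 := metricRep_self g x b c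
    simp only [add_apply, smul_apply, hexp, smul_eq_mul,
      h2, h3]
    simp only [dMetric]
    ring
  let β : TangentSpace 𝓘(ℝ, F) x →ₗ[ℝ] TangentSpace 𝓘(ℝ, F) x →ₗ[ℝ] ℝ :=
    Real.exp (-φ x) • g.bilin x
  have hβ : ∀ v, v ≠ 0 → 0 < β v v := fun v hv =>
    mul_pos (Real.exp_pos _) (g.bilin_pos x v hv)
  let α : TangentSpace 𝓘(ℝ, F) x →ₗ[ℝ] ℝ := Real.exp (-φ x) • (christoffelForm g x u v -
    (2 : ℝ)⁻¹ • (mvfderiv 𝓘(ℝ, F) φ x u • g.bilin x v + mvfderiv 𝓘(ℝ, F) φ x v • g.bilin x u -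
      g.inner x u v • (mvfderiv 𝓘(ℝ, F) φ x).toLinearMap))
  have h := riesz_spec β hβ α w
  have e : christoffel (fun y a b => Real.exp (-φ y) * g.form y a b) x u v =
      riesz (fun a b => β a b) α := by
    unfold christoffel
    refine congrArg (riesz _) (funext fun w => ?_)
    simp only [hp]
    change _ = Real.exp (-φ x) * ((dMetric g x u v w + dMetric g x v u w - dMetric g x w u v) / 2 -
      (2 : ℝ)⁻¹ * (mvfderiv 𝓘(ℝ, F) φ x u * g.inner x v w + mvfderiv 𝓘(ℝ, F) φ x v * g.inner x u w
        - g.inner x u v * mvfderiv 𝓘(ℝ, F) φ x w))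
    ring
  rw [e, inner_christoffel]
  have h' : Real.exp (-φ x) * g.inner x (riesz (fun a b => β a b) α) w =
    Real.exp (-φ x) * ((dMetric g x u v w + dMetric g x v u w - dMetric g x w u v) / 2 -
      (2 : ℝ)⁻¹ * (mvfderiv 𝓘(ℝ, F) φ x u * g.inner x v w + mvfderiv 𝓘(ℝ, F) φ x v * g.inner x u w
        - g.inner x u v * mvfderiv 𝓘(ℝ, F) φ x w)) := h
  have h'' := mul_left_cancel₀ (Real.exp_pos _).ne' h'
  rw [h'']
  ring

end LeviCivita

/-! ### Covariant derivatives along maps -/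

section CovariantDerivative

variable {F : Type*} [NormedAddCommGroup F] [NormedSpace ℝ F] [FiniteDimensional ℝ F]
  {N : Type*} [TopologicalSpace N] [ChartedSpace F N] [IsManifold 𝓘(ℝ, F) ∞ N]
  {E : Type*} [NormedAddCommGroup E] [NormedSpace ℝ E]
  {M : Type*} [TopologicalSpace M] [ChartedSpace E M]

theorem covAlong_eq (b : ∀ x : N, TangentSpace 𝓘(ℝ, F) x → TangentSpace 𝓘(ℝ, F) x → ℝ)
    (f : M → N) (V : ∀ p : M, TangentSpace 𝓘(ℝ, F) (f p)) (p : M) (w : TangentSpace 𝓘(ℝ, E) p) :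
    covAlong b f V p w =
      (show TangentSpace 𝓘(ℝ, F) (f p) from
        mvfderiv 𝓘(ℝ, E) (fun q => toCoord (f p) (f q) (V q)) p w) +
      christoffel b (f p) (mfderiv 𝓘(ℝ, E) 𝓘(ℝ, F) f p w) (V p) :=
  congrArg (· + _) (coordDeriv_eq f V p w)

/-- A smooth vector field on an open set agrees near each point of this set with a multiple of
it that is smooth everywhere. -/
theorem exists_smooth_extension [T2Space N] {U : Set N} (hU : IsOpen U) {x : N} (hx : x ∈ U)
    {X : ∀ y : N, TangentSpace 𝓘(ℝ, F) y}
    (hX : ContMDiffOn 𝓘(ℝ, F) (𝓘(ℝ, F).prod 𝓘(ℝ, F)) ∞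
      (fun y => (⟨y, X y⟩ : TangentBundle 𝓘(ℝ, F) N)) U) :
    ∃ ψ : N → ℝ, IsSmoothField (fun y => ψ y • X y) ∧ (∀ᶠ y in nhds x, ψ y = 1) ∧
      ∀ y ∉ U, ψ y = 0 := by
  obtain ⟨ψ, -, hψ⟩ := ((SmoothBumpFunction.nhds_basis_tsupport (I := 𝓘(ℝ, F)) x).mem_iff).1
    (hU.mem_nhds hx)
  refine ⟨ψ, ContMDiffOn.smul_section_of_tsupport ψ.contMDiff.contMDiffOn hU hψ hX,
    ψ.eventuallyEq_one, fun y hy => ?_⟩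
  by_contra h
  exact hy (hψ (subset_tsupport _ h))

theorem contMDiffOn_ofCoord_apply {x : N} {U : Set N} (hU : IsOpen U)
    (hUx : U ⊆ (chartAt F x).source) {a : N → F} (ha : ContMDiffOn 𝓘(ℝ, F) 𝓘(ℝ, F) ∞ a U) :
    ContMDiffOn 𝓘(ℝ, F) (𝓘(ℝ, F).prod 𝓘(ℝ, F)) ∞
      (fun y => (⟨y, ofCoord x y (a y)⟩ : TangentBundle 𝓘(ℝ, F) N)) U := by
  have := (Bundle.Trivialization.contMDiffOn_section_iff (IB := 𝓘(ℝ, F)) (n := ∞)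
    (s := fun y => ofCoord x y (a y)) (trivializationAt F (TangentSpace 𝓘(ℝ, F)) x) hU
    (by simpa using hUx)).2
  refine this (ha.congr fun y hy => ?_)
  have h := toCoord_ofCoord (hUx hy) (a y)
  rwa [toCoord, Bundle.Trivialization.continuousLinearMapAt_apply,
    Bundle.Trivialization.coe_linearMapAt_of_mem _ (by simpa using hUx hy)] at h

theorem contMDiffOn_ofCoord (x : N) (a : F) :
    ContMDiffOn 𝓘(ℝ, F) (𝓘(ℝ, F).prod 𝓘(ℝ, F)) ∞
      (fun y => (⟨y, ofCoord x y a⟩ : TangentBundle 𝓘(ℝ, F) N)) (chartAt F x).source :=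
  contMDiffOn_ofCoord_apply (chartAt F x).open_source subset_rfl contMDiffOn_const

variable {b : ∀ x : N, TangentSpace 𝓘(ℝ, F) x → TangentSpace 𝓘(ℝ, F) x → ℝ}
  {J : ∀ x : N, TangentSpace 𝓘(ℝ, F) x →L[ℝ] TangentSpace 𝓘(ℝ, F) x}

/-- The covariant derivative `(∇_a J) u`, in coordinates. -/
def nablaEndo (b : ∀ x : N, TangentSpace 𝓘(ℝ, F) x → TangentSpace 𝓘(ℝ, F) x → ℝ)
    (J : ∀ x : N, TangentSpace 𝓘(ℝ, F) x →L[ℝ] TangentSpace 𝓘(ℝ, F) x) (x : N)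
    (a u : TangentSpace 𝓘(ℝ, F) x) : TangentSpace 𝓘(ℝ, F) x :=
  dEndo J x a u + christoffel b x a (J x u) - J x (christoffel b x a u)

/-- The product rule `∇_w (J V) = J ∇_w V + (∇_w J) V`. -/
theorem covAlong_endo (hJ : ∀ x, MDifferentiableAt 𝓘(ℝ, F) 𝓘(ℝ, F →L[ℝ] F) (endoRep J x) x)
    {f : M → N} {V : ∀ p : M, TangentSpace 𝓘(ℝ, F) (f p)} {p : M}
    (hf : MDifferentiableAt 𝓘(ℝ, E) 𝓘(ℝ, F) f p) (hV : DiffAlong E f V p)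
    (w : TangentSpace 𝓘(ℝ, E) p) :
    covAlong b f (fun q => J (f q) (V q)) p w = J (f p) (covAlong b f V p w) +
      nablaEndo b J (f p) (mfderiv 𝓘(ℝ, E) 𝓘(ℝ, F) f p w) (V p) := by
  have hev : ∀ᶠ q in nhds p, f q ∈ (chartAt F (f p)).source :=
    hf.continuousAt.eventually (eventually_mem_chart_source (F := F) (f p))
  have h1 : mvfderiv 𝓘(ℝ, E) (fun q => toCoord (f p) (f q) (J (f q) (V q))) p =
      mvfderiv 𝓘(ℝ, E) (fun q => endoRep J (f p) (f q) (toCoord (f p) (f q) (V q))) p := by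
    refine mvfderiv_congr ?_
    filter_upwards [hev] with q hq
    simp only [endoRep, ContinuousLinearMap.comp_apply, ofCoord_toCoord hq]
  have h2 := mvfderiv_clm_apply (B := fun q => endoRep J (f p) (f q))
    ((hJ (f p)).comp p hf) hV w
  rw [mvfderiv_comp_vec (hJ (f p)) hf] at h2
  set D := mvfderiv 𝓘(ℝ, E) (fun q => toCoord (f p) (f q) (V q)) p w with hD
  have h3 : (mvfderiv 𝓘(ℝ, F) (endoRep J (f p)) (f p) (mfderiv 𝓘(ℝ, E) 𝓘(ℝ, F) f p w)
      (toCoord (f p) (f p) (V p)) + endoRep J (f p) (f p) D : F) =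
      dEndo J (f p) (mfderiv 𝓘(ℝ, E) 𝓘(ℝ, F) f p w) (V p) + J (f p) D := by
    rw [toCoord_self]
    exact congrArg (_ + ·) (endoRep_self J (f p) D)
  rw [covAlong_eq, covAlong_eq, h1, nablaEndo]
  rw [← hD, map_add]
  have h4 := h2.trans h3
  refine (congrArg (fun d : TangentSpace 𝓘(ℝ, F) (f p) => d +
    christoffel b (f p) (mfderiv 𝓘(ℝ, E) 𝓘(ℝ, F) f p w) (J (f p) (V p))) h4).trans ?_
  abel

end CovariantDerivative

section CovariantDerivative

variable {F : Type*} [NormedAddCommGroup F] [NormedSpace ℝ F] [FiniteDimensional ℝ F]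
  {N : Type*} [TopologicalSpace N] [ChartedSpace F N] [IsManifold 𝓘(ℝ, F) ∞ N]
  {E : Type*} [NormedAddCommGroup E] [NormedSpace ℝ E]
  {M : Type*} [TopologicalSpace M] [ChartedSpace E M]

/-- The Levi-Civita connection is metric. -/
theorem mvfderiv_inner (g : Metric F N)
    {f : M → N} {V W : ∀ p : M, TangentSpace 𝓘(ℝ, F) (f p)} {p : M}
    (hf : MDifferentiableAt 𝓘(ℝ, E) 𝓘(ℝ, F) f p) (hV : DiffAlong E f V p)
    (hW : DiffAlong E f W p) (w : TangentSpace 𝓘(ℝ, E) p) :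
    mvfderiv 𝓘(ℝ, E) (fun q => g.inner (f q) (V q) (W q)) p w =
      g.inner (f p) (covAlong g.form f V p w) (W p) +
        g.inner (f p) (V p) (covAlong g.form f W p w) := by
  have hev : ∀ᶠ q in nhds p, f q ∈ (chartAt F (f p)).source :=
    hf.continuousAt.eventually (eventually_mem_chart_source (F := F) (f p))
  have h1 : mvfderiv 𝓘(ℝ, E) (fun q => g.inner (f q) (V q) (W q)) p =
      mvfderiv 𝓘(ℝ, E) (fun q => metricRep g (f p) (f q) (toCoord (f p) (f q) (V q))
        (toCoord (f p) (f q) (W q))) p := by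
    refine mvfderiv_congr ?_
    filter_upwards [hev] with q hq
    rw [metricRep_apply g hq, ofCoord_toCoord hq, ofCoord_toCoord hq]
  have hg := mdifferentiableAt_metricRep g (f p)
  have hgf : MDifferentiableAt 𝓘(ℝ, E) 𝓘(ℝ, F →L[ℝ] F →L[ℝ] ℝ)
    (fun q => metricRep g (f p) (f q)) p := hg.comp p hf
  rw [h1, mvfderiv_clm_apply (mdifferentiableAt_clm_apply hgf hV) hW,
    mvfderiv_clm_apply hgf hV, mvfderiv_comp_vec hg hf, covAlong_eq, covAlong_eq]
  set DV := mvfderiv 𝓘(ℝ, E) (fun q => toCoord (f p) (f q) (V q)) p w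
  set DW := mvfderiv 𝓘(ℝ, E) (fun q => toCoord (f p) (f q) (W q)) p w
  set a := mfderiv 𝓘(ℝ, E) 𝓘(ℝ, F) f p w
  rw [toCoord_self, toCoord_self]
  have e1 : metricRep (F := F) g (f p) (f p) DV (W p) = g.inner (f p) DV (W p) :=
    metricRep_self g (f p) DV (W p)
  have e2 : metricRep (F := F) g (f p) (f p) (V p) DW = g.inner (f p) (V p) DW :=
    metricRep_self g (f p) (V p) DW
  have e3 : mvfderiv 𝓘(ℝ, F) (metricRep g (f p)) (f p) a (V p) (W p) = _ :=
    dMetric_eq g (f p) a (V p) (W p)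
  have e4 : g.inner (f p) ((show TangentSpace 𝓘(ℝ, F) (f p) from DV) +
      christoffel g.form (f p) a (V p)) (W p) = g.inner (f p) DV (W p) +
      g.inner (f p) (christoffel g.form (f p) a (V p)) (W p) := by
    rw [map_add, add_apply]
  have e5 : g.inner (f p) (V p) ((show TangentSpace 𝓘(ℝ, F) (f p) from DW) +
      christoffel g.form (f p) a (W p)) = g.inner (f p) (V p) DW +
      g.inner (f p) (V p) (christoffel g.form (f p) a (W p)) := by
    rw [map_add]
  refine Eq.trans ?_ (congrArg₂ (· + ·) e4 e5).symm
  refine (congrArg₂ (· + ·) (congrArg₂ (· + ·) e3 e1) e2).trans ?_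
  ring

/-- The connection being metric, the derivative can be moved from one field to the other when two
fields along a map stay orthogonal. -/
theorem inner_covAlong_of_orthogonal (g : Metric F N)
    {f : M → N} {V W : ∀ p : M, TangentSpace 𝓘(ℝ, F) (f p)} {p : M}
    (hf : MDifferentiableAt 𝓘(ℝ, E) 𝓘(ℝ, F) f p) (hV : DiffAlong E f V p)
    (hW : DiffAlong E f W p) (h : ∀ q, g.inner (f q) (V q) (W q) = 0)
    (w : TangentSpace 𝓘(ℝ, E) p) :
    g.inner (f p) (covAlong g.form f V p w) (W p) =
      -g.inner (f p) (V p) (covAlong g.form f W p w) := by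
  have h1 := mvfderiv_inner g hf hV hW w
  simp only [h, mvfderiv_const] at h1
  have h2 : (0 : TangentSpace 𝓘(ℝ, E) p →L[ℝ] ℝ) w = 0 := rfl
  linarith

end CovariantDerivative

/-! ### The covariant derivative of the complex structure -/

section ComplexStructure

variable {F : Type*} [NormedAddCommGroup F] [NormedSpace ℝ F] [FiniteDimensional ℝ F]
  {N : Type*} [TopologicalSpace N] [ChartedSpace F N] [IsManifold 𝓘(ℝ, F) ∞ N]
  {J : ∀ x : N, TangentSpace 𝓘(ℝ, F) x →L[ℝ] TangentSpace 𝓘(ℝ, F) x}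

/-- For a Kähler metric `∇J = 0` also as a tensor: a tangent vector extends to a smooth vector field
with locally constant coordinates. -/
theorem IsKahlerOn.nablaEndo_eq_zero [T2Space N]
    {b : ∀ x : N, TangentSpace 𝓘(ℝ, F) x → TangentSpace 𝓘(ℝ, F) x → ℝ} {U : Set N}
    (h : IsKahlerOn b J U) (hJ : ∀ x, MDifferentiableAt 𝓘(ℝ, F) 𝓘(ℝ, F →L[ℝ] F) (endoRep J x) x)
    {x : N} (hx : x ∈ U) (a u : TangentSpace 𝓘(ℝ, F) x) : nablaEndo b J x a u = 0 := by
  obtain ⟨ψ, h1, h2, -⟩ := exists_smooth_extension (chartAt F x).open_source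
    (mem_chart_source F x) (contMDiffOn_ofCoord (F := F) x u)
  have h3 := h _ h1 x hx a
  have h4 := covAlong_endo (b := b) hJ (f := fun y : N => y) mdifferentiableAt_id
    (diffAlong_of_contMDiffAt (E := F) (f := fun y : N => y) (h1 x)) a
  have h5 := h3.symm.trans h4
  rw [cov, left_eq_add] at h5
  have h6 : mfderiv 𝓘(ℝ, F) 𝓘(ℝ, F) (fun y : N => y) x a = a :=
    DFunLike.congr_fun (mfderiv_id (I := 𝓘(ℝ, F)) (x := x)) a
  have h7 : ψ x • ofCoord (F := F) x x u = u := by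
    rw [h2.self_of_nhds, one_smul]
    exact ofCoord_self (F := F) x u
  rw [h6, h7] at h5
  exact h5

theorem IsAlmostHermitian.inner_J_left {g : Metric F N} (h : IsAlmostHermitian g J) (x : N)
    (u v : TangentSpace 𝓘(ℝ, F) x) : g.inner x (J x u) v = -g.inner x u (J x v) := by
  rw [← h.isometry x u, h.sq]
  simp

theorem partial₂_kahlerForm {g : Metric F N} (h : IsAlmostHermitian g J) (x : N)
    (w u v : TangentSpace 𝓘(ℝ, F) x) :
    partial₂ (kahlerForm g J) x w u v = dMetric g x w u (J x v) + g.inner x u (dEndo J x w v) := by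
  have hJ := h.mdifferentiableAt_endoRep x
  have hg := mdifferentiableAt_metricRep g x
  have h1 : ∀ a b : F, mvfderiv 𝓘(ℝ, F) (fun y => metricRep g x y a (endoRep J x y b)) x w =
      mvfderiv 𝓘(ℝ, F) (metricRep g x) x w a (endoRep J x x b) +
        metricRep g x x a (mvfderiv 𝓘(ℝ, F) (endoRep J x) x w b) := by
    intro a b
    rw [mvfderiv_clm_apply (mdifferentiableAt_clm_apply hg mdifferentiableAt_const)
      (mdifferentiableAt_clm_apply hJ mdifferentiableAt_const), mvfderiv_clm_apply_const hg,
      mvfderiv_clm_apply_const hJ]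
  have h2 : ∀ y ∈ (chartAt F x).source, ∀ a b : F, metricRep g x y a (endoRep J x y b) =
      g.inner y (ofCoord x y a) (J y (ofCoord x y b)) := by
    intro y hy a b
    rw [metricRep_apply g hy]
    simp only [endoRep, ContinuousLinearMap.comp_apply, ofCoord_toCoord hy]
  have h3 : partial₂ (kahlerForm g J) x w u v =
      mvfderiv 𝓘(ℝ, F) (fun y => metricRep (F := F) g x y u (endoRep (F := F) J x y v)) x w := by
    refine DFunLike.congr_fun (mvfderiv_congr ?_) w
    filter_upwards [eventually_mem_chart_source (F := F) x] with y hy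
    rw [coordField_eq, coordField_eq]
    exact (h2 y hy u v).symm
  refine h3.trans ((h1 u v).trans ?_)
  exact congrArg₂ (· + ·)
    (congrArg (mvfderiv 𝓘(ℝ, F) (metricRep g x) x w u) (endoRep_self J x v))
    (metricRep_self g x u (dEndo J x w v))

/-- The exterior derivative of the Kähler form is the cyclic sum of the derivatives of the complex
structure. -/
theorem extDeriv₂_kahlerForm {g : Metric F N} (h : IsAlmostHermitian g J) (x : N)
    (u v w : TangentSpace 𝓘(ℝ, F) x) :
    extDeriv₂ (kahlerForm g J) x u v w = g.inner x v (nablaEndo g.form J x u w) +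
      g.inner x w (nablaEndo g.form J x v u) + g.inner x u (nablaEndo g.form J x w v) := by
  have key : ∀ a b c : TangentSpace 𝓘(ℝ, F) x, partial₂ (kahlerForm g J) x a b c =
      g.inner x b (nablaEndo g.form J x a c) + g.inner x (christoffel g.form x a b) (J x c) -
        g.inner x (christoffel g.form x a c) (J x b) := by
    intro a b c
    rw [partial₂_kahlerForm h, dMetric_eq, nablaEndo, map_sub, map_add,
      g.symm x b (J x (christoffel g.form x a c)), h.inner_J_left]
    ring
  rw [extDeriv₂, key, key, key, christoffel_symm g x v u, christoffel_symm g x w u,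
    christoffel_symm g x w v]
  ring

/-- In a locally conformal Kähler manifold, at each point, `∇J` is given by the differential `λ`
of the conformal factor, and `dΩ = λ ∧ Ω`. -/
theorem IsLCK.exists_nablaEndo [T2Space N] {g : Metric F N} (h : IsLCK g J) (x : N) :
    ∃ lam : TangentSpace 𝓘(ℝ, F) x →L[ℝ] ℝ,
      (∀ a u z, g.inner x (nablaEndo g.form J x a u) z =
        (lam (J x u) * g.inner x a z - lam u * g.inner x (J x a) z -
          g.inner x a (J x u) * lam z - g.inner x a u * lam (J x z)) / 2) ∧
      ∀ u v w, extDeriv₂ (kahlerForm g J) x u v w =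
        lam u * g.inner x v (J x w) + lam v * g.inner x w (J x u) +
          lam w * g.inner x u (J x v) := by
  obtain ⟨U, hU, hx, φ, hφ, -, hK⟩ := h.locally_conformal x
  have hφx : MDifferentiableAt 𝓘(ℝ, F) 𝓘(ℝ, ℝ) φ x :=
    (hφ.contMDiffAt (hU.mem_nhds hx)).mdifferentiableAt (by simp)
  have hJ := h.toIsAlmostHermitian.mdifferentiableAt_endoRep
  have h1 : ∀ a u z, g.inner x (nablaEndo g.form J x a u) z =
      (mvfderiv 𝓘(ℝ, F) φ x (J x u) * g.inner x a z -
        mvfderiv 𝓘(ℝ, F) φ x u * g.inner x (J x a) z -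
        g.inner x a (J x u) * mvfderiv 𝓘(ℝ, F) φ x z -
        g.inner x a u * mvfderiv 𝓘(ℝ, F) φ x (J x z)) / 2 := by
    intro a u z
    -- `∇J` vanishes for the conformal Kähler metric, whose Christoffel symbols are known
    have h2 := hK.nablaEndo_eq_zero hJ hx a u
    have h3 : g.inner x (dEndo J x a u) z = _ :=
      congrArg (fun t => g.inner x t z) (eq_sub_of_add_eq (sub_eq_zero.1 h2))
    simp only [map_sub, sub_apply] at h3
    simp only [nablaEndo, map_sub, map_add, sub_apply, add_apply, h3,
      h.toIsAlmostHermitian.inner_J_left x _ z, inner_christoffel_conformal g x hφx]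
    ring
  refine ⟨mvfderiv 𝓘(ℝ, F) φ x, h1, fun u v w => ?_⟩
  rw [extDeriv₂_kahlerForm h.toIsAlmostHermitian, g.symm x v, g.symm x w,
    g.symm x u (nablaEndo _ _ _ _ _), h1, h1, h1]
  have e := h.toIsAlmostHermitian.inner_J_left x
  rw [e u v, e v w, e w u, g.symm x v u, g.symm x w u, g.symm x w v]
  have e1 : g.inner x u (J x w) = - g.inner x w (J x u) := by rw [g.symm, e]
  have e2 : g.inner x v (J x u) = - g.inner x u (J x v) := by rw [g.symm, e]
  have e3 : g.inner x w (J x v) = - g.inner x v (J x w) := by rw [g.symm, e]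
  rw [e1, e2, e3]
  ring

end ComplexStructure

/-! ### Smooth projectors onto the kernel of a family of operators -/

section Projector

variable {E : Type*} [NormedAddCommGroup E] [NormedSpace ℝ E] [FiniteDimensional ℝ E]
  {M : Type*} [TopologicalSpace M] [ChartedSpace E M]
  {W : Type*} [NormedAddCommGroup W] [NormedSpace ℝ W]

theorem contMDiffAt_clm_of_apply {T : M → E →L[ℝ] W} {p : M}
    (h : ∀ u, ContMDiffAt 𝓘(ℝ, E) 𝓘(ℝ, W) ∞ (fun q => T q u) p) :
    ContMDiffAt 𝓘(ℝ, E) 𝓘(ℝ, E →L[ℝ] W) ∞ T p := by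
  let b := Module.finBasis ℝ E
  have e : T = fun q => ∑ i, ContinuousLinearMap.smulRightL ℝ E W
      (LinearMap.toContinuousLinearMap (b.coord i)) (T q (b i)) := by
    funext q
    ext u
    conv_lhs => rw [← b.sum_repr u]
    simp only [map_sum, map_smul, sum_apply]
    rfl
  rw [e]
  refine contMDiffAt_finsetSum fun i _ => ?_
  exact ((ContinuousLinearMap.smulRightL ℝ E W
    (LinearMap.toContinuousLinearMap (b.coord i))).contDiff.contMDiff.contMDiffAt).comp p (h (b i))

/-- A smooth family of operators with values in `K`, bijective on `K` at one point, has a smooth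
family of kernels near this point: the projections along `K` onto the kernels are smooth. -/
theorem exists_kernel_projector {U : Set M} (hU : IsOpen U) {p : M} (hp : p ∈ U)
    {T : M → E →L[ℝ] E} (hT : ContMDiffOn 𝓘(ℝ, E) 𝓘(ℝ, E →L[ℝ] E) ∞ T U) (K : Submodule ℝ E)
    (hK : ∀ q ∈ U, ∀ u, T q u ∈ K) (hinj : ∀ k ∈ K, T p k = 0 → k = 0) :
    ∃ V ⊆ U, IsOpen V ∧ p ∈ V ∧ ∃ P : M → E →L[ℝ] E,
      ContMDiffOn 𝓘(ℝ, E) 𝓘(ℝ, E →L[ℝ] E) ∞ P V ∧ ∀ q ∈ V,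
        (∀ u, T q (P q u) = 0) ∧ (∀ u, T q u = 0 → P q u = u) ∧ (∀ u, u - P q u ∈ K) ∧
          ∀ k ∈ K, P q k = 0 := by
  have hcomplete : CompleteSpace E := FiniteDimensional.complete ℝ E
  obtain ⟨C, hC⟩ := Submodule.exists_isCompl K
  let pr : E →L[ℝ] E := LinearMap.toContinuousLinearMap (Submodule.projection K C hC)
  have pr_mem : ∀ u, pr u ∈ K := fun u => Submodule.projection_apply_mem hC u
  have pr_of_mem : ∀ k ∈ K, pr k = k := fun k hk =>
    Submodule.projection_apply_of_mem_left hC hk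
  -- `A q` is `T q` on `K` and the identity modulo `K`; it is invertible where `T q` is bijective
  -- on `K`, and then `1 - (A q)⁻¹ T q` is the projector onto the kernel of `T q`
  let A : M → E →L[ℝ] E := fun q => (T q).comp pr + (ContinuousLinearMap.id ℝ E - pr)
  have A_apply : ∀ q u, A q u = T q (pr u) + (u - pr u) := fun q u => rfl
  have hA : ContMDiffOn 𝓘(ℝ, E) 𝓘(ℝ, E →L[ℝ] E) ∞ A U :=
    (hT.clm_comp contMDiffOn_const).add contMDiffOn_const
  have hAp : IsUnit (A p) := by
    have hi : Function.Injective (A p : E →ₗ[ℝ] E) := by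
      rw [injective_iff_map_eq_zero]
      intro u hu
      have h1 : T p (pr u) + (u - pr u) = 0 := hu
      have h2 := congrArg pr h1
      rw [map_add, map_sub, pr_of_mem _ (pr_mem u), sub_self, add_zero, map_zero,
        pr_of_mem _ (hK p hp _)] at h2
      have h3 := hinj _ (pr_mem u) h2
      rw [h3] at h1
      simpa using h1
    let e : E ≃L[ℝ] E := (LinearEquiv.ofInjectiveEndo _ hi).toContinuousLinearEquiv
    refine ⟨ContinuousLinearEquiv.toUnit e, ?_⟩
    ext u
    rfl
  let V : Set M := U ∩ A ⁻¹' {L | IsUnit L}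
  have hV : IsOpen V := hA.continuousOn.isOpen_inter_preimage hU Units.isOpen
  refine ⟨V, Set.inter_subset_left, hV, ⟨hp, hAp⟩,
    fun q => ContinuousLinearMap.id ℝ E - (Ring.inverse (A q)).comp (T q), ?_, ?_⟩
  · refine contMDiffOn_const.sub (ContMDiffOn.clm_comp (fun q hq => ?_)
      (hT.mono Set.inter_subset_left))
    obtain ⟨a, ha⟩ : IsUnit (A q) := hq.2
    have h1 : ContDiffAt ℝ ∞ Ring.inverse (A q) := ha ▸ contDiffAt_ringInverse ℝ a
    exact (h1.contMDiffAt.comp q (hA.contMDiffAt (hU.mem_nhds hq.1))).contMDiffWithinAt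
  · rintro q ⟨hqU, hq⟩
    have inv_left : ∀ u, Ring.inverse (A q) (A q u) = u := fun u =>
      DFunLike.congr_fun (Ring.inverse_mul_cancel _ hq) u
    have inv_right : ∀ u, A q (Ring.inverse (A q) u) = u := fun u =>
      DFunLike.congr_fun (Ring.mul_inverse_cancel _ hq) u
    have key : ∀ u, Ring.inverse (A q) (T q u) ∈ K ∧
        T q (Ring.inverse (A q) (T q u)) = T q u := by
      intro u
      set k := Ring.inverse (A q) (T q u) with hk
      have h1 : T q (pr k) + (k - pr k) = T q u := inv_right (T q u)
      have h2 := congrArg pr h1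
      rw [map_add, map_sub, pr_of_mem _ (pr_mem k), sub_self, add_zero,
        pr_of_mem _ (hK q hqU _), pr_of_mem _ (hK q hqU _)] at h2
      rw [h2, add_eq_left, sub_eq_zero] at h1
      rw [h1, h2]
      exact ⟨pr_mem k, rfl⟩
    refine ⟨fun u => ?_, fun u hu => ?_, fun u => ?_, fun k hk => ?_⟩
    · simp [(key u).2]
    · simp [hu]
    · simpa using (key u).1
    · have h1 : A q k = T q k := by rw [A_apply, pr_of_mem k hk, sub_self, add_zero]
      have h2 := inv_left k
      rw [h1] at h2
      simp [h2]

end Projector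

/-! ### Smooth fields along maps and sections of distributions -/

section Sections

variable {F : Type*} [NormedAddCommGroup F] [NormedSpace ℝ F]
  {N : Type*} [TopologicalSpace N] [ChartedSpace F N] [IsManifold 𝓘(ℝ, F) ∞ N]
  {E : Type*} [NormedAddCommGroup E] [NormedSpace ℝ E]
  {M : Type*} [TopologicalSpace M] [ChartedSpace E M] [IsManifold 𝓘(ℝ, E) ∞ M]

variable (E) in
/-- A vector field along a map is smooth at a point. -/
def SmoothAlong (f : M → N) (V : ∀ p : M, TangentSpace 𝓘(ℝ, F) (f p)) (p : M) : Prop :=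
  ContMDiffAt 𝓘(ℝ, E) (𝓘(ℝ, F).prod 𝓘(ℝ, F)) ∞
    (fun q => (⟨f q, V q⟩ : TangentBundle 𝓘(ℝ, F) N)) p

theorem SmoothAlong.inner (g : Metric F N) {f : M → N}
    {V W : ∀ p : M, TangentSpace 𝓘(ℝ, F) (f p)} {p : M} (hV : SmoothAlong E f V p)
    (hW : SmoothAlong E f W p) :
    ContMDiffAt 𝓘(ℝ, E) 𝓘(ℝ, ℝ) ∞ (fun q => g.inner (f q) (V q) (W q)) p := by
  have hf : ContMDiffAt 𝓘(ℝ, E) 𝓘(ℝ, F) ∞ f p := (Bundle.contMDiffAt_totalSpace.1 hV).1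
  have h : ContMDiffAt 𝓘(ℝ, E) (𝓘(ℝ, F).prod 𝓘(ℝ)) ∞
      (fun m => Bundle.TotalSpace.mk' ℝ (E := Bundle.Trivial N ℝ) (f m)
        (g.inner (f m) (V m) (W m))) p :=
    ContMDiffAt.clm_bundle_apply₂ (F₁ := F) (F₂ := F)
      (ContMDiffAt.comp p (g.contMDiff (f p)) hf) hV hW
  exact (Bundle.contMDiffAt_totalSpace.1 h).2

theorem IsAlmostHermitian.smoothAlong {g : Metric F N}
    {J : ∀ x : N, TangentSpace 𝓘(ℝ, F) x →L[ℝ] TangentSpace 𝓘(ℝ, F) x}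
    (h : IsAlmostHermitian g J) {f : M → N}
    {V : ∀ p : M, TangentSpace 𝓘(ℝ, F) (f p)} {p : M} (hV : SmoothAlong E f V p) :
    SmoothAlong E f (fun q => J (f q) (V q)) p := by
  have hf : ContMDiffAt 𝓘(ℝ, E) 𝓘(ℝ, F) ∞ f p := (Bundle.contMDiffAt_totalSpace.1 hV).1
  exact ContMDiffAt.clm_bundle_apply (F₁ := F) (F₂ := F)
    (ContMDiffAt.comp p (h.smooth (f p)) hf) hV

theorem SmoothAlong.diff {G : Type*} [NormedAddCommGroup G] [NormedSpace ℝ G]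
    {L : Type*} [TopologicalSpace L] [ChartedSpace G L] [IsManifold 𝓘(ℝ, G) ∞ L] {j : L → M}
    {f : M → N} (hf : ContMDiff 𝓘(ℝ, E) 𝓘(ℝ, F) ∞ f)
    {X : ∀ q : L, TangentSpace 𝓘(ℝ, E) (j q)} {q : L} (hX : SmoothAlong G j X q) :
    SmoothAlong G (fun r => f (j r)) (fun r => diff E F f (j r) (X r)) q := by
  have : IsManifold 𝓘(ℝ, F) 1 N := IsManifold.of_le (n := ∞) (by simp)
  have : IsManifold 𝓘(ℝ, E) 1 M := IsManifold.of_le (n := ∞) (by simp)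
  have h := hf.contMDiff_tangentMap (m := ∞) (by simp)
  exact (h ⟨j q, X q⟩).comp q hX

theorem SmoothAlong.diffAlong {f : M → N} {V : ∀ p : M, TangentSpace 𝓘(ℝ, F) (f p)} {p : M}
    (h : SmoothAlong E f V p) : DiffAlong E f V p := diffAlong_of_contMDiffAt h

end Sections

section Distributions

variable {F : Type*} [NormedAddCommGroup F] [NormedSpace ℝ F] [FiniteDimensional ℝ F]
  {N : Type*} [TopologicalSpace N] [ChartedSpace F N] [IsManifold 𝓘(ℝ, F) ∞ N]
  {E : Type*} [NormedAddCommGroup E] [NormedSpace ℝ E] [FiniteDimensional ℝ E]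
  {M : Type*} [TopologicalSpace M] [ChartedSpace E M] [IsManifold 𝓘(ℝ, E) ∞ M]
  {g : Metric F N} {f : M → N} {D : ∀ p : M, Submodule ℝ (TangentSpace 𝓘(ℝ, E) p)}

theorem inducedMetric_pos (hf : IsSmoothImmersion E F f) (p : M) (v : TangentSpace 𝓘(ℝ, E) p)
    (hv : v ≠ 0) : 0 < inducedMetric g f p v v :=
  g.pos (f p) _ fun h => hv (hf.injective_diff p (h.trans (map_zero _).symm))

theorem inducedMetric_symm (p : M) (v w : TangentSpace 𝓘(ℝ, E) p) :
    inducedMetric g f p v w = inducedMetric g f p w v :=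
  g.symm (f p) _ _

theorem smoothAlong_diff (hf : ContMDiff 𝓘(ℝ, E) 𝓘(ℝ, F) ∞ f)
    {X : ∀ q : M, TangentSpace 𝓘(ℝ, E) q} {p : M} (hX : SmoothAlong E (fun q : M => q) X p) :
    SmoothAlong E f (fun q => diff E F f q (X q)) p :=
  SmoothAlong.diff (j := fun q : M => q) hf hX

/-- A vector of a distribution extends to a section. -/
theorem IsSmoothDistribution.exists_section [T2Space M] (hD : IsSmoothDistribution D) {p : M}
    {v : TangentSpace 𝓘(ℝ, E) p} (hv : v ∈ D p) : ∃ Y, IsSection D Y ∧ Y p = v := by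
  obtain ⟨U, hU, hp, k, X, hX, hspan⟩ := hD p
  have hv' := hv
  rw [← (hspan p hp).2, Submodule.mem_span_range_iff_exists_fun] at hv'
  obtain ⟨c, hc⟩ := hv'
  have hsum : ContMDiffOn 𝓘(ℝ, E) (𝓘(ℝ, E).prod 𝓘(ℝ, E)) ∞
      (fun q => (⟨q, ∑ i, c i • X i q⟩ : TangentBundle 𝓘(ℝ, E) M)) U :=
    ContMDiffOn.sum_section fun i _ => contMDiffOn_const.smul_section (hX i)
  obtain ⟨ψ, h1, h2, h3⟩ := exists_smooth_extension hU hp hsum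
  refine ⟨_, ⟨h1, fun q => ?_⟩, ?_⟩
  · by_cases hq : q ∈ U
    · refine (D q).smul_mem _ (Submodule.sum_mem _ fun i _ => (D q).smul_mem _ ?_)
      rw [← (hspan q hq).2]
      exact Submodule.subset_span ⟨i, rfl⟩
    · simp [h3 q hq]
  · simp only [h2.self_of_nhds, one_smul, hc]

/-- Near each point, there are smooth projectors, in coordinates, onto the orthogonal complement
of a distribution, along a fixed subspace. -/
theorem exists_perp_projector (hf : IsSmoothImmersion E F f) (hD : IsSmoothDistribution D)
    (g : Metric F N) (p : M) :
    ∃ V : Set M, IsOpen V ∧ p ∈ V ∧ V ⊆ (chartAt E p).source ∧ ∃ (P : M → E →L[ℝ] E)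
      (K : Submodule ℝ E), ContMDiffOn 𝓘(ℝ, E) 𝓘(ℝ, E →L[ℝ] E) ∞ P V ∧ ∀ q ∈ V,
        (∀ u, ofCoord p q (P q u) ∈ perp g f D q) ∧
          (∀ u, ofCoord p q u ∈ perp g f D q → P q u = u) ∧ (∀ u, u - P q u ∈ K) ∧
          ∀ k ∈ K, P q k = 0 := by
  obtain ⟨U₀, hU₀, hp₀, k, X, hX₀, hspan₀⟩ := hD p
  let U := U₀ ∩ (chartAt E p).source
  have hU : IsOpen U := hU₀.inter (chartAt E p).open_source
  have hp : p ∈ U := ⟨hp₀, mem_chart_source E p⟩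
  have hX : ∀ i, ∀ q ∈ U, SmoothAlong E f (fun q => diff E F f q (X i q)) q := fun i q hq =>
    smoothAlong_diff hf.smooth ((hX₀ i).contMDiffAt (hU₀.mem_nhds hq.1))
  have hC : ∀ u : E, ∀ q ∈ U, SmoothAlong E f (fun q => diff E F f q (ofCoord p q u)) q :=
    fun u q hq => smoothAlong_diff hf.smooth
      ((contMDiffOn_ofCoord p u).contMDiffAt ((chartAt E p).open_source.mem_nhds hq.2))
  let x : Fin k → E := fun i => X i p
  have hxli : LinearIndependent ℝ x := (hspan₀ p hp₀).1
  -- `T q` collects the scalar products with a frame of `D`, so that its kernel is `D^⊥`; its values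
  -- are put in the space `K = D p`
  let T : M → E →L[ℝ] E := fun q => ∑ i, ContinuousLinearMap.smulRight
    ((g.inner (f q) (diff E F f q (X i q))).comp ((diff E F f q).comp (ofCoord p q))) (x i)
  have T_apply : ∀ q u, T q u = ∑ i,
      g.inner (f q) (diff E F f q (X i q)) (diff E F f q (ofCoord p q u)) • x i := by
    intro q u
    simp only [T, sum_apply]
    rfl
  have hT : ContMDiffOn 𝓘(ℝ, E) 𝓘(ℝ, E →L[ℝ] E) ∞ T U := by
    refine fun q hq => (contMDiffAt_clm_of_apply fun u => ?_).contMDiffWithinAt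
    simp only [T_apply]
    refine contMDiffAt_finsetSum fun i _ => ?_
    exact ((hX i q hq).inner g (hC u q hq)).smul contMDiffAt_const
  have T_ker : ∀ q ∈ U, ∀ u, T q u = 0 ↔ ofCoord p q u ∈ perp g f D q := by
    intro q hq u
    rw [T_apply]
    constructor
    · intro h w hw
      rw [← (hspan₀ q hq.1).2] at hw
      have h1 := Fintype.linearIndependent_iff.1 hxli _ h
      induction hw using Submodule.span_induction with
      | mem w hw =>
        obtain ⟨i, rfl⟩ := hw
        exact (inducedMetric_symm _ _ _).trans (h1 i)
      | zero => exact map_zero _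
      | add a b _ _ ha hb => rw [map_add, ha, hb, add_zero]
      | smul c a _ ha => rw [map_smul, ha, smul_zero]
    · intro h
      refine Finset.sum_eq_zero fun i _ => ?_
      have h1 : X i q ∈ D q := by
        rw [← (hspan₀ q hq.1).2]
        exact Submodule.subset_span ⟨i, rfl⟩
      have h2 : g.inner (f q) (diff E F f q (X i q)) (diff E F f q (ofCoord p q u)) = 0 :=
        (g.symm _ _ _).trans (h _ h1)
      rw [h2, zero_smul]
  obtain ⟨V, hVU, hV, hpV, P, hP, h⟩ := exists_kernel_projector hU hp hT
    (Submodule.span ℝ (Set.range x))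
    (fun q _ u => by
      rw [T_apply]
      exact Submodule.sum_mem _ fun i _ => Submodule.smul_mem _ _ (Submodule.subset_span ⟨i, rfl⟩))
    (fun u hu hTu => by
      have h1 := (T_ker p hp u).1 hTu
      have h2 : ofCoord p p u = (show TangentSpace 𝓘(ℝ, E) p from u) := ofCoord_self p u
      rw [h2] at h1
      have h3 : (show TangentSpace 𝓘(ℝ, E) p from u) ∈ D p := by
        rw [← (hspan₀ p hp₀).2]
        exact hu
      by_contra h0
      exact (inducedMetric_pos (g := g) hf p _ h0).ne' (h1 _ h3))
  refine ⟨V, hV, hpV, fun q hq => (hVU hq).2, P, _, hP, fun q hq => ⟨fun u => ?_, fun u hu => ?_,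
    (h q hq).2.2⟩⟩
  · exact (T_ker q (hVU hq) _).1 ((h q hq).1 u)
  · exact (h q hq).2.1 u ((T_ker q (hVU hq) u).2 hu)

/-- A vector of the orthogonal complement of a distribution extends to a section. -/
theorem exists_section_perp [T2Space M] (hf : IsSmoothImmersion E F f)
    (hD : IsSmoothDistribution D) {p : M} {v : TangentSpace 𝓘(ℝ, E) p}
    (hv : v ∈ perp g f D p) : ∃ Z, IsSection (perp g f D) Z ∧ Z p = v := by
  obtain ⟨V, hV, hp, hVs, P, K, hP, h⟩ := exists_perp_projector hf hD g p
  have hs : ContMDiffOn 𝓘(ℝ, E) (𝓘(ℝ, E).prod 𝓘(ℝ, E)) ∞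
      (fun q => (⟨q, ofCoord p q (P q (v : E))⟩ : TangentBundle 𝓘(ℝ, E) M)) V :=
    contMDiffOn_ofCoord_apply hV hVs (hP.clm_apply contMDiffOn_const)
  obtain ⟨ψ, h1, h2, h3⟩ := exists_smooth_extension hV hp hs
  refine ⟨_, ⟨h1, fun q => ?_⟩, ?_⟩
  · by_cases hq : q ∈ V
    · exact Submodule.smul_mem _ _ ((h q hq).1 _)
    · simp [h3 q hq]
  · have h4 : ofCoord (F := E) p p v = v := ofCoord_self (F := E) p v
    have h5 : P p v = v := (h p hp).2.1 v (by rw [h4]; exact hv)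
    simp only [h2.self_of_nhds, one_smul]
    exact (congrArg (ofCoord (F := E) p p) h5).trans h4

end Distributions

/-! ### Orthogonal projections -/

section Projection

variable {F : Type*} [NormedAddCommGroup F] [NormedSpace ℝ F] [FiniteDimensional ℝ F]
  {N : Type*} [TopologicalSpace N] [ChartedSpace F N] [IsManifold 𝓘(ℝ, F) ∞ N]

theorem proj_mem (g : Metric F N) {x : N} (S : Submodule ℝ (TangentSpace 𝓘(ℝ, F) x))
    (v : TangentSpace 𝓘(ℝ, F) x) : proj (g.bilin x) S v ∈ S :=
  (proj_spec (g.bilin x) (g.bilin_pos x) S v).1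

theorem inner_proj (g : Metric F N) {x : N} {S : Submodule ℝ (TangentSpace 𝓘(ℝ, F) x)}
    (v : TangentSpace 𝓘(ℝ, F) x) {w : TangentSpace 𝓘(ℝ, F) x} (hw : w ∈ S) :
    g.inner x (proj (g.bilin x) S v) w = g.inner x v w := by
  have h : g.inner x (v - proj (g.bilin x) S v) w = 0 :=
    (proj_spec (g.bilin x) (g.bilin_pos x) S v).2 w hw
  rw [map_sub, sub_apply, sub_eq_zero] at h
  exact h.symm

theorem Metric.eq_of_mem (g : Metric F N) {x : N} {S : Submodule ℝ (TangentSpace 𝓘(ℝ, F) x)}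
    {a b : TangentSpace 𝓘(ℝ, F) x} (ha : a ∈ S) (hb : b ∈ S)
    (h : ∀ w ∈ S, g.inner x a w = g.inner x b w) : a = b := by
  by_contra hab
  have h1 := g.pos x (a - b) (sub_ne_zero.2 hab)
  rw [(g.inner x).map_sub a b, sub_apply, h _ (S.sub_mem ha hb), sub_self] at h1
  exact lt_irrefl _ h1

theorem proj_eq_zero_iff (g : Metric F N) {x : N} {S : Submodule ℝ (TangentSpace 𝓘(ℝ, F) x)}
    (v : TangentSpace 𝓘(ℝ, F) x) :
    proj (g.bilin x) S v = 0 ↔ ∀ w ∈ S, g.inner x v w = 0 := by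
  constructor
  · intro h w hw
    rw [← inner_proj g v hw, h, map_zero, zero_apply]
  · intro h
    refine g.eq_of_mem (proj_mem g S v) S.zero_mem fun w hw => ?_
    rw [inner_proj g v hw, h w hw, map_zero, zero_apply]

end Projection

/-! ### The tangent bundle of the ambient manifold along a CR-submanifold -/

section CR

variable {F : Type*} [NormedAddCommGroup F] [NormedSpace ℝ F] [FiniteDimensional ℝ F]
  {N : Type*} [TopologicalSpace N] [ChartedSpace F N] [IsManifold 𝓘(ℝ, F) ∞ N]
  {E : Type*} [NormedAddCommGroup E] [NormedSpace ℝ E] [FiniteDimensional ℝ E]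
  {M : Type*} [TopologicalSpace M] [ChartedSpace E M] [IsManifold 𝓘(ℝ, E) ∞ M]
  {g : Metric F N} {J : ∀ x : N, TangentSpace 𝓘(ℝ, F) x →L[ℝ] TangentSpace 𝓘(ℝ, F) x}
  {η : ∀ x : N, TangentSpace 𝓘(ℝ, F) x →L[ℝ] ℝ}
  {f : M → N} {D : ∀ p : M, Submodule ℝ (TangentSpace 𝓘(ℝ, E) p)}

namespace IsCRSubmanifold

theorem exists_add (hM : IsCRSubmanifold g J f D) (p : M) (t : TangentSpace 𝓘(ℝ, E) p) :
    ∃ y ∈ D p, ∃ z ∈ perp g f D p, t = y + z := by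
  have h := proj_spec (inducedMetric g f p) (inducedMetric_pos hM.immersion p) (D p) t
  exact ⟨_, h.1, _, h.2, (add_sub_cancel _ _).symm⟩

theorem exists_J_eq (hM : IsCRSubmanifold g J f D) {p : M} {y : TangentSpace 𝓘(ℝ, E) p}
    (hy : y ∈ D p) : ∃ y' ∈ D p, J (f p) (diff E F f p y') = diff E F f p y := by
  have h : diff E F f p y ∈ jImage J f D p := by
    rw [hM.holomorphic p]
    exact ⟨y, hy, rfl⟩
  obtain ⟨y', hy', h'⟩ := h
  exact ⟨y', hy', h'⟩

theorem exists_eq_J (hM : IsCRSubmanifold g J f D) {p : M} {y : TangentSpace 𝓘(ℝ, E) p}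
    (hy : y ∈ D p) : ∃ y' ∈ D p, diff E F f p y' = J (f p) (diff E F f p y) := by
  have h : J (f p) (diff E F f p y) ∈ (D p).map (diff E F f p).toLinearMap := by
    rw [← hM.holomorphic p]
    exact ⟨y, hy, rfl⟩
  obtain ⟨y', hy', h'⟩ := h
  exact ⟨y', hy', h'⟩

theorem jPerp_le (hM : IsCRSubmanifold g J f D) (p : M) :
    jPerp g J f D p ≤ normalSpace E g f p := hM.totally_real p

theorem inner_J_perp (hM : IsCRSubmanifold g J f D) {p : M} {z : TangentSpace 𝓘(ℝ, E) p}
    (hz : z ∈ perp g f D p) (t : TangentSpace 𝓘(ℝ, E) p) :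
    g.inner (f p) (J (f p) (diff E F f p z)) (diff E F f p t) = 0 :=
  hM.totally_real p ⟨z, hz, rfl⟩ _ ⟨t, rfl⟩

theorem mem_mu_iff {p : M} {n : TangentSpace 𝓘(ℝ, F) (f p)} :
    n ∈ muBundle g J f D p ↔ (∀ t : TangentSpace 𝓘(ℝ, E) p, g.inner (f p) n (diff E F f p t) = 0) ∧
      ∀ z ∈ perp g f D p, g.inner (f p) n (J (f p) (diff E F f p z)) = 0 := by
  constructor
  · rintro ⟨h1, h2⟩
    exact ⟨fun t => h1 _ ⟨t, rfl⟩, fun z hz => h2 _ ⟨z, hz, rfl⟩⟩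
  · rintro ⟨h1, h2⟩
    refine ⟨?_, ?_⟩
    · rintro _ ⟨t, rfl⟩
      exact h1 t
    · rintro _ ⟨z, hz, rfl⟩
      exact h2 z hz

/-- The bundle `μ` is holomorphic. -/
theorem J_mem_mu (hM : IsCRSubmanifold g J f D) (hJ : IsAlmostHermitian g J) {p : M}
    {n : TangentSpace 𝓘(ℝ, F) (f p)} (hn : n ∈ muBundle g J f D p) :
    J (f p) n ∈ muBundle g J f D p := by
  rw [mem_mu_iff] at hn ⊢
  refine ⟨fun t => ?_, fun z hz => ?_⟩
  · obtain ⟨y, hy, z, hz, rfl⟩ := hM.exists_add p t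
    obtain ⟨y', -, h⟩ := hM.exists_eq_J hy
    rw [hJ.inner_J_left, map_add, map_add, ← h, map_add, hn.1, hn.2 z hz, add_zero, neg_zero]
  · rw [hJ.isometry, hn.1]

/-- The normal space is the orthogonal sum of `J D^⊥` and `μ`. -/
theorem forall_normal_iff (hM : IsCRSubmanifold g J f D) (p : M)
    (v : TangentSpace 𝓘(ℝ, F) (f p)) :
    (∀ n ∈ normalSpace E g f p, g.inner (f p) v n = 0) ↔
      (∀ z ∈ perp g f D p, g.inner (f p) v (J (f p) (diff E F f p z)) = 0) ∧
        ∀ n ∈ muBundle g J f D p, g.inner (f p) v n = 0 := by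
  constructor
  · exact fun h => ⟨fun z hz => h _ (hM.totally_real p ⟨z, hz, rfl⟩), fun n hn => h n hn.1⟩
  · rintro ⟨h1, h2⟩ n hn
    set m := proj (g.bilin (f p)) (jPerp g J f D p) n with hm
    have hm1 : m ∈ jPerp g J f D p := proj_mem g _ n
    have hm2 : n - m ∈ muBundle g J f D p :=
      ⟨Submodule.sub_mem _ hn (hM.jPerp_le p hm1),
        (proj_spec (g.bilin (f p)) (g.bilin_pos (f p)) _ n).2⟩
    obtain ⟨z, hz, hzm⟩ := hm1
    have h3 : g.inner (f p) v m = 0 := by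
      rw [← hzm]
      exact h1 z hz
    have h4 := h2 _ hm2
    rwa [map_sub, h3, sub_zero] at h4

/-- The tangent space of the ambient manifold is the orthogonal sum of `D`, `D^⊥` and the normal
space. -/
theorem mem_perp_iff (hM : IsCRSubmanifold g J f D) (p : M) (v : TangentSpace 𝓘(ℝ, F) (f p)) :
    v ∈ (perp g f D p).map (diff E F f p).toLinearMap ↔
      (∀ y ∈ D p, g.inner (f p) v (diff E F f p y) = 0) ∧
        ∀ n ∈ normalSpace E g f p, g.inner (f p) v n = 0 := by
  constructor
  · rintro ⟨z, hz, rfl⟩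
    exact ⟨fun y hy => hz y hy, fun n hn => (g.symm _ _ _).trans (hn _ ⟨z, rfl⟩)⟩
  · rintro ⟨h1, h2⟩
    set S := (perp g f D p).map (diff E F f p).toLinearMap with hS
    set m := proj (g.bilin (f p)) S v with hm
    have hm1 : m ∈ S := proj_mem g _ v
    have hm2 : ∀ w ∈ S, g.inner (f p) (v - m) w = 0 :=
      (proj_spec (g.bilin (f p)) (g.bilin_pos (f p)) _ v).2
    obtain ⟨z, hz, hzm⟩ := hm1
    have hzm' : diff E F f p z = m := hzm
    have hn : v - m ∈ normalSpace E g f p := by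
      rintro _ ⟨t, rfl⟩
      obtain ⟨y, hy, z', hz', rfl⟩ := hM.exists_add p t
      change g.inner (f p) (v - m) (diff E F f p (y + z')) = 0
      rw [map_add, map_add, hm2 (diff E F f p z') ⟨z', hz', rfl⟩, add_zero,
        (g.inner (f p)).map_sub v m, sub_apply, h1 y hy, zero_sub, neg_eq_zero, ← hzm']
      exact hz y hy
    have h3 : v - m = 0 := by
      by_contra h0
      refine (g.pos (f p) _ h0).ne' ?_
      have h4 : g.inner (f p) m (v - m) = 0 := (g.symm _ _ _).trans
        ((congrArg (g.inner (f p) (v - m)) hzm'.symm).trans (hn _ ⟨z, rfl⟩))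
      rw [(g.inner (f p)).map_sub v m, sub_apply, h2 _ hn, h4, sub_zero]
    rw [sub_eq_zero.1 h3]
    exact ⟨z, hz, hzm⟩

end IsCRSubmanifold

end CR

/-! ### The conditions on the second fundamental form -/

section Conditions

variable {F : Type*} [NormedAddCommGroup F] [NormedSpace ℝ F] [FiniteDimensional ℝ F]
  {N : Type*} [TopologicalSpace N] [ChartedSpace F N] [IsManifold 𝓘(ℝ, F) ∞ N]
  {E : Type*} [NormedAddCommGroup E] [NormedSpace ℝ E] [FiniteDimensional ℝ E]
  {M : Type*} [TopologicalSpace M] [ChartedSpace E M] [IsManifold 𝓘(ℝ, E) ∞ M]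
  {g : Metric F N} {J : ∀ x : N, TangentSpace 𝓘(ℝ, F) x →L[ℝ] TangentSpace 𝓘(ℝ, F) x}
  {η : ∀ x : N, TangentSpace 𝓘(ℝ, F) x →L[ℝ] ℝ}
  {f : M → N} {D : ∀ p : M, Submodule ℝ (TangentSpace 𝓘(ℝ, E) p)}

/-- The ambient covariant derivative `∇̄_X Z` of vector fields tangent to the submanifold. -/
def ambientCov (g : Metric F N) (f : M → N) (X Z : ∀ p : M, TangentSpace 𝓘(ℝ, E) p) (p : M) :
    TangentSpace 𝓘(ℝ, F) (f p) :=
  covAlong g.form f (fun q => diff E F f q (Z q)) p (X p)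

/-- The distribution `S` is autoparallel for the connection of the ambient manifold:
`∇̄_X Z ∈ Γ(S)` for all `X, Z ∈ Γ(S)`. -/
def IsAutoparallel (g : Metric F N) (f : M → N)
    (S : ∀ p : M, Submodule ℝ (TangentSpace 𝓘(ℝ, E) p)) : Prop :=
  ∀ X Z : ∀ p : M, TangentSpace 𝓘(ℝ, E) p, IsSection S X → IsSection S Z →
    ∀ p, ambientCov g f X Z p ∈ (S p).map (diff E F f p).toLinearMap

/-- The Lee form agrees with the differential of the conformal factor on every vector `u` for which
there is a nonzero vector orthogonal to `u` and `J u`. -/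
theorem IsLeeForm.inner_mul_eq (hJ : IsAlmostHermitian g J) (hη : IsLeeForm g J η) {x : N}
    {lam : TangentSpace 𝓘(ℝ, F) x →L[ℝ] ℝ}
    (hlam : ∀ u v w, extDeriv₂ (kahlerForm g J) x u v w =
        lam u * g.inner x v (J x w) + lam v * g.inner x w (J x u) +
          lam w * g.inner x u (J x v))
    {u v : TangentSpace 𝓘(ℝ, F) x} (h1 : g.inner x v u = 0) (h2 : g.inner x v (J x u) = 0) :
    g.inner x v v * lam u = g.inner x v v * η x u := by
  have h3 := (hlam u v (J x v)).symm.trans (hη.lee x u v (J x v))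
  have h4 : g.inner x (J x v) (J x u) = 0 := by rw [hJ.isometry, h1]
  have h5 : g.inner x u (J x v) = 0 := by rw [g.symm, hJ.inner_J_left, h2, neg_zero]
  simp only [wedge₁₂, kahlerForm, Metric.form, h4, h5, hJ.sq, map_neg, mul_zero, add_zero] at h3
  linarith

theorem smoothAlong_of_isSection (hf : IsSmoothImmersion E F f)
    {S : ∀ p : M, Submodule ℝ (TangentSpace 𝓘(ℝ, E) p)} {X : ∀ p : M, TangentSpace 𝓘(ℝ, E) p}
    (hX : IsSection S X) (p : M) : SmoothAlong E f (fun q => diff E F f q (X q)) p :=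
  smoothAlong_diff hf.smooth (hX.1 p)

section

variable (hN : IsLCK g J) (hη : IsLeeForm g J η) (hM : IsCRSubmanifold g J f D)
  {X Y Z : ∀ p : M, TangentSpace 𝓘(ℝ, E) p}

include hN hη hM

/-- The identity `g(∇̄_X Z, JY) = g(∇̄_X Y, JZ) - ½ g(X, Z) θ(Y)`: since `JZ` is orthogonal to `Y`,
the scalar product `g(∇̄_X JZ, Y)` is `-g(JZ, ∇̄_X Y)`, and `∇̄J` is known. -/
theorem inner_ambientCov_holomorphic [T2Space N] (hX : IsSection (perp g f D) X)
    (hZ : IsSection (perp g f D) Z) (hY : IsSection D Y) (p : M) :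
    2 * g.inner (f p) (ambientCov g f X Z p) (J (f p) (diff E F f p (Y p))) =
      2 * g.inner (f p) (ambientCov g f X Y p) (J (f p) (diff E F f p (Z p))) -
        inducedMetric g f p (X p) (Z p) * antiLeeForm J η (f p) (diff E F f p (Y p)) := by
  have hJ := hN.toIsAlmostHermitian
  obtain ⟨lam, h1, h2⟩ := hN.exists_nablaEndo (f p)
  have hfd : MDifferentiableAt 𝓘(ℝ, E) 𝓘(ℝ, F) f p :=
    (hM.immersion.smooth p).mdifferentiableAt (by simp)
  have hZs := smoothAlong_of_isSection hM.immersion hZ p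
  have hYs := smoothAlong_of_isSection hM.immersion hY p
  have h3 := covAlong_endo (b := g.form) hJ.mdifferentiableAt_endoRep hfd hZs.diffAlong (X p)
  have h4 := inner_covAlong_of_orthogonal g hfd (hJ.smoothAlong hZs).diffAlong hYs.diffAlong
    (fun q => hM.inner_J_perp (hZ.2 q) (Y q)) (X p)
  have h5 := h1 (diff E F f p (X p)) (diff E F f p (Z p)) (diff E F f p (Y p))
  have h6 : g.inner (f p) (J (f p) (diff E F f p (X p))) (diff E F f p (Y p)) = 0 :=
    hM.inner_J_perp (hX.2 p) _
  have h7 : g.inner (f p) (diff E F f p (X p)) (J (f p) (diff E F f p (Z p))) = 0 :=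
    (g.symm _ _ _).trans (hM.inner_J_perp (hZ.2 p) _)
  have h8 : g.inner (f p) (diff E F f p (X p)) (diff E F f p (Y p)) = 0 := hX.2 p _ (hY.2 p)
  have h9 := hη.inner_mul_eq hJ h2 (u := J (f p) (diff E F f p (Y p)))
    (v := diff E F f p (X p)) (by rw [← neg_eq_zero, ← hJ.inner_J_left, h6])
    (by rw [hJ.sq, map_neg, h8, neg_zero])
  -- `λ` and the Lee form agree on `J Y` unless `X` vanishes at `p`
  have h10 : g.inner (f p) (diff E F f p (X p)) (diff E F f p (Z p)) *
      lam (J (f p) (diff E F f p (Y p))) =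
      g.inner (f p) (diff E F f p (X p)) (diff E F f p (Z p)) *
        η (f p) (J (f p) (diff E F f p (Y p))) := by
    by_cases h0 : diff E F f p (X p) = 0
    · rw [h0, map_zero, zero_apply, zero_mul, zero_mul]
    · rw [mul_left_cancel₀ (g.pos _ _ h0).ne' h9]
  change covAlong g.form f (fun q => J (f q) (diff E F f q (Z q))) p (X p) =
    J (f p) (ambientCov g f X Z p) + nablaEndo g.form J (f p) (diff E F f p (X p))
      (diff E F f p (Z p)) at h3
  change g.inner (f p) (covAlong g.form f (fun q => J (f q) (diff E F f q (Z q))) p (X p))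
    (diff E F f p (Y p)) = -g.inner (f p) (J (f p) (diff E F f p (Z p)))
      (ambientCov g f X Y p) at h4
  rw [h3, map_add, add_apply, hJ.inner_J_left, h5, h6, h7, h8,
    g.symm (f p) (J (f p) (diff E F f p (Z p)))] at h4
  change 2 * _ = 2 * _ - g.inner (f p) (diff E F f p (X p)) (diff E F f p (Z p)) *
    η (f p) (J (f p) (diff E F f p (Y p)))
  linarith

/-- The identity `g(∇̄_X JZ, N) = -½ g(X, Z) g(A, N) - g(∇̄_X Z, JN)` for `N` in `μ`. -/
theorem inner_normalCov_mu [T2Space N] (hX : IsSection (perp g f D) X)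
    (hZ : IsSection (perp g f D) Z) (p : M)
    {n : TangentSpace 𝓘(ℝ, F) (f p)} (hn : n ∈ muBundle g J f D p) :
    2 * g.inner (f p) (covAlong g.form f (fun q => J (f q) (diff E F f q (Z q))) p (X p)) n =
      -inducedMetric g f p (X p) (Z p) * g.inner (f p) (antiLeeField g J η (f p)) n -
        2 * g.inner (f p) (ambientCov g f X Z p) (J (f p) n) := by
  have hJ := hN.toIsAlmostHermitian
  obtain ⟨lam, h1, h2⟩ := hN.exists_nablaEndo (f p)
  have hfd : MDifferentiableAt 𝓘(ℝ, E) 𝓘(ℝ, F) f p :=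
    (hM.immersion.smooth p).mdifferentiableAt (by simp)
  have hZs := smoothAlong_of_isSection hM.immersion hZ p
  have h3 := covAlong_endo (b := g.form) hJ.mdifferentiableAt_endoRep hfd hZs.diffAlong (X p)
  change covAlong g.form f (fun q => J (f q) (diff E F f q (Z q))) p (X p) =
    J (f p) (ambientCov g f X Z p) + nablaEndo g.form J (f p) (diff E F f p (X p))
      (diff E F f p (Z p)) at h3
  have hn' := IsCRSubmanifold.mem_mu_iff.1 hn
  have h5 := h1 (diff E F f p (X p)) (diff E F f p (Z p)) n
  have h6 : g.inner (f p) (J (f p) (diff E F f p (X p))) n = 0 :=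
    (g.symm _ _ _).trans (hn'.2 _ (hX.2 p))
  have h7 : g.inner (f p) (diff E F f p (X p)) (J (f p) (diff E F f p (Z p))) = 0 :=
    (g.symm _ _ _).trans (hM.inner_J_perp (hZ.2 p) _)
  have h8 : g.inner (f p) (diff E F f p (X p)) n = 0 := (g.symm _ _ _).trans (hn'.1 _)
  have h9 := hη.inner_mul_eq hJ h2 (u := J (f p) n)
    (v := diff E F f p (X p)) (by rw [← neg_eq_zero, ← hJ.inner_J_left, h6])
    (by rw [hJ.sq, map_neg, h8, neg_zero])
  have h10 : g.inner (f p) (diff E F f p (X p)) (diff E F f p (Z p)) * lam (J (f p) n) =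
      g.inner (f p) (diff E F f p (X p)) (diff E F f p (Z p)) * η (f p) (J (f p) n) := by
    by_cases h0 : diff E F f p (X p) = 0
    · rw [h0, map_zero, zero_apply, zero_mul, zero_mul]
    · rw [mul_left_cancel₀ (g.pos _ _ h0).ne' h9]
  have h11 : g.inner (f p) (antiLeeField g J η (f p)) n = η (f p) (J (f p) n) := by
    have h12 : g.inner (f p) (leeField g η (f p)) (J (f p) n) = η (f p) (J (f p) n) :=
      riesz_spec (g.bilin (f p)) (g.bilin_pos (f p)) (η (f p)).toLinearMap (J (f p) n)
    rw [antiLeeField, (g.inner (f p)).map_neg, neg_apply, hJ.inner_J_left, neg_neg, h12]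
  change _ = -g.inner (f p) (diff E F f p (X p)) (diff E F f p (Z p)) * _ - _
  rw [h3, map_add, add_apply, hJ.inner_J_left, h5, h6, h7, h8, h11]
  linarith

/-- The relation between the anti-Lee form and the second fundamental form says that `∇̄_X Z` is
orthogonal to `D` for `X, Z ∈ Γ(D^⊥)`. -/
theorem thetaRelation_iff [T2Space N] [T2Space M] : ThetaRelation g J η f D ↔
    ∀ X Z : ∀ p : M, TangentSpace 𝓘(ℝ, E) p, IsSection (perp g f D) X →
      IsSection (perp g f D) Z → ∀ p, ∀ y ∈ D p,
        g.inner (f p) (ambientCov g f X Z p) (diff E F f p y) = 0 := by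
  have hJ := hN.toIsAlmostHermitian
  -- the `J D^⊥`-component of the second fundamental form
  have key : ∀ (X Y : ∀ p : M, TangentSpace 𝓘(ℝ, E) p) (p : M), ∀ z ∈ perp g f D p,
      g.inner (f p) (proj (g.bilin (f p)) (jPerp g J f D p) (secondForm g f X Y p))
        (J (f p) (diff E F f p z)) =
      g.inner (f p) (ambientCov g f X Y p) (J (f p) (diff E F f p z)) := by
    intro X Y p z hz
    have hz' : J (f p) (diff E F f p z) ∈ jPerp g J f D p := ⟨z, hz, rfl⟩
    rw [inner_proj g _ hz', secondForm, inner_proj g _ (hM.jPerp_le p hz')]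
    rfl
  constructor
  · intro h X Z hX hZ p y hy
    obtain ⟨y', hy', hyy'⟩ := hM.exists_J_eq hy
    obtain ⟨Y, hY, rfl⟩ := hM.smooth.exists_section hy'
    have h1 := inner_ambientCov_holomorphic hN hη hM hX hZ hY p
    have h2 := congrArg (fun t => g.inner (f p) t (J (f p) (diff E F f p (Z p)))) (h X Y hX hY p)
    simp only [map_smul, smul_apply, key X Y p (Z p) (hZ.2 p), hJ.isometry, smul_eq_mul] at h2
    change _ * inducedMetric g f p (X p) (Z p) = _ at h2
    rw [hyy'] at h1
    linarith
  · intro h X Y hX hY p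
    refine g.eq_of_mem (S := jPerp g J f D p) (Submodule.smul_mem _ _ ⟨X p, hX.2 p, rfl⟩)
      (Submodule.smul_mem _ _ (proj_mem g _ _)) ?_
    rintro _ ⟨z, hz, rfl⟩
    obtain ⟨Z, hZ, rfl⟩ := exists_section_perp hM.immersion hM.smooth hz
    have h1 := inner_ambientCov_holomorphic hN hη hM hX hZ hY p
    obtain ⟨y', hy', hyy'⟩ := hM.exists_eq_J (hY.2 p)
    have h2 := h X Z hX hZ p y' hy'
    rw [hyy'] at h2
    change g.inner (f p) (_ • _) (J (f p) (diff E F f p (Z p))) =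
      g.inner (f p) (_ • _) (J (f p) (diff E F f p (Z p)))
    simp only [map_smul, smul_apply, key X Y p (Z p) (hZ.2 p), hJ.isometry, smul_eq_mul]
    change _ * inducedMetric g f p (X p) (Z p) = _
    linarith

/-- `h(X, Z) = 0` says that the normal component of `∇̄_X Z` vanishes. -/
theorem perpGeodesic_and_theta_iff [T2Space N] [T2Space M] :
    IsPerpGeodesic g f D ∧ ThetaRelation g J η f D ↔ IsAutoparallel g f (perp g f D) := by
  rw [thetaRelation_iff hN hη hM]
  constructor
  · rintro ⟨h1, h2⟩ X Z hX hZ p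
    rw [hM.mem_perp_iff]
    exact ⟨h2 X Z hX hZ p, (proj_eq_zero_iff g _).1 (h1 X Z hX hZ p)⟩
  · intro h
    exact ⟨fun X Z hX hZ p => (proj_eq_zero_iff g _).2
      ((hM.mem_perp_iff p _).1 (h X Z hX hZ p)).2,
      fun X Z hX hZ p => ((hM.mem_perp_iff p _).1 (h X Z hX hZ p)).1⟩

/-- The three conditions say that the components of `∇̄_X Z` in `D`, in `J D^⊥` and in `μ`
vanish. -/
theorem theta_and_normalRelation_iff [T2Space N] [T2Space M] :
    ThetaRelation g J η f D ∧ SecondFormInMu g J f D ∧ NormalRelation g J η f D ↔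
      IsAutoparallel g f (perp g f D) := by
  have hJ := hN.toIsAlmostHermitian
  have h2 : SecondFormInMu g J f D ↔ ∀ X Z : ∀ p : M, TangentSpace 𝓘(ℝ, E) p,
      IsSection (perp g f D) X → IsSection (perp g f D) Z → ∀ p, ∀ z ∈ perp g f D p,
        g.inner (f p) (ambientCov g f X Z p) (J (f p) (diff E F f p z)) = 0 := by
    refine forall_congr' fun X => forall_congr' fun Z => imp_congr_right fun hX =>
      imp_congr_right fun hZ => forall_congr' fun p => ?_
    have hn : secondForm g f X Z p ∈ normalSpace E g f p := proj_mem g _ _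
    have hn' : ∀ t : TangentSpace 𝓘(ℝ, E) p,
        g.inner (f p) (secondForm g f X Z p) (diff E F f p t) = 0 := fun t => hn _ ⟨t, rfl⟩
    rw [IsCRSubmanifold.mem_mu_iff, and_iff_right hn']
    refine forall_congr' fun z => imp_congr_right fun hz => ?_
    have hz' : J (f p) (diff E F f p z) ∈ jPerp g J f D p := ⟨z, hz, rfl⟩
    rw [secondForm, inner_proj g _ (hM.jPerp_le p hz')]
    rfl
  have h3 : NormalRelation g J η f D ↔ ∀ X Z : ∀ p : M, TangentSpace 𝓘(ℝ, E) p,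
      IsSection (perp g f D) X → IsSection (perp g f D) Z → ∀ p, ∀ n ∈ muBundle g J f D p,
        g.inner (f p) (ambientCov g f X Z p) n = 0 := by
    refine forall_congr' fun X => forall_congr' fun Z => imp_congr_right fun hX =>
      imp_congr_right fun hZ => forall_congr' fun p => ?_
    have key : ∀ n ∈ muBundle g J f D p,
        g.inner (f p) (proj (g.bilin (f p)) (muBundle g J f D p)
          (normalCov g f X (fun q => J (f q) (diff E F f q (Z q))) p)) n =
        g.inner (f p) ((-(1 / 2) * inducedMetric g f p (X p) (Z p)) •
          proj (g.bilin (f p)) (muBundle g J f D p) (antiLeeField g J η (f p))) n -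
        g.inner (f p) (ambientCov g f X Z p) (J (f p) n) := by
      intro n hn
      have h4 := inner_normalCov_mu hN hη hM hX hZ p hn
      rw [(g.inner (f p)).map_smul, smul_apply, inner_proj g _ hn, inner_proj g _ hn, normalCov,
        inner_proj g _ hn.1, smul_eq_mul]
      linarith
    constructor
    · intro h n hn
      have h5 := key (J (f p) n) (hM.J_mem_mu hJ hn)
      rw [h, hJ.sq, map_neg] at h5
      linarith
    · intro h
      refine g.eq_of_mem (proj_mem g _ _) (Submodule.smul_mem _ _ (proj_mem g _ _))
        fun n hn => ?_
      rw [key n hn, h _ (hM.J_mem_mu hJ hn), sub_zero]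
  rw [thetaRelation_iff hN hη hM, h2, h3]
  constructor
  · rintro ⟨h1, h2, h3⟩ X Z hX hZ p
    rw [hM.mem_perp_iff, hM.forall_normal_iff]
    exact ⟨h1 X Z hX hZ p, h2 X Z hX hZ p, h3 X Z hX hZ p⟩
  · intro h
    have h4 := fun X Z hX hZ p => (hM.mem_perp_iff p _).1 (h X Z hX hZ p)
    exact ⟨fun X Z hX hZ p => (h4 X Z hX hZ p).1,
      fun X Z hX hZ p => ((hM.forall_normal_iff p _).1 (h4 X Z hX hZ p).2).1,
      fun X Z hX hZ p => ((hM.forall_normal_iff p _).1 (h4 X Z hX hZ p).2).2⟩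

end

end Conditions

/-! ### Integral manifolds of an autoparallel distribution -/

section Leaves

variable {F : Type*} [NormedAddCommGroup F] [NormedSpace ℝ F] [FiniteDimensional ℝ F]
  {N : Type*} [TopologicalSpace N] [ChartedSpace F N] [IsManifold 𝓘(ℝ, F) ∞ N]
  {E : Type*} [NormedAddCommGroup E] [NormedSpace ℝ E] [FiniteDimensional ℝ E]
  {M : Type*} [TopologicalSpace M] [ChartedSpace E M] [IsManifold 𝓘(ℝ, E) ∞ M]
  {G : Type*} [NormedAddCommGroup G] [NormedSpace ℝ G] [FiniteDimensional ℝ G]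
  {L : Type*} [TopologicalSpace L] [ChartedSpace G L] [IsManifold 𝓘(ℝ, G) ∞ L]
  {g : Metric F N} {f : M → N} {D : ∀ p : M, Submodule ℝ (TangentSpace 𝓘(ℝ, E) p)} {j : L → M}

/-- The covariant derivative of a field which is pulled back along a second map. -/
theorem covAlong_comp {b : ∀ x : N, TangentSpace 𝓘(ℝ, F) x → TangentSpace 𝓘(ℝ, F) x → ℝ}
    {V : ∀ p : M, TangentSpace 𝓘(ℝ, F) (f p)} {r : L}
    (hf : MDifferentiableAt 𝓘(ℝ, E) 𝓘(ℝ, F) f (j r)) (hj : MDifferentiableAt 𝓘(ℝ, G) 𝓘(ℝ, E) j r)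
    (hV : DiffAlong E f V (j r)) (w : TangentSpace 𝓘(ℝ, G) r) :
    covAlong b (fun s => f (j s)) (fun s => V (j s)) r w =
      covAlong b f V (j r) (diff G E j r w) := by
  have h1 := mvfderiv_comp_vec hV hj w
  have h2 : mfderiv 𝓘(ℝ, G) 𝓘(ℝ, F) (fun s => f (j s)) r w =
      mfderiv 𝓘(ℝ, E) 𝓘(ℝ, F) f (j r) (mfderiv 𝓘(ℝ, G) 𝓘(ℝ, E) j r w) :=
    mfderiv_comp_apply r hf hj w
  rw [covAlong_eq, covAlong_eq, h1, h2]
  rfl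

/-- The differential of a map, in coordinates. -/
def diffRep (f : M → N) (p q : M) : E →L[ℝ] F :=
  (toCoord (f p) (f q)).comp ((diff E F f q).comp (ofCoord p q))

theorem contMDiffAt_diffRep (hf : ContMDiff 𝓘(ℝ, E) 𝓘(ℝ, F) ∞ f) (p : M) :
    ContMDiffAt 𝓘(ℝ, E) 𝓘(ℝ, E →L[ℝ] F) ∞ (diffRep (E := E) (F := F) f p) p :=
  contMDiffAt_clm_of_apply fun u => contMDiffAt_toCoord (smoothAlong_diff hf
    ((contMDiffOn_ofCoord p u).contMDiffAt
      ((chartAt E p).open_source.mem_nhds (mem_chart_source E p))))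

/-- Modulo the distribution, the covariant derivative of a field with values in the distribution
depends only on its value at the point. -/
theorem covAlong_sub_mem (hf : IsSmoothImmersion E F f) (hD : IsSmoothDistribution D)
    {r : L} (hj : ContMDiffAt 𝓘(ℝ, G) 𝓘(ℝ, E) ∞ j r)
    {ρ₁ ρ₂ : ∀ s : L, TangentSpace 𝓘(ℝ, E) (j s)} (h₁ : SmoothAlong G j ρ₁ r)
    (h₂ : SmoothAlong G j ρ₂ r) (hm₁ : ∀ s, ρ₁ s ∈ perp g f D (j s))
    (hm₂ : ∀ s, ρ₂ s ∈ perp g f D (j s)) (heq : ρ₁ r = ρ₂ r)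
    (b : ∀ x : N, TangentSpace 𝓘(ℝ, F) x → TangentSpace 𝓘(ℝ, F) x → ℝ)
    (w : TangentSpace 𝓘(ℝ, G) r) :
    covAlong b (fun s => f (j s)) (fun s => diff E F f (j s) (ρ₁ s)) r w -
      covAlong b (fun s => f (j s)) (fun s => diff E F f (j s) (ρ₂ s)) r w ∈
        (perp g f D (j r)).map (diff E F f (j r)).toLinearMap := by
  obtain ⟨V, hV, hp, hVs, P, K, hP, h⟩ := exists_perp_projector hf hD g (j r)
  have hjd : MDifferentiableAt 𝓘(ℝ, G) 𝓘(ℝ, E) j r := hj.mdifferentiableAt (by simp)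
  have hPd : MDifferentiableAt 𝓘(ℝ, E) 𝓘(ℝ, E →L[ℝ] E) P (j r) :=
    (hP.contMDiffAt (hV.mem_nhds hp)).mdifferentiableAt (by simp)
  have hev : ∀ᶠ s in nhds r, j s ∈ V := hj.continuousAt.eventually (hV.mem_nhds hp)
  have hιd : MDifferentiableAt 𝓘(ℝ, E) 𝓘(ℝ, E →L[ℝ] F) (diffRep f (j r)) (j r) :=
    (contMDiffAt_diffRep hf.smooth (j r)).mdifferentiableAt (by simp)
  -- in coordinates, the derivative of a field `ρ` is `∂(df) ρ + df (∂ρ)`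
  have key : ∀ ρ : ∀ s : L, TangentSpace 𝓘(ℝ, E) (j s), SmoothAlong G j ρ r →
      mvfderiv 𝓘(ℝ, G) (fun s => toCoord (f (j r)) (f (j s)) (diff E F f (j s) (ρ s))) r w =
      mvfderiv 𝓘(ℝ, E) (diffRep f (j r)) (j r) (mfderiv 𝓘(ℝ, G) 𝓘(ℝ, E) j r w)
        (toCoord (j r) (j r) (ρ r)) + diffRep f (j r) (j r)
          (mvfderiv 𝓘(ℝ, G) (fun s => toCoord (j r) (j s) (ρ s)) r w) := by
    intro ρ hρ
    have hρd := hρ.diffAlong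
    have h3 : mvfderiv 𝓘(ℝ, G) (fun s => toCoord (f (j r)) (f (j s)) (diff E F f (j s) (ρ s))) r =
        mvfderiv 𝓘(ℝ, G) (fun s => diffRep f (j r) (j s) (toCoord (j r) (j s) (ρ s))) r := by
      refine mvfderiv_congr ?_
      filter_upwards [hev] with s hs
      simp only [diffRep, ContinuousLinearMap.comp_apply, ofCoord_toCoord (hVs hs)]
    rw [h3, mvfderiv_clm_apply (B := fun s => diffRep f (j r) (j s)) (hιd.comp r hjd) hρd,
      mvfderiv_comp_vec hιd hjd]
  -- in coordinates, the fields are fixed by the projectors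
  have fixed : ∀ ρ : ∀ s : L, TangentSpace 𝓘(ℝ, E) (j s), SmoothAlong G j ρ r →
      (∀ s, ρ s ∈ perp g f D (j s)) →
      mvfderiv 𝓘(ℝ, G) (fun s => toCoord (j r) (j s) (ρ s)) r w =
      mvfderiv 𝓘(ℝ, E) P (j r) (mfderiv 𝓘(ℝ, G) 𝓘(ℝ, E) j r w)
        (toCoord (j r) (j r) (ρ r)) +
          P (j r) (mvfderiv 𝓘(ℝ, G) (fun s => toCoord (j r) (j s) (ρ s)) r w) := by
    intro ρ hρ hm
    have hρd := hρ.diffAlong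
    have h3 : mvfderiv 𝓘(ℝ, G) (fun s => toCoord (j r) (j s) (ρ s)) r =
        mvfderiv 𝓘(ℝ, G) (fun s => P (j s) (toCoord (j r) (j s) (ρ s))) r := by
      refine mvfderiv_congr ?_
      filter_upwards [hev] with s hs
      refine ((h _ hs).2.1 _ ?_).symm
      rw [ofCoord_toCoord (hVs hs)]
      exact hm s
    conv_lhs => rw [h3]
    rw [mvfderiv_clm_apply (B := fun s => P (j s)) (hPd.comp r hjd) hρd, mvfderiv_comp_vec hPd hjd]
  have e1 := key ρ₁ h₁
  have e2 := key ρ₂ h₂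
  have f1 := fixed ρ₁ h₁ hm₁
  have f2 := fixed ρ₂ h₂ hm₂
  -- the derivatives of the coordinates differ by an element of the distribution
  set d₁ := mvfderiv 𝓘(ℝ, G) (fun s => toCoord (j r) (j s) (ρ₁ s)) r w
  set d₂ := mvfderiv 𝓘(ℝ, G) (fun s => toCoord (j r) (j s) (ρ₂ s)) r w
  have f3 : P (j r) (d₁ - d₂) = d₁ - d₂ := by
    rw [heq] at f1
    conv_rhs => rw [f1, f2]
    rw [map_sub]
    abel
  have f4 : ofCoord (j r) (j r) (d₁ - d₂) ∈ perp g f D (j r) := by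
    rw [← f3]
    exact (h _ hp).1 _
  refine ⟨_, f4, ?_⟩
  have e3 : covAlong b (fun s => f (j s)) (fun s => diff E F f (j s) (ρ₁ s)) r w -
      covAlong b (fun s => f (j s)) (fun s => diff E F f (j s) (ρ₂ s)) r w =
      (show TangentSpace 𝓘(ℝ, F) (f (j r)) from
        diffRep (E := E) (F := F) f (j r) (j r) (d₁ - d₂)) := by
    rw [covAlong_eq, covAlong_eq, e1, e2, heq]
    refine (add_sub_add_right_eq_sub _ _ _).trans ((add_sub_add_left_eq_sub _ _ _).trans ?_)
    exact (map_sub (diffRep (E := E) (F := F) f (j r) (j r)) d₁ d₂).symm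
  rw [e3]
  exact (toCoord_self (f (j r)) (diff E F f (j r) (ofCoord (j r) (j r) (d₁ - d₂)))).symm

/-- The double orthogonal complement of a subspace is this subspace. -/
theorem proj_orth_eq_zero_iff (g : Metric F N) {x : N}
    (S : Submodule ℝ (TangentSpace 𝓘(ℝ, F) x)) (v : TangentSpace 𝓘(ℝ, F) x) :
    proj (g.bilin x) (orth (g.bilin x) S) v = 0 ↔ v ∈ S := by
  rw [proj_eq_zero_iff]
  constructor
  · intro h
    have h1 := proj_spec (g.bilin x) (g.bilin_pos x) S v
    set m := proj (g.bilin x) S v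
    have h2 : g.inner x m (v - m) = 0 := (g.symm _ _ _).trans (h1.2 _ h1.1)
    have h3 : v - m = 0 := by
      by_contra h0
      refine (g.pos x _ h0).ne' ?_
      rw [(g.inner x).map_sub v m, sub_apply, h _ h1.2, h2, sub_zero]
    rw [sub_eq_zero.1 h3]
    exact h1.1
  · intro hv w hw
    exact (g.symm _ _ _).trans (hw v hv)

variable (hf : IsSmoothImmersion E F f) (hD : IsSmoothDistribution D)
  (hj : IsIntegralManifold (G := G) (perp g f D) j)

include hf hj in
theorem diff_comp_apply (r : L) (w : TangentSpace 𝓘(ℝ, G) r) :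
    diff G F (fun s => f (j s)) r w = diff E F f (j r) (diff G E j r w) :=
  mfderiv_comp_apply r ((hf.smooth (j r)).mdifferentiableAt (by simp))
    ((hj.immersion.smooth r).mdifferentiableAt (by simp)) w

include hf hD hj in
/-- The second fundamental form of an integral manifold in the ambient manifold vanishes iff the
ambient covariant derivative of sections stays in the distribution. -/
theorem secondForm_integral_eq_zero_iff {X' Z' : ∀ s : L, TangentSpace 𝓘(ℝ, G) s}
    (hZ' : IsSmoothField Z') {X Z : ∀ p : M, TangentSpace 𝓘(ℝ, E) p}
    (hZ : IsSection (perp g f D) Z) {r : L} (hXr : diff G E j r (X' r) = X (j r))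
    (hZr : diff G E j r (Z' r) = Z (j r)) :
    secondForm g (fun s => f (j s)) X' Z' r = 0 ↔
      ambientCov g f X Z (j r) ∈ (perp g f D (j r)).map (diff E F f (j r)).toLinearMap := by
  have hrange : LinearMap.range (diff G F (fun s => f (j s)) r).toLinearMap =
      (perp g f D (j r)).map (diff E F f (j r)).toLinearMap := by
    rw [← hj.tangent r]
    ext v
    constructor
    · rintro ⟨w, rfl⟩
      exact ⟨_, ⟨w, rfl⟩, (diff_comp_apply hf hj r w).symm⟩
    · rintro ⟨_, ⟨w, rfl⟩, rfl⟩
      exact ⟨w, diff_comp_apply hf hj r w⟩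
  rw [secondForm, normalSpace, proj_orth_eq_zero_iff, hrange]
  have h1 : (fun s => diff G F (fun s => f (j s)) s (Z' s)) =
      fun s => diff E F f (j s) (diff G E j s (Z' s)) :=
    funext fun s => diff_comp_apply hf hj s (Z' s)
  have hj' := hj.immersion.smooth r
  have h2 := covAlong_sub_mem (g := g) hf hD hj' (ρ₁ := fun s => diff G E j s (Z' s))
    (ρ₂ := fun s => Z (j s)) (smoothAlong_diff hj.immersion.smooth (hZ' r))
    (ContMDiffAt.comp r (hZ.1 (j r)) hj')
    (fun s => by rw [← hj.tangent s]; exact ⟨Z' s, rfl⟩) (fun s => hZ.2 (j s)) hZr g.form (X' r)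
  have h3 := covAlong_comp (b := g.form) (r := r)
    (V := fun q => diff E F f q (Z q)) ((hf.smooth (j r)).mdifferentiableAt (by simp))
    (hj'.mdifferentiableAt (by simp)) (smoothAlong_of_isSection hf hZ (j r)).diffAlong (X' r)
  rw [hXr] at h3
  rw [h1]
  rw [h3] at h2
  change _ - ambientCov g f X Z (j r) ∈ _ at h2
  refine ⟨fun h4 => ?_, fun h4 => ?_⟩
  · have h5 := Submodule.sub_mem _ h4 h2
    rwa [sub_sub_cancel] at h5
  · have h5 := Submodule.add_mem _ h2 h4
    rwa [sub_add_cancel] at h5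

include hf hD hj in
/-- The integral manifolds of an autoparallel distribution are totally geodesic. -/
theorem IsAutoparallel.isTotallyGeodesic [T2Space M] (h : IsAutoparallel g f (perp g f D)) :
    IsTotallyGeodesic G g (fun s => f (j s)) := by
  intro X' Z' _ hZ' r
  have hmem : ∀ w, diff G E j r w ∈ perp g f D (j r) := fun w => by
    rw [← hj.tangent r]
    exact ⟨w, rfl⟩
  obtain ⟨X, hX, hXr⟩ := exists_section_perp hf hD (hmem (X' r))
  obtain ⟨Z, hZ, hZr⟩ := exists_section_perp hf hD (hmem (Z' r))
  exact (secondForm_integral_eq_zero_iff hf hD hj hZ' hZ hXr.symm hZr.symm).2 (h X Z hX hZ _)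

/-- A distribution with a totally geodesic integral manifold through each point is
autoparallel. -/
theorem IsRuled.isAutoparallel {M : Type u} [TopologicalSpace M] [ChartedSpace E M]
    [IsManifold 𝓘(ℝ, E) ∞ M] {f : M → N} {D : ∀ p : M, Submodule ℝ (TangentSpace 𝓘(ℝ, E) p)}
    (hf : IsSmoothImmersion E F f) (hD : IsSmoothDistribution D)
    (h : IsRuled g f (perp g f D)) : IsAutoparallel g f (perp g f D) := by
  intro X Z hX hZ p
  obtain ⟨k, L, _, _, _, _, _, _, j, hj, r, rfl⟩ := h.1 p
  have h1 : ∀ v ∈ perp g f D (j r), ∃ W : ∀ s : L, TangentSpace 𝓘(ℝ, EuclideanSpace ℝ (Fin k)) s,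
      IsSmoothField W ∧ diff (EuclideanSpace ℝ (Fin k)) E j r (W r) = v := by
    intro v hv
    rw [← hj.tangent r] at hv
    obtain ⟨w, hw⟩ := hv
    obtain ⟨ψ, h2, h3, -⟩ := exists_smooth_extension
      (chartAt (EuclideanSpace ℝ (Fin k)) r).open_source (mem_chart_source _ r)
      (contMDiffOn_ofCoord (F := EuclideanSpace ℝ (Fin k)) r w)
    refine ⟨_, h2, ?_⟩
    simp only [h3.self_of_nhds, one_smul]
    exact (congrArg (diff (EuclideanSpace ℝ (Fin k)) E j r)
      (ofCoord_self (F := EuclideanSpace ℝ (Fin k)) r w)).trans hw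
  obtain ⟨X', hX', hXr⟩ := h1 _ (hX.2 (j r))
  obtain ⟨Z', hZ', hZr⟩ := h1 _ (hZ.2 (j r))
  exact (secondForm_integral_eq_zero_iff hf hD hj hZ' hZ hXr hZr).1
    (h.2 k L j hj X' Z' hX' hZ' r)

end Leaves

/-! ### Commuting vector fields -/

section Frobenius

open Set _root_.Metric
open scoped NNReal

variable {E : Type*} [NormedAddCommGroup E] [NormedSpace ℝ E]
  {S : Type*} [NormedAddCommGroup S] [NormedSpace ℝ S]

/-- The theorem of Picard and Lindelöf on `[0, 1]`, with the information that the solution stays in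
the ball. -/
theorem exists_ode_solution_mem_closedBall [CompleteSpace E] {v : E → E} {x₀ : E} {a B K : ℝ≥0}
    (hb : ∀ x ∈ closedBall x₀ a, ‖v x‖ ≤ B) (hl : LipschitzOnWith K v (closedBall x₀ a))
    (hBa : B ≤ a) : ∃ α : ℝ → E, α 0 = x₀ ∧ (∀ t, α t ∈ closedBall x₀ a) ∧
      ∀ t ∈ Icc (0 : ℝ) 1, HasDerivWithinAt α (v (α t)) (Icc 0 1) t := by
  have hp : IsPicardLindelof (fun _ => v) (tmin := 0) (tmax := 1) ⟨0, by simp⟩ x₀ a 0 B K :=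
    IsPicardLindelof.of_time_independent hb hl (by simpa using hBa)
  obtain ⟨α, hα⟩ := ODE.FunSpace.exists_isFixedPt_next hp (mem_closedBall_self le_rfl)
  refine ⟨α.compProj, ?_, fun t => α.compProj_mem_closedBall hp.mul_max_le, fun t ht => ?_⟩
  · have h := ODE.FunSpace.compProj_val (α := α) (t := ⟨0, by simp⟩)
    rw [← hα, ODE.FunSpace.next_apply₀] at h
    rw [hα] at h
    exact h
  · exact (ODE.hasDerivWithinAt_picard_Icc (t₀ := 0) (by simp) hp.continuousOn_uncurry
      α.continuous_compProj.continuousOn (fun _ _ => α.compProj_mem_closedBall hp.mul_max_le)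
      x₀ ht).congr_of_mem (fun t ht => by
        rw [ODE.FunSpace.compProj_of_mem ht]
        exact (ODE.FunSpace.isFixedPt_next_iff hp _).1 hα ⟨t, ht⟩) ht

/-- The inequality of Gronwall on `[0, 1]` for a curve starting at `0`, with a bound linear in
`ε`. -/
theorem norm_le_of_deriv_le {z z' : ℝ → E} {K ε : ℝ} (hK : 0 < K) (hε : 0 ≤ ε)
    (hz : ∀ t ∈ Icc (0 : ℝ) 1, HasDerivWithinAt z (z' t) (Icc 0 1) t) (h0 : z 0 = 0)
    (hb : ∀ t ∈ Icc (0 : ℝ) 1, ‖z' t‖ ≤ K * ‖z t‖ + ε) :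
    ∀ t ∈ Icc (0 : ℝ) 1, ‖z t‖ ≤ Real.exp K / K * ε := by
  intro t ht
  have h := norm_le_gronwallBound_of_norm_deriv_right_le (f := z) (f' := z') (δ := 0) (K := K)
    (ε := ε) (a := 0) (b := 1) (fun t ht => (hz t ht).continuousWithinAt)
    (fun t ht => (hz t (Ico_subset_Icc_self ht)).mono_of_mem_nhdsWithin
      (Icc_mem_nhdsGE_of_mem ht)) (by simp [h0])
    (fun t ht => hb t (Ico_subset_Icc_self ht)) t ht
  refine h.trans ?_
  rw [gronwallBound_of_K_ne_0 hK.ne']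
  simp only [zero_mul, zero_add, sub_zero]
  have h1 : Real.exp (K * t) ≤ Real.exp K := Real.exp_le_exp.2 (by nlinarith [ht.2])
  have h2 : ε / K * (Real.exp (K * t) - 1) ≤ ε / K * Real.exp K :=
    mul_le_mul_of_nonneg_left (by linarith) (by positivity)
  calc _ ≤ _ := h2
    _ = _ := by ring

set_option synthInstance.maxHeartbeats 200000 in
/-- A solution of `dy = A(y)`: its value at `s` is the value at time `1` of the integral curve of
the vector field `A(·) s`. For `v = s' - s`, the difference of two integral curves satisfies
`φ_{s'}(t) - φ_s(t) = t A(φ_s(t)) v + O(‖v‖²)`, because by the commutation relation both sides solve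
the same linear equation up to an error `O(‖v‖²)`. -/
theorem exists_hasFDerivAt_of_commute_aux [CompleteSpace E] {A : E → S →L[ℝ] E}
    {A' : E → E →L[ℝ] S →L[ℝ] E} {x₀ : E} {a C l m : ℝ≥0}
    (hA : ∀ x ∈ closedBall x₀ a, HasFDerivAt A (A' x) x)
    (hC : ∀ x ∈ closedBall x₀ a, ‖A x‖ ≤ C) (hl : ∀ x ∈ closedBall x₀ a, ‖A' x‖ ≤ l)
    (hm : LipschitzOnWith m A' (closedBall x₀ a))
    (hcomm : ∀ x ∈ closedBall x₀ a, ∀ v w, A' x (A x v) w = A' x (A x w) v)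
    {r : ℝ≥0} (hr0 : 0 < r) (hr : C * r ≤ a) :
    ∃ y : S → E, y 0 = x₀ ∧ (∀ s ∈ ball (0 : S) r, y s ∈ closedBall x₀ a) ∧
      ∀ s ∈ ball (0 : S) r, HasFDerivAt y (A (y s)) s := by
  have hlip : ∀ x ∈ closedBall x₀ a, ∀ y ∈ closedBall x₀ a, ‖A y - A x‖ ≤ l * ‖y - x‖ :=
    fun x hx y hy => (convex_closedBall x₀ a).norm_image_sub_le_of_norm_hasFDerivWithin_le
      (fun z hz => (hA z hz).hasFDerivWithinAt) hl hx hy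
  have htaylor : ∀ x ∈ closedBall x₀ a, ∀ y ∈ closedBall x₀ a,
      ‖A y - A x - A' x (y - x)‖ ≤ m * ‖y - x‖ * ‖y - x‖ := by
    intro x hx y hy
    have hseg : segment ℝ x y ⊆ closedBall x₀ a :=
      (convex_closedBall x₀ (a : ℝ)).segment_subset hx hy
    refine (convex_segment x y).norm_image_sub_le_of_norm_hasFDerivWithin_le'
      (fun z hz => (hA z (hseg hz)).hasFDerivWithinAt) (fun z hz => ?_)
      (left_mem_segment ℝ x y) (right_mem_segment ℝ x y)
    have h := hm.dist_le_mul z (hseg hz) x hx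
    rw [dist_eq_norm, dist_eq_norm] at h
    refine h.trans (mul_le_mul_of_nonneg_left ?_ m.2)
    exact norm_sub_le_of_mem_segment hz
  -- the integral curves
  have hex : ∀ s ∈ ball (0 : S) r, ∃ α : ℝ → E, α 0 = x₀ ∧ (∀ t, α t ∈ closedBall x₀ a) ∧
      ∀ t ∈ Icc (0 : ℝ) 1, HasDerivWithinAt α (A (α t) s) (Icc 0 1) t := by
    intro s hs
    have hs' : ‖s‖ ≤ r := (mem_ball_zero_iff.1 hs).le
    refine exists_ode_solution_mem_closedBall (v := fun x => A x s) (B := C * r) (K := l * r)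
      (fun x hx => ?_) (LipschitzOnWith.of_dist_le_mul fun x hx y hy => ?_) hr
    · exact ((A x).le_opNorm s).trans (mul_le_mul (hC x hx) hs' (norm_nonneg _) C.2)
    · rw [dist_eq_norm, dist_eq_norm, ← sub_apply]
      refine ((A x - A y).le_opNorm s).trans ?_
      refine (mul_le_mul (hlip y hy x hx) hs' (norm_nonneg _) (by positivity)).trans_eq ?_
      push_cast
      ring
  choose! φ hφ0 hφmem hφ using hex
  have h0r : (0 : S) ∈ ball (0 : S) r := mem_ball_self hr0
  refine ⟨fun s => φ s 1, ?_, fun s hs => hφmem s hs 1, ?_⟩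
  · have h := norm_le_of_deriv_le (z := fun t => φ 0 t - x₀) (z' := fun _ => 0)
      (K := 1) one_pos le_rfl (fun t ht => by simpa using (hφ 0 h0r t ht).sub_const x₀)
      (by simp [hφ0 0 h0r])
      (fun t _ => by simp) 1 (right_mem_Icc.2 zero_le_one)
    simpa [sub_eq_zero] using h
  intro s hs
  -- the summand `1` makes the Lipschitz constant positive
  set K : ℝ := l * r + 1 with hK
  have hK0 : 0 < K := by positivity
  set c : ℝ := Real.exp K / K * C with hc
  have hc0 : 0 ≤ c := by positivity
  have hsr : ‖s‖ ≤ r := (mem_ball_zero_iff.1 hs).le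
  have key : ∀ s' ∈ ball (0 : S) r, ‖φ s' 1 - φ s 1 - A (φ s 1) (s' - s)‖ ≤
      Real.exp K / K * (m * c ^ 2 * r + l * c) * ‖s' - s‖ ^ 2 := by
    intro s' hs'
    set v := s' - s with hv
    -- Lipschitz dependence of the integral curves on the parameter
    have hδ : ∀ t ∈ Icc (0 : ℝ) 1, ‖φ s' t - φ s t‖ ≤ c * ‖v‖ := by
      intro t ht
      refine (norm_le_of_deriv_le (z := fun t => φ s' t - φ s t)
        (z' := fun t => A (φ s' t) s' - A (φ s t) s) (ε := C * ‖v‖) hK0 (by positivity)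
        (fun t ht => (hφ s' hs' t ht).sub (hφ s hs t ht)) (by simp [hφ0 s hs, hφ0 s' hs'])
        (fun t _ => ?_) t ht).trans_eq (by rw [hc]; ring)
      have e : A (φ s' t) s' - A (φ s t) s = (A (φ s' t) - A (φ s t)) s + A (φ s' t) v := by
        simp [hv]
      have h1 := ((A (φ s' t) - A (φ s t)).le_opNorm s).trans
        (mul_le_mul (hlip _ (hφmem s hs t) _ (hφmem s' hs' t)) hsr (norm_nonneg _)
          (by positivity))
      have h2 := (A (φ s' t)).le_of_opNorm_le (hC _ (hφmem s' hs' t)) v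
      rw [e]
      refine (norm_add_le _ _).trans ?_
      nlinarith [norm_nonneg (φ s' t - φ s t)]
    have hz : ∀ t ∈ Icc (0 : ℝ) 1, HasDerivWithinAt
        (fun t => φ s' t - φ s t - t • A (φ s t) v)
        (A (φ s' t) s' - A (φ s t) s -
          (t • A' (φ s t) (A (φ s t) s) v + (1 : ℝ) • A (φ s t) v)) (Icc 0 1) t := by
      intro t ht
      have h1 := (hA _ (hφmem s hs t)).comp_hasDerivWithinAt t (hφ s hs t ht)
      have h2 : HasDerivWithinAt (fun t => A (φ s t) v) (A' (φ s t) (A (φ s t) s) v)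
          (Icc 0 1) t := by
        simpa using h1.clm_apply (hasDerivWithinAt_const t (Icc (0 : ℝ) 1) v)
      exact ((hφ s' hs' t ht).sub (hφ s hs t ht)).sub ((hasDerivWithinAt_id t _).smul h2)
    have h := norm_le_of_deriv_le (ε := (m * c ^ 2 * r + l * c) * ‖v‖ ^ 2) hK0 (by positivity)
      hz (by simp [hφ0 s hs, hφ0 s' hs']) (fun t ht => ?_) 1 (right_mem_Icc.2 zero_le_one)
    · simp only [one_smul] at h
      exact h.trans_eq (by ring)
    -- the commutation relation turns the derivative of the error into a linear equation for it,
    -- up to terms of second order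
    have e : A (φ s' t) s' - A (φ s t) s -
        (t • A' (φ s t) (A (φ s t) s) v + (1 : ℝ) • A (φ s t) v) =
        A' (φ s t) (φ s' t - φ s t - t • A (φ s t) v) s +
        (A (φ s' t) - A (φ s t) - A' (φ s t) (φ s' t - φ s t)) s +
        (A (φ s' t) - A (φ s t)) v := by
      rw [hcomm _ (hφmem s hs t) s v]
      simp only [map_sub, map_smul, sub_apply, smul_apply, one_smul, hv]
      abel
    have d0 := hδ t ht
    have d1 : ‖A' (φ s t) (φ s' t - φ s t - t • A (φ s t) v) s‖ ≤
        l * ‖φ s' t - φ s t - t • A (φ s t) v‖ * r :=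
      ((A' (φ s t) _).le_opNorm s).trans (mul_le_mul
        ((A' (φ s t)).le_of_opNorm_le (hl _ (hφmem s hs t)) _) hsr (norm_nonneg _)
        (by positivity))
    have d2 : ‖(A (φ s' t) - A (φ s t) - A' (φ s t) (φ s' t - φ s t)) s‖ ≤
        m * (c * ‖v‖) * (c * ‖v‖) * r := by
      refine (ContinuousLinearMap.le_opNorm _ s).trans
        (mul_le_mul ((htaylor _ (hφmem s hs t) _ (hφmem s' hs' t)).trans ?_) hsr (norm_nonneg _)
          (by positivity))
      gcongr
    have d3 : ‖(A (φ s' t) - A (φ s t)) v‖ ≤ l * (c * ‖v‖) * ‖v‖ := by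
      refine (ContinuousLinearMap.le_opNorm _ v).trans (mul_le_mul_of_nonneg_right
        ((hlip _ (hφmem s hs t) _ (hφmem s' hs' t)).trans ?_) (norm_nonneg _))
      gcongr
    rw [e]
    refine ((norm_add_le _ _).trans (add_le_add (norm_add_le _ _) le_rfl)).trans ?_
    have := norm_nonneg (φ s' t - φ s t - t • A (φ s t) v)
    rw [hK]
    nlinarith
  refine HasFDerivAt.of_isLittleO (Asymptotics.IsBigO.trans_isLittleO
    (g := fun s' => ‖s' - s‖ ^ 2) ?_ (Asymptotics.isLittleO_pow_sub_sub s one_lt_two))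
  refine Asymptotics.IsBigO.of_bound (Real.exp K / K * (m * c ^ 2 * r + l * c)) ?_
  filter_upwards [isOpen_ball.mem_nhds hs] with s' hs'
  simpa using key s' hs'

theorem eventually_norm_lt_of_contDiffAt {H : Type*} [NormedAddCommGroup H] [NormedSpace ℝ H]
    {f : E → H} {x₀ : E} {n : WithTop ℕ∞} (hf : ContDiffAt ℝ n f x₀) :
    ∀ᶠ x in nhds x₀, ‖f x‖ < ‖f x₀‖₊ + 1 :=
  hf.continuousAt.norm.eventually_lt_const (by simp)

set_option synthInstance.maxHeartbeats 200000 in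
/-- Local solvability of the total differential equation `dy = A(y)`, `y(0) = x₀`, under the
integrability condition that the vector fields `A(·) v` commute. -/
theorem exists_hasFDerivAt_of_commute [CompleteSpace E] {A : E → S →L[ℝ] E} {U : Set E}
    (hU : IsOpen U) {x₀ : E} (hx₀ : x₀ ∈ U) (hA : ContDiffOn ℝ ∞ A U)
    (hcomm : ∀ x ∈ U, ∀ v w, fderiv ℝ A x (A x v) w = fderiv ℝ A x (A x w) v) :
    ∃ (y : S → E) (r : ℝ), 0 < r ∧ y 0 = x₀ ∧ (∀ s ∈ ball (0 : S) r, y s ∈ U) ∧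
      (∀ s ∈ ball (0 : S) r, HasFDerivAt y (A (y s)) s) ∧ ContDiffOn ℝ ∞ y (ball 0 r) := by
  have hAx : ContDiffAt ℝ ∞ A x₀ := hA.contDiffAt (hU.mem_nhds hx₀)
  have hA'x : ContDiffAt ℝ 1 (fderiv ℝ A) x₀ := hAx.fderiv_right (m := 1) (by norm_cast)
  obtain ⟨m, W, hW, hm⟩ := hA'x.exists_lipschitzOnWith
  have h1 : ∀ᶠ x in nhds x₀, ‖A x‖ < ‖A x₀‖₊ + 1 :=
    hAx.continuousAt.norm.eventually_lt_const (by simp)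
  have h2 : ∀ᶠ x in nhds x₀, ‖fderiv ℝ A x‖ < ‖fderiv ℝ A x₀‖₊ + 1 :=
    eventually_norm_lt_of_contDiffAt hA'x
  obtain ⟨a, ha, hball⟩ := nhds_basis_closedBall.mem_iff.1
    (Filter.inter_mem (Filter.inter_mem (hU.mem_nhds hx₀) hW) (h1.and h2))
  lift a to ℝ≥0 using ha.le
  have ha' : 0 < a := ha
  set C : ℝ≥0 := ‖A x₀‖₊ + 1 with hC
  obtain ⟨y, hy0, hyU, hy⟩ := exists_hasFDerivAt_of_commute_aux (A := A) (A' := fderiv ℝ A)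
    (x₀ := x₀) (a := a) (C := C) (l := ‖fderiv ℝ A x₀‖₊ + 1) (m := m)
    (fun x hx => ((hA.contDiffAt (hU.mem_nhds (hball hx).1.1)).differentiableAt
      (by simp)).hasFDerivAt)
    (fun x hx => (hball hx).2.1.le) (fun x hx => (hball hx).2.2.le)
    (hm.mono fun x hx => (hball hx).1.2) (fun x hx => hcomm x (hball hx).1.1) (r := a / C)
    (by positivity) (mul_div_cancel₀ a (by positivity)).le
  have hmaps : ∀ s ∈ ball (0 : S) ((a / C : ℝ≥0) : ℝ), y s ∈ U :=
    fun s hs => (hball (hyU s hs)).1.1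
  refine ⟨y, (a / C : ℝ≥0), by positivity, hy0, hmaps, hy, ?_⟩
  have hd : DifferentiableOn ℝ y (ball 0 ((a / C : ℝ≥0) : ℝ)) :=
    fun s hs => (hy s hs).differentiableAt.differentiableWithinAt
  -- the equation `dy = A(y)` raises the order of differentiability
  have hn : ∀ n : ℕ, ContDiffOn ℝ n y (ball 0 ((a / C : ℝ≥0) : ℝ)) := by
    intro n
    induction n with
    | zero => exact contDiffOn_zero.2 hd.continuousOn
    | succ n ih =>
      refine (contDiffOn_succ_iff_fderiv_of_isOpen (n := (n : WithTop ℕ∞)) isOpen_ball).2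
        ⟨hd, fun h => by simp at h, ?_⟩
      refine ((hA.of_le (by exact_mod_cast le_top)).comp ih hmaps).congr fun s hs => ?_
      exact (hy s hs).fderiv
  exact contDiffOn_infty.2 hn

end Frobenius

/-! ### The theorem of Frobenius -/

section FrobeniusTheorem

open Set _root_.Metric

variable {E : Type*} [NormedAddCommGroup E] [NormedSpace ℝ E] [FiniteDimensional ℝ E]

/-- Local integral manifolds in a vector space. The distribution `x ↦ range (P x)` is given by
projectors `P x` with a common kernel `K`; for such a family involutivity means that
`DP(x)(P x v) w - DP(x)(P x w) v` lies in `range (P x)`. -/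
theorem exists_integral_map {U : Set E} (hU : IsOpen U) {x₀ : E} (hx₀ : x₀ ∈ U)
    {P : E → E →L[ℝ] E} (hP : ContDiffOn ℝ ∞ P U) {K : Submodule ℝ E}
    (hidem : ∀ x ∈ U, ∀ u, P x (P x u) = P x u) (hsub : ∀ x ∈ U, ∀ u, u - P x u ∈ K)
    (hK : ∀ x ∈ U, ∀ u ∈ K, P x u = 0)
    (hinv : ∀ x ∈ U, ∀ v w, P x (fderiv ℝ P x (P x v) w - fderiv ℝ P x (P x w) v) =
      fderiv ℝ P x (P x v) w - fderiv ℝ P x (P x w) v) :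
    ∃ (k : ℕ) (r : ℝ) (y : EuclideanSpace ℝ (Fin k) → E)
      (y' : EuclideanSpace ℝ (Fin k) → EuclideanSpace ℝ (Fin k) →L[ℝ] E), 0 < r ∧ y 0 = x₀ ∧
      (∀ s ∈ ball 0 r, y s ∈ U) ∧ ContDiffOn ℝ ∞ y (ball 0 r) ∧ InjOn y (ball 0 r) ∧
      ∀ s ∈ ball 0 r, HasFDerivAt y (y' s) s ∧ Function.Injective (y' s) ∧
        LinearMap.range (y' s).toLinearMap = LinearMap.range (P (y s)).toLinearMap := by
  have hPP : ∀ x ∈ U, ∀ z ∈ U, ∀ u, P x (P z u) = P x u := fun x hx z hz u => by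
    have h := hK x hx _ (hsub z hz u)
    rw [map_sub, sub_eq_zero] at h
    exact h.symm
  let R := LinearMap.range (P x₀).toLinearMap
  -- coordinates on the distribution at the base point
  let e : EuclideanSpace ℝ (Fin (Module.finrank ℝ R)) ≃L[ℝ] R :=
    ContinuousLinearEquiv.ofFinrankEq (by simp)
  let ι : EuclideanSpace ℝ (Fin (Module.finrank ℝ R)) →L[ℝ] E :=
    R.subtypeL.comp e.toContinuousLinearMap
  have hι : Function.Injective ι := Subtype.val_injective.comp e.injective
  have hPι : ∀ s, P x₀ (ι s) = ι s := by
    intro s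
    obtain ⟨u, hu⟩ := (e s).2
    have hu' : P x₀ u = ι s := hu
    rw [← hu', hidem x₀ hx₀]
  have hιP : ∀ u, ∃ s, ι s = P x₀ u := by
    intro u
    refine ⟨e.symm ⟨P x₀ u, u, rfl⟩, ?_⟩
    simp [ι]
  let A : E → EuclideanSpace ℝ (Fin (Module.finrank ℝ R)) →L[ℝ] E := fun x => (P x).comp ι
  have hPd : ∀ x ∈ U, DifferentiableAt ℝ P x := fun x hx =>
    (hP.contDiffAt (hU.mem_nhds hx)).differentiableAt (by simp)
  have hA' : ∀ x ∈ U, ∀ h w, fderiv ℝ A x h w = fderiv ℝ P x h (ι w) := by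
    intro x hx h w
    have h1 := (hPd x hx).hasFDerivAt.clm_comp (hasFDerivAt_const ι x)
    rw [show fderiv ℝ A x = _ from h1.fderiv]
    simp
  -- `P x₀ (P x w)` does not depend on `x`, so the derivatives of `P` take their values in `K`
  have hzero : ∀ x ∈ U, ∀ h w, P x₀ (fderiv ℝ P x h w) = 0 := by
    intro x hx h w
    have h1 : HasFDerivAt (fun z => P x₀ (P z w)) ((P x₀).comp ((fderiv ℝ P x).flip w)) x := by
      refine (P x₀).hasFDerivAt.comp x ?_
      simpa using! (hPd x hx).hasFDerivAt.clm_apply (hasFDerivAt_const w x)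
    have h2 : HasFDerivAt (fun z => P x₀ (P z w)) (0 : E →L[ℝ] E) x := by
      refine (hasFDerivAt_const (P x₀ w) x).congr_of_eventuallyEq ?_
      filter_upwards [hU.mem_nhds hx] with z hz
      exact hPP x₀ hx₀ z hz w
    have h3 := congrArg (fun T : E →L[ℝ] E => T h) (h1.unique h2)
    simpa using h3
  have hcomm : ∀ x ∈ U, ∀ v w, fderiv ℝ A x (A x v) w = fderiv ℝ A x (A x w) v := by
    intro x hx v w
    rw [hA' x hx, hA' x hx]
    change fderiv ℝ P x (P x (ι v)) (ι w) = fderiv ℝ P x (P x (ι w)) (ι v)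
    -- the bracket lies in the range of `P x` and in `K`
    have h1 := hinv x hx (ι v) (ι w)
    rw [← hPP x hx x₀ hx₀, map_sub (P x₀), hzero x hx, hzero x hx, sub_zero, map_zero] at h1
    exact sub_eq_zero.1 h1.symm
  obtain ⟨y, r, hr, hy0, hyU, hyd, hyc⟩ := exists_hasFDerivAt_of_commute hU hx₀
    (hP.clm_comp contDiffOn_const : ContDiffOn ℝ ∞ A U) hcomm
  have hPA : ∀ x ∈ U, ∀ s, P x₀ (A x s) = ι s := fun x hx s =>
    (hPP x₀ hx₀ x hx (ι s)).trans (hPι s)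
  refine ⟨_, r, y, fun s => A (y s), hr, hy0, hyU, hyc, ?_, fun s hs => ⟨hyd s hs, ?_, ?_⟩⟩
  · -- the projection of `y` to the tangent space at the base point is affine
    have h1 : ∀ s ∈ ball (0 : EuclideanSpace ℝ (Fin (Module.finrank ℝ R))) r,
        HasFDerivWithinAt (fun s => P x₀ (y s) - ι s) (0 : _ →L[ℝ] E) (ball 0 r) s := by
      intro s hs
      have h2 := ((P x₀).hasFDerivAt.comp s (hyd s hs)).sub ι.hasFDerivAt
      have h3 : (P x₀).comp (A (y s)) - ι = 0 := by
        ext u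
        simp [hPA (y s) (hyU s hs)]
      rw [h3] at h2
      exact h2.hasFDerivWithinAt
    intro s hs t ht hst
    have h4 := Convex.is_const_of_fderivWithin_eq_zero (𝕜 := ℝ)
      (convex_ball (0 : EuclideanSpace ℝ (Fin (Module.finrank ℝ R))) r)
      (fun s hs => (h1 s hs).differentiableWithinAt)
      (fun s hs => (h1 s hs).fderivWithin (isOpen_ball.uniqueDiffWithinAt hs)) hs ht
    simp only [hst] at h4
    exact hι (sub_right_injective h4)
  · intro u v huv
    apply hι
    rw [← hPA (y s) (hyU s hs) u, ← hPA (y s) (hyU s hs) v]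
    exact congrArg (P x₀) huv
  · ext v
    constructor
    · rintro ⟨u, rfl⟩
      exact ⟨ι u, rfl⟩
    · rintro ⟨u, rfl⟩
      obtain ⟨t, ht⟩ := hιP u
      refine ⟨t, ?_⟩
      change P (y s) (ι t) = P (y s) u
      rw [ht, hPP _ (hyU s hs) _ hx₀]

variable (G : Type) [NormedAddCommGroup G] [NormedSpace ℝ G] [FiniteDimensional ℝ G]

/-- An open ball of `G` as a manifold in the universe `Type u`, with its inclusion. -/
theorem exists_manifold_ball {r : ℝ} (hr : 0 < r) :
    ∃ (L : Type u) (_ : TopologicalSpace L) (_ : T2Space L) (_ : SecondCountableTopology L)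
      (_ : ConnectedSpace L) (_ : ChartedSpace G L) (_ : IsManifold 𝓘(ℝ, G) ∞ L) (e : L → G),
      ContMDiff 𝓘(ℝ, G) 𝓘(ℝ, G) ∞ e ∧ Function.Injective e ∧ range e = ball 0 r ∧
        ∀ q, Function.Bijective (mfderiv 𝓘(ℝ, G) 𝓘(ℝ, G) e q) := by
  let L := ULift.{u} (ball (0 : G) r)
  let e : L → G := fun q => q.down
  have he : Topology.IsOpenEmbedding e :=
    isOpen_ball.isOpenEmbedding_subtypeVal.comp Homeomorph.ulift.isOpenEmbedding
  have : ConnectedSpace (ball (0 : G) r) := Subtype.connectedSpace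
    ((convex_ball 0 r).isConnected ⟨0, mem_ball_self hr⟩)
  have hconn : ConnectedSpace L :=
    Homeomorph.ulift.symm.surjective.connectedSpace Homeomorph.ulift.symm.continuous
  have : Nonempty L := hconn.toNonempty
  let _ : ChartedSpace G L := he.singletonChartedSpace
  have hL : IsManifold 𝓘(ℝ, G) ∞ L := he.isManifold_singleton
  have hL1 : IsManifold 𝓘(ℝ, G) 1 L := he.isManifold_singleton
  have : ProperSpace G := FiniteDimensional.proper ℝ G
  have hrange : range e = ball 0 r := by
    ext x
    exact ⟨fun ⟨q, hq⟩ => hq ▸ q.down.2, fun hx => ⟨⟨⟨x, hx⟩⟩, rfl⟩⟩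
  refine ⟨L, inferInstance, he.isEmbedding.t2Space, he.isEmbedding.secondCountableTopology, hconn,
    inferInstance, hL, e, contMDiff_isOpenEmbedding he, he.injective, hrange, fun q => ?_⟩
  have h1 : (extChartAt 𝓘(ℝ, G) q : L → G) = e := by
    rw [extChartAt_coe]
    exact he.singletonChartedSpace_chartAt_eq (x := q)
  have h2 := isInvertible_mfderiv_extChartAt (I := 𝓘(ℝ, G)) (mem_extChartAt_source (I := 𝓘(ℝ, G)) q)
  rw [h1] at h2
  exact h2.bijective

end FrobeniusTheorem

/-! ### Leaves of an autoparallel distribution -/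

section Integrability

open Set _root_.Metric

variable {F : Type*} [NormedAddCommGroup F] [NormedSpace ℝ F] [FiniteDimensional ℝ F]
  {N : Type*} [TopologicalSpace N] [ChartedSpace F N] [IsManifold 𝓘(ℝ, F) ∞ N]
  {E : Type*} [NormedAddCommGroup E] [NormedSpace ℝ E] [FiniteDimensional ℝ E]

section

variable {M : Type*} [TopologicalSpace M] [ChartedSpace E M] [IsManifold 𝓘(ℝ, E) ∞ M]
  {g : Metric F N} {f : M → N} {D : ∀ p : M, Submodule ℝ (TangentSpace 𝓘(ℝ, E) p)}

/-- The derivative of a chart inverse maps coordinates to tangent vectors. -/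
theorem hasMFDerivAt_extChartAt_symm (p : M) {x : E} (hx : x ∈ (extChartAt 𝓘(ℝ, E) p).target) :
    HasMFDerivAt 𝓘(ℝ, E) 𝓘(ℝ, E) (extChartAt 𝓘(ℝ, E) p).symm x
      (ofCoord (F := E) p ((extChartAt 𝓘(ℝ, E) p).symm x)) := by
  have : IsManifold 𝓘(ℝ, E) 1 M := IsManifold.of_le (n := ∞) (by simp)
  have h1 : MDifferentiableAt 𝓘(ℝ, E) 𝓘(ℝ, E) (extChartAt 𝓘(ℝ, E) p).symm x :=
    ((contMDiffOn_extChartAt_symm (n := ∞) p).contMDiffAt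
      ((isOpen_extChartAt_target p).mem_nhds hx)).mdifferentiableAt (by simp)
  have h2 := TangentBundle.symmL_trivializationAt (I := 𝓘(ℝ, E)) (x₀ := p)
    (x := (extChartAt 𝓘(ℝ, E) p).symm x) (by
      simpa using (extChartAt 𝓘(ℝ, E) p).map_target hx)
  rw [(extChartAt 𝓘(ℝ, E) p).right_inv hx, ModelWithCorners.range_eq_univ,
    mfderivWithin_univ] at h2
  exact h1.hasMFDerivAt.congr_mfderiv h2.symm

/-- The derivative of a chart maps tangent vectors to their coordinates. -/
theorem hasMFDerivAt_extChartAt {x y : N} (hy : y ∈ (chartAt F x).source) :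
    HasMFDerivAt 𝓘(ℝ, F) 𝓘(ℝ, F) (extChartAt 𝓘(ℝ, F) x) y (toCoord (F := F) x y) := by
  have h1 : MDifferentiableAt 𝓘(ℝ, F) 𝓘(ℝ, F) (extChartAt 𝓘(ℝ, F) x) y :=
    (contMDiffAt_extChartAt' (n := ∞) hy).mdifferentiableAt (by simp)
  exact h1.hasMFDerivAt.congr_mfderiv (toCoord_eq_mfderiv hy).symm

/-- The covariant derivative of a tangent vector field which is `A` in coordinates: the second
derivative of the immersion, the derivative of `A` and the Christoffel symbols. -/
theorem ambientCov_eq_of_coord (hf : IsSmoothImmersion E F f) (p : M) {x : E}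
    (hx : x ∈ (extChartAt 𝓘(ℝ, E) p).target) {X Z : ∀ q : M, TangentSpace 𝓘(ℝ, E) q}
    (hZ : IsSmoothField Z) {A : E → E} (hA : DifferentiableAt ℝ A x)
    (hZA : ∀ᶠ z in nhds x, Z ((extChartAt 𝓘(ℝ, E) p).symm z) =
      ofCoord p ((extChartAt 𝓘(ℝ, E) p).symm z) (A z)) {v : E}
    (hX : X ((extChartAt 𝓘(ℝ, E) p).symm x) = ofCoord p ((extChartAt 𝓘(ℝ, E) p).symm x) v)
    {q : M} (hq : (extChartAt 𝓘(ℝ, E) p).symm x = q) {Φ : E → F}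
    (hΦ : Φ = fun z => extChartAt 𝓘(ℝ, F) (f q) (f ((extChartAt 𝓘(ℝ, E) p).symm z))) :
    ContDiffAt ℝ ∞ Φ x ∧ (∀ u, fderiv ℝ Φ x u = diff E F f q (ofCoord p q u)) ∧
    ambientCov g f X Z q = (show TangentSpace 𝓘(ℝ, F) (f q) from
      fderiv ℝ (fderiv ℝ Φ) x v (A x) + fderiv ℝ Φ x (fderiv ℝ A x v)) +
      christoffel g.form (f q) (diff E F f q (X q)) (diff E F f q (Z q)) := by
  subst hq
  set ρ := (extChartAt 𝓘(ℝ, E) p).symm with hρ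
  set c := extChartAt 𝓘(ℝ, F) (f (ρ x)) with hc
  have hρs : ContMDiffOn 𝓘(ℝ, E) 𝓘(ℝ, E) ∞ ρ (extChartAt 𝓘(ℝ, E) p).target :=
    contMDiffOn_extChartAt_symm p
  have hρx : ContMDiffAt 𝓘(ℝ, E) 𝓘(ℝ, E) ∞ ρ x :=
    hρs.contMDiffAt ((isOpen_extChartAt_target p).mem_nhds hx)
  have hev : ∀ᶠ z in nhds x, z ∈ (extChartAt 𝓘(ℝ, E) p).target ∧
      f (ρ z) ∈ (chartAt F (f (ρ x))).source :=
    ((isOpen_extChartAt_target p).eventually_mem hx).and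
      ((hf.smooth.continuous.continuousAt.comp hρx.continuousAt).eventually
        (eventually_mem_chart_source (F := F) (f (ρ x))))
  have hder : ∀ z, z ∈ (extChartAt 𝓘(ℝ, E) p).target →
      f (ρ z) ∈ (chartAt F (f (ρ x))).source → ∀ u,
      fderiv ℝ Φ z u = toCoord (f (ρ x)) (f (ρ z)) (diff E F f (ρ z) (ofCoord p (ρ z) u)) := by
    intro z hz hz' u
    have h1 := hasMFDerivAt_extChartAt_symm p hz
    have h2 := ((hf.smooth (ρ z)).mdifferentiableAt (by simp)).hasMFDerivAt
    have h3 := hasMFDerivAt_extChartAt hz'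
    have h4 := h3.comp z (h2.comp z h1)
    rw [hΦ, ← mfderiv_eq_fderiv]
    exact congrArg (fun T : E →L[ℝ] F => T u) h4.mfderiv
  have hΦx : ContDiffAt ℝ ∞ Φ x := by
    rw [hΦ]
    exact ((contMDiffAt_extChartAt (n := ∞)).comp x ((hf.smooth (ρ x)).comp x hρx)).contDiffAt
  refine ⟨hΦx, fun u => ?_, ?_⟩
  · rw [hder x hx (mem_chart_source F _)]
    exact toCoord_self _ _
  · have h1 := mvfderiv_comp_vec (h := fun q => toCoord (f (ρ x)) (f q) (diff E F f q (Z q)))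
      (smoothAlong_diff hf.smooth (hZ (ρ x))).diffAlong
      (hρx.mdifferentiableAt (by simp)) v
    have h2 : HasFDerivAt (fun z => fderiv ℝ Φ z (A z))
        ((fderiv ℝ Φ x).comp (fderiv ℝ A x) + (fderiv ℝ (fderiv ℝ Φ) x).flip (A x)) x :=
      ((hΦx.fderiv_right (m := ∞) (by simp)).differentiableAt (by simp)).hasFDerivAt.clm_apply
        hA.hasFDerivAt
    have h3 : HasFDerivAt (fun z => toCoord (f (ρ x)) (f (ρ z)) (diff E F f (ρ z) (Z (ρ z))))
        ((fderiv ℝ Φ x).comp (fderiv ℝ A x) + (fderiv ℝ (fderiv ℝ Φ) x).flip (A x)) x := by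
      refine h2.congr_of_eventuallyEq ?_
      filter_upwards [hev, hZA] with z hz hz'
      rw [hder z hz.1 hz.2, hz']
    have h4 := congrArg (fun T : E →L[ℝ] F => T v) h3.hasMFDerivAt.mfderiv
    rw [(hasMFDerivAt_extChartAt_symm p hx).mfderiv] at h1
    have h5 := h1.symm.trans h4
    rw [ambientCov, covAlong_eq, hX]
    refine congrArg (· + _) (h5.trans ?_)
    simp [add_comm]

/-- An autoparallel distribution is involutive: `∇̄_X Z - ∇̄_Z X` is the image of the bracket, since
the second derivatives of the immersion and the Christoffel symbols are symmetric. -/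
theorem IsAutoparallel.bracket_mem [T2Space M] (hf : IsSmoothImmersion E F f)
    (h : IsAutoparallel g f (perp g f D)) {p : M} {V : Set M} (hV : IsOpen V)
    (hVp : V ⊆ (chartAt E p).source) {P : M → E →L[ℝ] E}
    (hP : ContMDiffOn 𝓘(ℝ, E) 𝓘(ℝ, E →L[ℝ] E) ∞ P V)
    (hPm : ∀ q ∈ V, ∀ u, ofCoord p q (P q u) ∈ perp g f D q) {x : E}
    (hx : x ∈ (extChartAt 𝓘(ℝ, E) p).target) (hxV : (extChartAt 𝓘(ℝ, E) p).symm x ∈ V)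
    {P' : E → E →L[ℝ] E} (hP' : P' = fun z => P ((extChartAt 𝓘(ℝ, E) p).symm z)) (v w : E) :
    ofCoord p ((extChartAt 𝓘(ℝ, E) p).symm x)
      (fderiv ℝ P' x (P' x v) w - fderiv ℝ P' x (P' x w) v) ∈
        perp g f D ((extChartAt 𝓘(ℝ, E) p).symm x) := by
  set ρ := (extChartAt 𝓘(ℝ, E) p).symm with hρ
  have hev : ∀ᶠ z in nhds x, ρ z ∈ V := by
    have h1 : ContinuousAt ρ x := (contMDiffOn_extChartAt_symm (n := ∞) p).continuousOn.continuousAt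
      ((isOpen_extChartAt_target p).mem_nhds hx)
    exact h1.eventually (hV.mem_nhds hxV)
  have hP'x : ContDiffAt ℝ ∞ P' x := by
    rw [hP']
    exact ((hP.contMDiffAt (hV.mem_nhds hxV)).comp x
      ((contMDiffOn_extChartAt_symm (n := ∞) p).contMDiffAt
        ((isOpen_extChartAt_target p).mem_nhds hx))).contDiffAt
  have hP'd : DifferentiableAt ℝ P' x := hP'x.differentiableAt (by simp)
  have hsec : ∀ u : E, ∃ Z, IsSection (perp g f D) Z ∧
      ∀ᶠ z in nhds x, Z (ρ z) = ofCoord p (ρ z) (P' z u) := by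
    intro u
    have hs : ContMDiffOn 𝓘(ℝ, E) (𝓘(ℝ, E).prod 𝓘(ℝ, E)) ∞
        (fun q => (⟨q, ofCoord p q (P q u)⟩ : TangentBundle 𝓘(ℝ, E) M)) V :=
      contMDiffOn_ofCoord_apply hV hVp (hP.clm_apply contMDiffOn_const)
    obtain ⟨ψ, h1, h2, h3⟩ := exists_smooth_extension hV hxV hs
    refine ⟨_, ⟨h1, fun q => ?_⟩, ?_⟩
    · by_cases hq : q ∈ V
      · exact Submodule.smul_mem _ _ (hPm q hq _)
      · simp [h3 q hq]
    · have h4 : ContinuousAt ρ x :=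
        (contMDiffOn_extChartAt_symm (n := ∞) p).continuousOn.continuousAt
          ((isOpen_extChartAt_target p).mem_nhds hx)
      filter_upwards [h4.eventually h2] with z hz
      rw [hz, one_smul, hP']
  obtain ⟨X, hX, hXe⟩ := hsec v
  obtain ⟨Z, hZ, hZe⟩ := hsec w
  have hd : ∀ u, DifferentiableAt ℝ (fun z => P' z u) x := fun u =>
    hP'd.clm_apply (differentiableAt_const u)
  have hd' : ∀ u a, fderiv ℝ (fun z => P' z u) x a = fderiv ℝ P' x a u := by
    intro u a
    rw [(hP'd.hasFDerivAt.clm_apply (hasFDerivAt_const u x)).fderiv]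
    simp
  obtain ⟨hΦ, hΦd, e1⟩ := ambientCov_eq_of_coord (g := g) hf p hx hZ.1 (hd w) hZe
    hXe.self_of_nhds rfl rfl
  obtain ⟨-, -, e2⟩ := ambientCov_eq_of_coord (g := g) hf p hx hX.1 (hd v) hXe
    hZe.self_of_nhds rfl rfl
  have hsymm := (hΦ.isSymmSndFDerivAt (by
    simpa using (WithTop.coe_le_coe.2 le_top : ((2 : ℕ∞) : WithTop ℕ∞) ≤ (⊤ : ℕ∞)))).eq
    (P' x v) (P' x w)
  set b := fderiv ℝ P' x (P' x v) w - fderiv ℝ P' x (P' x w) v with hb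
  obtain ⟨t, ht, hte⟩ := Submodule.sub_mem _ (h X Z hX hZ (ρ x)) (h Z X hZ hX (ρ x))
  have e3 : diff E F f (ρ x) t = diff E F f (ρ x) (ofCoord p (ρ x) b) := by
    refine hte.trans ?_
    rw [e1, e2, christoffel_symm g (f (ρ x)) (diff E F f (ρ x) (Z (ρ x))), hsymm,
      ← hΦd b, hb, map_sub, hd', hd']
    refine (add_sub_add_right_eq_sub _ _ _).trans ?_
    exact add_sub_add_left_eq_sub _ _ _
  rw [← hf.injective_diff _ e3]
  exact ht

end

/-- Through each point of the manifold there passes a connected integral manifold of an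
autoparallel distribution. -/
theorem IsAutoparallel.exists_integralManifold {M : Type u} [TopologicalSpace M] [T2Space M]
    [ChartedSpace E M] [IsManifold 𝓘(ℝ, E) ∞ M] {g : Metric F N} {f : M → N}
    {D : ∀ p : M, Submodule ℝ (TangentSpace 𝓘(ℝ, E) p)} (hf : IsSmoothImmersion E F f)
    (hD : IsSmoothDistribution D) (h : IsAutoparallel g f (perp g f D)) (p : M) :
    ∃ (k : ℕ) (L : Type u) (_ : TopologicalSpace L) (_ : T2Space L)
      (_ : SecondCountableTopology L) (_ : ConnectedSpace L)
      (_ : ChartedSpace (EuclideanSpace ℝ (Fin k)) L)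
      (_ : IsManifold 𝓘(ℝ, EuclideanSpace ℝ (Fin k)) ∞ L) (j : L → M),
      IsIntegralManifold (G := EuclideanSpace ℝ (Fin k)) (perp g f D) j ∧ p ∈ Set.range j := by
  obtain ⟨V, hV, hp, hVp, P, K, hP, hPK⟩ := exists_perp_projector hf hD g p
  let κ := extChartAt 𝓘(ℝ, E) p
  have hsrc : κ.source = (chartAt E p).source := extChartAt_source _ p
  let U := κ.target ∩ κ.symm ⁻¹' V
  have hsymm : ContMDiffOn 𝓘(ℝ, E) 𝓘(ℝ, E) ∞ κ.symm κ.target := contMDiffOn_extChartAt_symm p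
  have hU : IsOpen U := hsymm.continuousOn.isOpen_inter_preimage (isOpen_extChartAt_target p) hV
  have hx₀ : κ p ∈ U := by
    refine ⟨mem_extChartAt_target p, ?_⟩
    change κ.symm (κ p) ∈ V
    rw [κ.left_inv (mem_extChartAt_source p)]
    exact hp
  have hP' : ContDiffOn ℝ ∞ (fun z => P (κ.symm z)) U :=
    (hP.comp (hsymm.mono inter_subset_left) fun z hz => hz.2).contDiffOn
  obtain ⟨k, r, y, y', hr, hy0, hyU, hyc, hyi, hy⟩ := exists_integral_map hU hx₀ hP' (K := K)
    (fun x hx u => (hPK _ hx.2).2.1 _ ((hPK _ hx.2).1 u)) (fun x hx => (hPK _ hx.2).2.2.1)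
    (fun x hx => (hPK _ hx.2).2.2.2)
    (fun x hx v w => (hPK _ hx.2).2.1 _
      (h.bracket_mem hf hV hVp hP (fun q hq => (hPK q hq).1) hx.1 hx.2 rfl v w))
  obtain ⟨L, _, _, _, _, _, _, e, he, hei, her, hed⟩ :=
    exists_manifold_ball.{u} (EuclideanSpace ℝ (Fin k)) hr
  have heb : ∀ q, e q ∈ ball (0 : EuclideanSpace ℝ (Fin k)) r := fun q => her ▸ mem_range_self q
  have hyq : ∀ q, y (e q) ∈ U := fun q => hyU _ (heb q)
  have hdiff : ∀ q w, diff (EuclideanSpace ℝ (Fin k)) E (fun q => κ.symm (y (e q))) q w =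
      ofCoord p (κ.symm (y (e q))) (y' (e q) (mfderiv 𝓘(ℝ, EuclideanSpace ℝ (Fin k))
        𝓘(ℝ, EuclideanSpace ℝ (Fin k)) e q w)) := by
    intro q w
    have h1 := (he q).mdifferentiableAt (by simp) |>.hasMFDerivAt
    have h2 := (hy (e q) (heb q)).1.hasMFDerivAt
    have h3 := hasMFDerivAt_extChartAt_symm p (hyq q).1
    have h4 := (h3.comp (e q) h2).comp q h1
    exact congrArg (fun T : EuclideanSpace ℝ (Fin k) →L[ℝ] E => T w) h4.mfderiv
  refine ⟨k, L, _, ‹_›, ‹_›, ‹_›, _, ‹_›, fun q => κ.symm (y (e q)),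
    ⟨⟨?_, fun q v w hvw => ?_⟩, ?_, fun q => ?_⟩, ?_⟩
  · exact hsymm.comp_contMDiff
      (hyc.contMDiffOn.comp_contMDiff he heb) fun q => (hyq q).1
  · rw [hdiff, hdiff] at hvw
    have h1 := congrArg (toCoord p (κ.symm (y (e q)))) hvw
    rw [toCoord_ofCoord (hVp (hyq q).2), toCoord_ofCoord (hVp (hyq q).2)] at h1
    exact (hed q).1 ((hy _ (heb q)).2.1 h1)
  · intro a b hab
    exact hei (hyi (heb a) (heb b) (κ.symm.injOn (hyq a).1 (hyq b).1 hab))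
  · ext v
    have hr' := (hy _ (heb q)).2.2
    constructor
    · rintro ⟨w, rfl⟩
      obtain ⟨u, hu⟩ := hr'.le ⟨mfderiv 𝓘(ℝ, EuclideanSpace ℝ (Fin k))
        𝓘(ℝ, EuclideanSpace ℝ (Fin k)) e q w, rfl⟩
      refine (hdiff q w).symm ▸ ?_
      exact hu ▸ (hPK _ (hyq q).2).1 u
    · intro hv
      have h1 := (hPK _ (hyq q).2).2.1 (toCoord p (κ.symm (y (e q))) v)
        (by rw [ofCoord_toCoord (hVp (hyq q).2)]; exact hv)
      obtain ⟨t, ht⟩ := hr'.ge ⟨_, h1⟩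
      obtain ⟨w, hw⟩ := (hed q).2 t
      refine ⟨w, (hdiff q w).trans ?_⟩
      rw [hw]
      exact (congrArg _ ht).trans (ofCoord_toCoord (hVp (hyq q).2) v)
  · obtain ⟨q, hq⟩ := her.ge (mem_ball_self hr)
    refine ⟨q, ?_⟩
    change κ.symm (y (e q)) = p
    rw [hq, hy0, κ.left_inv (mem_extChartAt_source p)]

end Integrability

end

end LCK

/-- Characterization of totally real ruled CR-submanifolds of locally conformal Kähler
manifolds. -/
theorem mainTheorem1
    {F : Type*} [NormedAddCommGroup F] [NormedSpace ℝ F] [FiniteDimensional ℝ F]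
    {N : Type*} [TopologicalSpace N] [T2Space N] [SecondCountableTopology N]
    [ChartedSpace F N] [IsManifold 𝓘(ℝ, F) ∞ N]
    {E : Type*} [NormedAddCommGroup E] [NormedSpace ℝ E] [FiniteDimensional ℝ E]
    {M : Type u} [TopologicalSpace M] [T2Space M] [SecondCountableTopology M]
    [ChartedSpace E M] [IsManifold 𝓘(ℝ, E) ∞ M]
    (g : LCK.Metric F N)
    (J : ∀ x : N, TangentSpace 𝓘(ℝ, F) x →L[ℝ] TangentSpace 𝓘(ℝ, F) x)
    (hN : LCK.IsLCK g J)
    (η : ∀ x : N, TangentSpace 𝓘(ℝ, F) x →L[ℝ] ℝ) (hη : LCK.IsLeeForm g J η)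
    (f : M → N) (D : ∀ p : M, Submodule ℝ (TangentSpace 𝓘(ℝ, E) p))
    (hM : LCK.IsCRSubmanifold g J f D) :
    List.TFAE [
      LCK.IsRuled g f (LCK.perp g f D),
      LCK.IsPerpGeodesic g f D ∧ LCK.ThetaRelation g J η f D,
      LCK.ThetaRelation g J η f D ∧ LCK.SecondFormInMu g J f D ∧
        LCK.NormalRelation g J η f D] := by
  have hf := hM.immersion
  have hruled : LCK.IsRuled g f (LCK.perp g f D) ↔ LCK.IsAutoparallel g f (LCK.perp g f D) :=
    ⟨LCK.IsRuled.isAutoparallel hf hM.smooth, fun h =>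
      ⟨h.exists_integralManifold hf hM.smooth, fun k L _ _ _ _ _ _ j hj =>
        h.isTotallyGeodesic hf hM.smooth hj⟩⟩
  tfae_have 1 ↔ 2 := hruled.trans (LCK.perpGeodesic_and_theta_iff hN hη hM).symm
  tfae_have 1 ↔ 3 := hruled.trans (LCK.theta_and_normalRelation_iff hN hη hM).symm
  tfae_finish
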